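/- **Setting.** Fix $d$ and write $L^p=L^p(\mathbb R^d)$, $W^{k,p}=W^{k,p}(\mathbb R^d)$ for $p\in[1,\infty]$ and integers $-3\le k\le 3$. For $k\ge 0$ these are the usual Sobolev spaces, normed by $\sum_{|\gamma|\le k}|\partial^\gamma u|_{L^p}$ (or equivalently). For $k<0$, $W^{k,p}$ is the space of distributions $u=\sum_{|\gamma|\le -k}\partial^\gamma f_\gamma$ with $f_\gamma\in L^p$, normed by the infimum of $\sum_\gamma |f_\gamma|_{L^p}$ over all such representations. Let $T>0$ and $\Delta=\{(s,t):0\le s\le t\le T\}$. A *control* on an interval $[a,b]$ is a continuous map $\omega:\{(s,t):a\le s\le t\le b\}\to[0,\infty)$ with $\omega(s,\theta)+\omega(\theta,t)\le\omega(s,t)$ for $s\le\theta\le t$. For a Banach space $E$, $\gamma>0$ and a two-index map $g$ with values in $E$, $\|g\|_{\mathcal V_2^\gamma(a,b;E)}$ is the infimum of $\omega(a,b)^\gamma$ over the controls $\omega$ on $[a,b]$ with $|g_{st}|_E\le\omega(s,t)^\gamma$ for all $a\le s\le t\le b$ (it is $\infty$ if there is none); $g$ has finite $1/\gamma$-variation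 on $[a,b]$ if it is finite. "Locally" means: on a neighbourhood, in $[0,T]$, of each point of $[0,T]$. Write $\delta v_{st}=v_t-v_s$. An *unbounded rough driver* on the scale $(W^{k,p})_{-3\le k\le 3}$ of regularity $\alpha$, with control $\omega_B$ on $[0,T]$, is a family $\mathbf B=(B^1_{st},B^2_{st})_{(s,t)\in\Delta}$ of linear operators such that, for $i=1,2$ and all $-3+i\le k\le 3$, $B^i_{st}$ maps $W^{k,p}$ to $W^{k-i,p}$ with operator norm at most $\omega_B(s,t)^{i\alpha}$, and for $s\le\theta\le t$ $$B^1_{st}-B^1_{s\theta}-B^1_{\theta t}=0,\qquad B^2_{st}-B^2_{s\theta}-B^2_{\theta t}=B^1_{\theta t}\circ B^1_{s\theta}.$$ **Proposition 3.5 (Remainder estimates).** Let $\alpha\in(1/3,1/2]$. There are constants $C,L>0$, depending only on $\alpha$ and on the space dimension $d$, such that the following holds for all $p\in[1,\infty]$, all $T>0$ and every unbounded rough driver $\mathbf B$ as above. Let $v:[0,T]\to L^p$ be essentially bounded, let $f\in L^p(0,T;W^{-2,p})$, and assume that $dv=f\,dt+d\mathbf B\,v$, that is, the remainder $$v^\natural_{st}:=\delta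 v_{st}-\int_s^t f_r\,dr-(B^1_{st}+B^2_{st})v_s,\qquad (s,t)\in\Delta,$$ has, for some $z>1$, locally finite $1/z$-variation in $W^{-3,p}$. Then: 1. $v^\natural$ has locally finite $\frac1{3\alpha}$-variation in $W^{-3,p}$. 2. For each $(s,t)\in\Delta$ with $\omega_B(s,t)\le L$, $$\|v^\natural\|_{\mathcal V_2^{3\alpha}(s,t;W^{-3,p})}\le C\Big(\omega_B(s,t)^{3\alpha}\,\|v\|_{L^\infty(s,t;L^p)}+\omega_B(s,t)^{\alpha}\int_s^t|f_r|_{W^{-2,p}}\,dr\Big).$$ 3. For each $(s,t)\in\Delta$ with $\omega_B(s,t)+\int_s^t|f_r|_{W^{-2,p}}\,dr\le L$, $$\|\delta v\|_{\mathcal V_2^{\alpha}(s,t;W^{-1,p})}\le C\big(1+\|v\|_{L^\infty(s,t;L^p)}\big)\Big[\Big(\int_s^t|f_r|_{W^{-2,p}}\,dr\Big)^{\alpha}+\omega_B(s,t)^{\alpha}\Big].$$ -/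

import Mathlib

open MeasureTheory Set
open scoped ENNReal Distributions LineDeriv

noncomputable section

namespace RoughPDE

/-! ### Sobolev spaces of integer order on the whole space -/

/-- The space `ℝ^d` with its Euclidean norm. -/
abbrev Sp (d : ℕ) : Type := EuclideanSpace ℝ (Fin d)

/-- Real-valued (Schwartz) distributions on `ℝ^d`. -/
abbrev Dist (d : ℕ) : Type := 𝓓'((⊤ : TopologicalSpace.Opens (Sp d)), ℝ)

/-- Real-valued Lebesgue spaces `L^p(ℝ^d)`. -/
abbrev LpSp (d : ℕ) (p : ℝ≥0∞) : Type := Lp ℝ p (volume : Measure (Sp d))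

/-- The distribution `φ ↦ ∫ φ(x) f(x) dx` attached to `f ∈ L^p(ℝ^d)`. -/
def lpDist {d : ℕ} {p : ℝ≥0∞} (f : LpSp d p) : Dist d :=
  TestFunction.integralAgainstBilinCLM (ContinuousLinearMap.mul ℝ ℝ) volume f

lemma lpDist_apply {d : ℕ} {p : ℝ≥0∞} [Fact (1 ≤ p)] (f : LpSp d p)
    (φ : 𝓓((⊤ : TopologicalSpace.Opens (Sp d)), ℝ)) :
    lpDist f φ = ∫ x, φ x * f x := by
  have hf : LocallyIntegrable f (volume : Measure (Sp d)) :=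
    (Lp.memLp f).locallyIntegrable Fact.out
  exact TestFunction.integralAgainstBilinCLM_eq_integral (hf.locallyIntegrableOn _)

/-- Derivatives of order at most `k` are indexed by their order `j ≤ k` together with the list of
the `j` coordinate directions in which one differentiates. Mixed derivatives are listed with
multiplicity, which changes Sobolev norms of positive order only to equivalent ones (with
constants depending on `d` and `k` alone), and those of negative order not at all. -/
abbrev DerivIdx (d k : ℕ) : Type := Σ j : Fin (k + 1), (Fin (j : ℕ) → Fin d)

/-- The partial derivative `∂_{i₁} ⋯ ∂_{i_j} u` of a distribution. -/
def partialD {d k : ℕ} (m : DerivIdx d k) (u : Dist d) : Dist d :=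
  ∂^{fun i => (EuclideanSpace.single (m.2 i) (1 : ℝ) : Sp d)} u

/-- Families `(f_m)` of `L^p` functions indexed by the derivatives of order at most `k`, normed
by `∑_m ‖f_m‖_{L^p}`. -/
abbrev LpFam (d k : ℕ) (p : ℝ≥0∞) : Type := PiLp 1 (fun _ : DerivIdx d k => LpSp d p)

/-- The linear map `(f_m) ↦ ∑_m ∂_m f_m` from families of `L^p` functions to distributions. -/
def divMap (d k : ℕ) (p : ℝ≥0∞) [Fact (1 ≤ p)] : LpFam d k p →ₗ[ℝ] Dist d where
  toFun g := ∑ m, partialD m (lpDist (g m))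
  map_add' g h := by
    have key : ∀ a b : LpSp d p, lpDist (a + b) = lpDist a + lpDist b := by
      intro a b
      ext φ
      have e : ∀ c : LpSp d p, Integrable (fun x => φ x * c x) (volume : Measure (Sp d)) :=
        fun c => TestFunction.integrable_bilin (ContinuousLinearMap.mul ℝ ℝ)
          (((Lp.memLp c).locallyIntegrable Fact.out).locallyIntegrableOn _) φ
      change lpDist (a + b) φ = lpDist a φ + lpDist b φ
      rw [lpDist_apply, lpDist_apply, lpDist_apply, ← integral_add (e a) (e b)]
      refine integral_congr_ae ?_
      filter_upwards [Lp.coeFn_add a b] with x hx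
      rw [hx, Pi.add_apply, mul_add]
    simp [key, partialD, LineDeriv.iteratedLineDerivOp_add, Finset.sum_add_distrib]
  map_smul' c g := by
    have key : ∀ a : LpSp d p, lpDist (c • a) = c • lpDist a := by
      intro a
      ext φ
      change lpDist (c • a) φ = c * lpDist a φ
      rw [lpDist_apply, lpDist_apply, ← integral_const_mul]
      refine integral_congr_ae ?_
      filter_upwards [Lp.coeFn_smul c a] with x hx
      rw [hx, Pi.smul_apply, smul_eq_mul]
      ring
    simp [key, partialD, LineDeriv.iteratedLineDerivOp_smul, Finset.smul_sum]

/-- The norm of `W^{k,p}(ℝ^d)`, `k ∈ ℤ`, as an extended-valued function on distributions; it is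
finite exactly on `W^{k,p}`.
* For `k ≥ 0` it is `∑_m ‖∂_m u‖_{L^p}`, the sum running over all derivatives of order at
  most `k`, and `∞` if one of these derivatives is not in `L^p`.
* For `k < 0` it is the infimum of `∑_m ‖f_m‖_{L^p}` over all representations
  `u = ∑_m ∂_m f_m` with derivatives of order at most `-k`, and `∞` if there is none. -/
def sobNorm {d : ℕ} (p : ℝ≥0∞) [Fact (1 ≤ p)] : ℤ → Dist d → ℝ≥0∞
  | Int.ofNat k, u => ⨅ (g : LpFam d k p) (_ : ∀ m, partialD m u = lpDist (g m)), ‖g‖ₑ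
  | Int.negSucc k, u => ⨅ (g : LpFam d (k + 1) p) (_ : divMap d (k + 1) p g = u), ‖g‖ₑ

lemma exists_testFunction_iteratedLineDerivOp {d n : ℕ} (v : Fin n → Sp d)
    (φ : 𝓓((⊤ : TopologicalSpace.Opens (Sp d)), ℝ)) :
    ∃ ψ : 𝓓((⊤ : TopologicalSpace.Opens (Sp d)), ℝ), ∀ u : Dist d, (∂^{v} u) φ = u ψ := by
  induction n generalizing φ with
  | zero => exact ⟨φ, fun u => rfl⟩
  | succ n ih =>
    obtain ⟨ψ, hψ⟩ := ih (Fin.tail v) (-∂_{v 0} φ)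
    refine ⟨ψ, fun u => ?_⟩
    rw [LineDeriv.iteratedLineDerivOp_succ_left, Distribution.lineDerivOp_apply_apply]
    exact hψ u

lemma continuous_lpDist_apply {d : ℕ} {p : ℝ≥0∞} [hp : Fact (1 ≤ p)]
    (φ : 𝓓((⊤ : TopologicalSpace.Opens (Sp d)), ℝ)) :
    Continuous (fun f : LpSp d p => lpDist f φ) := by
  have hpq : ENNReal.HolderConjugate p (1 - p⁻¹)⁻¹ :=
    ENNReal.HolderConjugate.inv_one_sub_inv' hp.out
  have : Fact (1 ≤ (1 - p⁻¹)⁻¹) := by simp [fact_iff]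
  have hφ : MemLp φ (1 - p⁻¹)⁻¹ (volume : Measure (Sp d)) :=
    φ.continuous.memLp_of_hasCompactSupport φ.hasCompactSupport
  have h := (((ContinuousLinearMap.mul ℝ ℝ).lpPairing (volume : Measure (Sp d)) p
    (1 - p⁻¹)⁻¹).flip (hφ.toLp φ)).continuous
  refine h.congr fun f => ?_
  rw [ContinuousLinearMap.flip_apply, ContinuousLinearMap.lpPairing_eq_integral, lpDist_apply]
  refine integral_congr_ae ?_
  filter_upwards [hφ.coeFn_toLp] with x hx
  rw [hx, ContinuousLinearMap.mul_apply', mul_comm]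

instance isClosed_ker_divMap (d k : ℕ) (p : ℝ≥0∞) [Fact (1 ≤ p)] :
    IsClosed ((LinearMap.ker (divMap d k p) : Submodule ℝ (LpFam d k p)) : Set (LpFam d k p)) := by
  have h : ((LinearMap.ker (divMap d k p) : Submodule ℝ (LpFam d k p)) : Set (LpFam d k p))
      = ⋂ φ : 𝓓((⊤ : TopologicalSpace.Opens (Sp d)), ℝ), {g | (divMap d k p g) φ = 0} := by
    ext g
    simp only [SetLike.mem_coe, LinearMap.mem_ker, mem_iInter, mem_ofPred_eq]
    exact ⟨fun h φ => by rw [h]; rfl, fun h => by ext φ; exact h φ⟩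
  rw [h]
  refine isClosed_iInter fun φ => isClosed_eq ?_ continuous_const
  have : ∀ g : LpFam d k p, (divMap d k p g) φ = ∑ m, (partialD m (lpDist (g m))) φ := by
    intro g
    let ev : Dist d →ₗ[ℝ] ℝ :=
      { toFun := fun u => u φ, map_add' := fun _ _ => rfl, map_smul' := fun _ _ => rfl }
    exact map_sum ev (fun m => partialD m (lpDist (g m))) Finset.univ
  simp only [this]
  refine continuous_finsetSum _ fun m _ => ?_
  obtain ⟨ψ, hψ⟩ := exists_testFunction_iteratedLineDerivOp
    (fun i => (EuclideanSpace.single (m.2 i) (1 : ℝ) : Sp d)) φ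
  have e : ∀ g : LpFam d k p, (partialD m (lpDist (g m))) φ = lpDist (g m) ψ := fun g => hψ _
  simp only [e]
  exact (continuous_lpDist_apply ψ).comp (by fun_prop)

/-- The Banach space `W^{-k,p}(ℝ^d)`: the range of `(f_m) ↦ ∑_m ∂_m f_m`, realised as the
quotient by the kernel of this map, with the quotient norm (the infimum of `∑_m ‖f_m‖_{L^p}` over
all representations). -/
abbrev NegSobolev (d k : ℕ) (p : ℝ≥0∞) [Fact (1 ≤ p)] : Type :=
  LpFam d k p ⧸ LinearMap.ker (divMap d k p)

/-- The (injective) embedding of `W^{-k,p}(ℝ^d)` into the distributions. -/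
def negDist {d k : ℕ} {p : ℝ≥0∞} [Fact (1 ≤ p)] : NegSobolev d k p →ₗ[ℝ] Dist d :=
  (LinearMap.ker (divMap d k p)).liftQ (divMap d k p) le_rfl

/-! ### Controls and variation -/

/-- `ω` is a control on `[a,b]`: a continuous superadditive map from
`{(s,t) : a ≤ s ≤ t ≤ b}` to `[0,∞)`. -/
structure IsControl (a b : ℝ) (ω : ℝ → ℝ → ℝ) : Prop where
  continuousOn : ContinuousOn (fun q : ℝ × ℝ => ω q.1 q.2) {q | a ≤ q.1 ∧ q.1 ≤ q.2 ∧ q.2 ≤ b}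
  nonneg : ∀ s t, a ≤ s → s ≤ t → t ≤ b → 0 ≤ ω s t
  superadditive : ∀ s θ t, a ≤ s → s ≤ θ → θ ≤ t → t ≤ b → ω s θ + ω θ t ≤ ω s t

/-- The norm of the two-index map `g` in `𝒱₂^γ(a,b;E)`, where `N` is the norm of `E`: the infimum
of `ω(a,b)^γ` over the controls `ω` on `[a,b]` such that `N(g_{st}) ≤ ω(s,t)^γ` for all
`a ≤ s ≤ t ≤ b`. It is `∞` if there is no such control, that is, if `g` does not belong to
`𝒱₂^γ(a,b;E)`; otherwise `g` has finite `1/γ`-variation on `[a,b]`. -/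
def varNorm {X : Type*} (N : X → ℝ≥0∞) (γ a b : ℝ) (g : ℝ → ℝ → X) : ℝ≥0∞ :=
  ⨅ (ω : ℝ → ℝ → ℝ) (_ : IsControl a b ω ∧
    ∀ s t, a ≤ s → s ≤ t → t ≤ b → N (g s t) ≤ ENNReal.ofReal (ω s t ^ γ)),
    ENNReal.ofReal (ω a b ^ γ)

/-- `g ∈ 𝒱_{2,loc}^γ(0,T;E)`: every point of `[0,T]` has a neighbourhood in `[0,T]` on which `g`
has finite `1/γ`-variation. -/
def LocFiniteVar {X : Type*} (N : X → ℝ≥0∞) (γ T : ℝ) (g : ℝ → ℝ → X) : Prop :=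
  ∀ r ∈ Icc 0 T, ∃ ε > 0, varNorm N γ (max 0 (r - ε)) (min T (r + ε)) g < ∞

/-! ### Unbounded rough drivers and rough equations -/

/-- `(B¹,B²)` is a `𝒱^α`-unbounded rough driver on `[0,T]` acting on the scale
`(W^{k,p}(ℝ^d))_{-3 ≤ k ≤ 3}`, with control `ω` (the control `ω_B`).

`B^i_{st}` is a linear operator from `W^{-3+i,p}`, the largest space of the scale on which it acts,
to `W^{-3,p}`. As a linear map on a linear subspace can always be extended linearly, it is written
as a linear map on all distributions; nothing is required of its values outside `W^{-3+i,p}`. -/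
structure IsRoughDriver {d : ℕ} (p : ℝ≥0∞) [Fact (1 ≤ p)] (α T : ℝ)
    (B₁ B₂ : ℝ → ℝ → Dist d →ₗ[ℝ] Dist d) (ω : ℝ → ℝ → ℝ) : Prop where
  control : IsControl 0 T ω
  bound₁ : ∀ s t, 0 ≤ s → s ≤ t → t ≤ T → ∀ k : ℤ, -2 ≤ k → k ≤ 3 → ∀ u : Dist d,
    sobNorm p k u < ∞ → sobNorm p (k - 1) (B₁ s t u) ≤ ENNReal.ofReal (ω s t ^ α) * sobNorm p k u
  bound₂ : ∀ s t, 0 ≤ s → s ≤ t → t ≤ T → ∀ k : ℤ, -1 ≤ k → k ≤ 3 → ∀ u : Dist d,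
    sobNorm p k u < ∞ →
      sobNorm p (k - 2) (B₂ s t u) ≤ ENNReal.ofReal (ω s t ^ (2 * α)) * sobNorm p k u
  chen₁ : ∀ s θ t, 0 ≤ s → s ≤ θ → θ ≤ t → t ≤ T → ∀ u : Dist d, sobNorm p (-2) u < ∞ →
    B₁ s t u - B₁ s θ u - B₁ θ t u = 0
  chen₂ : ∀ s θ t, 0 ≤ s → s ≤ θ → θ ≤ t → t ≤ T → ∀ u : Dist d, sobNorm p (-1) u < ∞ →
    B₂ s t u - B₂ s θ u - B₂ θ t u = B₁ θ t (B₁ s θ u)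

/-- The increments `δv_{st} = v_t - v_s` of a path in `L^p`, as distributions. -/
def incr {d : ℕ} {p : ℝ≥0∞} (v : ℝ → LpSp d p) (s t : ℝ) : Dist d :=
  lpDist (v t) - lpDist (v s)

/-- The remainder `v^♮_{st} = δv_{st} - ∫_s^t f_r dr - (B¹_{st} + B²_{st}) v_s`, where the integral
is the Bochner integral in `W^{-2,p}`. -/
def remainder {d : ℕ} {p : ℝ≥0∞} [Fact (1 ≤ p)] (B₁ B₂ : ℝ → ℝ → Dist d →ₗ[ℝ] Dist d)
    (v : ℝ → LpSp d p) (f : ℝ → NegSobolev d 2 p) (s t : ℝ) : Dist d :=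
  incr v s t - negDist (∫ r in s..t, f r) - (B₁ s t (lpDist (v s)) + B₂ s t (lpDist (v s)))

/-- The path `v` satisfies `dv = f dt + d𝐁 v` on `[0,T]`: its remainder belongs to
`𝒱_{2,loc}^{1+}(0,T;W^{-3,p})`, the union over `z > 1` of the `𝒱_{2,loc}^z(0,T;W^{-3,p})`. -/
def SolvesRough {d : ℕ} {p : ℝ≥0∞} [Fact (1 ≤ p)] (T : ℝ)
    (B₁ B₂ : ℝ → ℝ → Dist d →ₗ[ℝ] Dist d)
    (v : ℝ → LpSp d p) (f : ℝ → NegSobolev d 2 p) : Prop :=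
  ∃ z : ℝ, 1 < z ∧ LocFiniteVar (sobNorm p (-3)) z T (remainder B₁ B₂ v f)

end RoughPDE

end

/-! Write `ν(s,t)` for the `W^{-3,p}` norm of the remainder, `M` for a bound on `v` in `L^p`, and
`F(s,t)` for the integral of the norm of `f`. By Chen's relations the remainder fails to be additive
exactly by `B¹_{θt}(δv_{sθ} - B¹_{sθ} v_s) + B²_{θt} δv_{sθ}` (`remainder_eq`). To bound this in
`W^{-3,p}` one has to estimate `δv - B¹v` in `W^{-2,p}` and `δv` in `W^{-1,p}`. What is at hand is
boundedness in `L^p`, which carries no smallness, and the equation, which holds in `W^{-3,p}`.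

The two are interpolated by a smoothing operator `J` at scale `η`: on `(1 - J)δv` the `L^p` bound is
used, on `Jδv` the equation (`interpolation`). With `η = l ω^α`, `l ≥ 1`, this gives
(`remainder_almost_additive`) `ν(s,t) ≤ ν(s,θ) + ν(θ,t) + C (l² ω^{3α} M + ω^α F) + (C/l) ν(s,θ)`.

The last term cannot be absorbed into the `1/(3α)`-variation of the remainder, whose finiteness is
part of the claim. Instead `sewing_absorb` bisects `[a,b]` repeatedly and lets `l` grow
geometrically with the generation: the product of the factors `1 + C/l` stays bounded, while `3α >
1` leaves room to pay for `l²`. The assumption of finite `1/z`-variation with `z > 1` serves only to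
make the sum over the finest generation vanish in the limit. The result is a pointwise bound of `ν`
by powers of controls (`remainder_le`), hence the variation estimate; interpolating once more, with
`η = F^α + ω^α`, gives the estimate of `δv` (`incr_le`).

Two further ingredients are needed. The operators `J` must act on all the spaces at once, for every
`p` in `[1,∞]`, with constants depending on `d` alone; they are built from averages over boxes
(`exists_smoothing_two`). And `M` must bound `v` at every time, although only an essential supremum
is given: increments are small in `W^{-3,p}`, and the `L^p` norm is lower semicontinuous for
convergence of distributions (`norm_le_essSup`). -/

namespace RoughPDE

/-! ### Controls -/

namespace IsControl

variable {a b : ℝ} {ω ω' : ℝ → ℝ → ℝ}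

lemma diag (h : IsControl a b ω) {s : ℝ} (hs : a ≤ s) (hs' : s ≤ b) : ω s s = 0 := by
  have h1 := h.superadditive s s s hs le_rfl le_rfl hs'
  have h2 := h.nonneg s s hs le_rfl hs'
  linarith

lemma mono (h : IsControl a b ω) {s t s' t' : ℝ} (h1 : a ≤ s') (h2 : s' ≤ s) (h3 : s ≤ t)
    (h4 : t ≤ t') (h5 : t' ≤ b) : ω s t ≤ ω s' t' := by
  have e1 := h.superadditive s' s t' h1 h2 (h3.trans h4) h5
  have e2 := h.superadditive s t t' (h1.trans h2) h3 h4 h5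
  have e3 := h.nonneg s' s h1 h2 ((h3.trans h4).trans h5)
  have e4 := h.nonneg t t' ((h1.trans h2).trans h3) h4 h5
  linarith

lemma restrict (h : IsControl a b ω) {a' b' : ℝ} (ha : a ≤ a') (hb : b' ≤ b) :
    IsControl a' b' ω where
  continuousOn := h.continuousOn.mono fun _ hq => ⟨ha.trans hq.1, hq.2.1, hq.2.2.trans hb⟩
  nonneg s t h1 h2 h3 := h.nonneg s t (ha.trans h1) h2 (h3.trans hb)
  superadditive s θ t h1 h2 h3 h4 := h.superadditive s θ t (ha.trans h1) h2 h3 (h4.trans hb)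

lemma add (h : IsControl a b ω) (h' : IsControl a b ω') :
    IsControl a b (fun s t => ω s t + ω' s t) where
  continuousOn := h.continuousOn.add h'.continuousOn
  nonneg s t h1 h2 h3 := add_nonneg (h.nonneg s t h1 h2 h3) (h'.nonneg s t h1 h2 h3)
  superadditive s θ t h1 h2 h3 h4 := by
    have e1 := h.superadditive s θ t h1 h2 h3 h4
    have e2 := h'.superadditive s θ t h1 h2 h3 h4
    linarith

lemma const_mul (h : IsControl a b ω) {c : ℝ} (hc : 0 ≤ c) :
    IsControl a b (fun s t => c * ω s t) where
  continuousOn := continuousOn_const.mul h.continuousOn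
  nonneg s t h1 h2 h3 := mul_nonneg hc (h.nonneg s t h1 h2 h3)
  superadditive s θ t h1 h2 h3 h4 := by
    rw [← mul_add]
    exact mul_le_mul_of_nonneg_left (h.superadditive s θ t h1 h2 h3 h4) hc

lemma length (a b : ℝ) : IsControl a b (fun s t => t - s) where
  continuousOn := by fun_prop
  nonneg s t _ h2 _ := sub_nonneg.2 h2
  superadditive s θ t _ _ _ _ := by linarith

lemma integral {g : ℝ → ℝ} (hab : a ≤ b) (hg : IntervalIntegrable g volume a b)
    (hg0 : ∀ r, 0 ≤ g r) : IsControl a b (fun s t => ∫ r in s..t, g r) where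
  continuousOn := by
    have hc : ContinuousOn (fun x => ∫ r in a..x, g r) (Icc a b) := by
      have := intervalIntegral.continuousOn_primitive_interval' hg (left_mem_uIcc)
      rwa [uIcc_of_le hab] at this
    have h1 : ContinuousOn (fun q : ℝ × ℝ => (∫ r in a..q.2, g r) - ∫ r in a..q.1, g r)
        {q | a ≤ q.1 ∧ q.1 ≤ q.2 ∧ q.2 ≤ b} := by
      refine ContinuousOn.sub ?_ ?_
      · exact hc.comp continuousOn_snd fun q hq => ⟨hq.1.trans hq.2.1, hq.2.2⟩
      · exact hc.comp continuousOn_fst fun q hq => ⟨hq.1, hq.2.1.trans hq.2.2⟩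
    refine h1.congr fun q hq => ?_
    have hi : ∀ x, a ≤ x → x ≤ b → IntervalIntegrable g volume a x := fun x h1 h2 =>
      hg.mono_set (by rw [uIcc_of_le h1, uIcc_of_le hab]; exact Icc_subset_Icc_right h2)
    exact (intervalIntegral.integral_interval_sub_left
      (hi _ (hq.1.trans hq.2.1) hq.2.2) (hi _ hq.1 (hq.2.1.trans hq.2.2))).symm
  nonneg s t _ h2 _ := intervalIntegral.integral_nonneg h2 fun r _ => hg0 r
  superadditive s θ t h1 h2 h3 h4 := by
    have hi : ∀ x y, a ≤ x → x ≤ y → y ≤ b → IntervalIntegrable g volume x y := fun x y h1 h2 h3 =>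
      hg.mono_set (by rw [uIcc_of_le h2, uIcc_of_le hab]; exact Icc_subset_Icc h1 h3)
    exact (intervalIntegral.integral_add_adjacent_intervals (hi _ _ h1 h2 (h3.trans h4))
      (hi _ _ (h1.trans h2) h3 h4)).le

/-- The intermediate value theorem gives a point where the left half carries exactly half of the
control; superadditivity then bounds the right half. -/
lemma exists_bisection (h : IsControl a b ω) {s t : ℝ} (hs : a ≤ s) (hst : s ≤ t) (ht : t ≤ b) :
    ∃ θ, s ≤ θ ∧ θ ≤ t ∧ ω s θ ≤ ω s t / 2 ∧ ω θ t ≤ ω s t / 2 := by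
  have hc : ContinuousOn (fun θ => ω s θ) (Icc s t) :=
    h.continuousOn.comp (f := fun θ => (s, θ)) (by fun_prop)
      fun θ hθ => ⟨hs, hθ.1, hθ.2.trans ht⟩
  have h0 : ω s s = 0 := h.diag hs (hst.trans ht)
  have h1 : 0 ≤ ω s t := h.nonneg s t hs hst ht
  obtain ⟨θ, hθ, he⟩ := intermediate_value_Icc hst hc
    (show ω s t / 2 ∈ Icc (ω s s) (ω s t) from ⟨by rw [h0]; linarith, by linarith⟩)
  have he' : ω s θ = ω s t / 2 := he
  refine ⟨θ, hθ.1, hθ.2, he'.le, ?_⟩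
  have := h.superadditive s θ t hs hθ.1 hθ.2 ht
  linarith

end IsControl

/-! ### Products of powers of controls -/

/-- A Hölder inequality for two-term sums. After dividing by the sums, the `b`-ratios are at most
`1`, so their exponent `y` may be lowered to `1 - x`; the weighted arithmetic-geometric mean
inequality does the rest. -/
lemma rpow_mul_rpow_add_le {a₁ a₂ b₁ b₂ x y : ℝ} (ha₁ : 0 ≤ a₁) (ha₂ : 0 ≤ a₂) (hb₁ : 0 ≤ b₁)
    (hb₂ : 0 ≤ b₂) (hx : 0 < x) (hy : 0 < y) (hx1 : x ≤ 1) (hxy : 1 ≤ x + y) :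
    a₁ ^ x * b₁ ^ y + a₂ ^ x * b₂ ^ y ≤ (a₁ + a₂) ^ x * (b₁ + b₂) ^ y := by
  rcases (add_nonneg ha₁ ha₂).eq_or_lt with ha | ha
  · have h1 : a₁ = 0 := by linarith
    have h2 : a₂ = 0 := by linarith
    simp [h1, h2, Real.zero_rpow hx.ne']
  rcases (add_nonneg hb₁ hb₂).eq_or_lt with hb | hb
  · have h1 : b₁ = 0 := by linarith
    have h2 : b₂ = 0 := by linarith
    simp [h1, h2, Real.zero_rpow hy.ne']
  have key : ∀ u w : ℝ, 0 ≤ u → 0 ≤ w → w ≤ 1 → u ^ x * w ^ y ≤ x * u + (1 - x) * w := by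
    intro u w hu hw hw1
    have e1 : w ^ y ≤ w ^ (1 - x) := by
      rcases hw.eq_or_lt with h0 | h0
      · rw [← h0, Real.zero_rpow hy.ne']
        exact Real.rpow_nonneg le_rfl _
      · exact Real.rpow_le_rpow_of_exponent_ge h0 hw1 (by linarith)
    calc u ^ x * w ^ y ≤ u ^ x * w ^ (1 - x) :=
          mul_le_mul_of_nonneg_left e1 (Real.rpow_nonneg hu _)
      _ ≤ _ := Real.geom_mean_le_arith_mean2_weighted hx.le (by linarith) hu hw (by ring)
  set A := a₁ + a₂
  set B := b₁ + b₂
  have hA : 0 < A ^ x := Real.rpow_pos_of_pos ha _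
  have hB : 0 < B ^ y := Real.rpow_pos_of_pos hb _
  have e : ∀ c e : ℝ, 0 ≤ c → 0 ≤ e →
      c ^ x * e ^ y = ((c / A) ^ x * (e / B) ^ y) * (A ^ x * B ^ y) := by
    intro c e hc he
    rw [Real.div_rpow hc ha.le, Real.div_rpow he hb.le]
    field_simp
  rw [e a₁ b₁ ha₁ hb₁, e a₂ b₂ ha₂ hb₂, ← add_mul]
  have k1 := key (a₁ / A) (b₁ / B) (by positivity) (by positivity)
    ((div_le_one hb).2 (by simp only [B]; linarith))
  have k2 := key (a₂ / A) (b₂ / B) (by positivity) (by positivity)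
    ((div_le_one hb).2 (by simp only [B]; linarith))
  have s1 : a₁ / A + a₂ / A = 1 := by rw [← add_div]; exact div_self ha.ne'
  have s2 : b₁ / B + b₂ / B = 1 := by rw [← add_div]; exact div_self hb.ne'
  have : (a₁ / A) ^ x * (b₁ / B) ^ y + (a₂ / A) ^ x * (b₂ / B) ^ y ≤ 1 := by
    have : x * (a₁ / A + a₂ / A) + (1 - x) * (b₁ / B + b₂ / B) = 1 := by rw [s1, s2]; ring
    nlinarith
  calc _ ≤ 1 * (A ^ x * B ^ y) := mul_le_mul_of_nonneg_right this (by positivity)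
    _ = _ := one_mul _

lemma IsControl.rpow_mul_rpow {a b : ℝ} {ω ω' : ℝ → ℝ → ℝ} (h : IsControl a b ω)
    (h' : IsControl a b ω') {x y : ℝ} (hx : 0 < x) (hy : 0 < y) (hx1 : x ≤ 1) (hxy : 1 ≤ x + y) :
    IsControl a b (fun s t => ω s t ^ x * ω' s t ^ y) where
  continuousOn := (h.continuousOn.rpow_const fun _ _ => Or.inr hx.le).mul
    (h'.continuousOn.rpow_const fun _ _ => Or.inr hy.le)
  nonneg s t h1 h2 h3 := mul_nonneg (Real.rpow_nonneg (h.nonneg s t h1 h2 h3) _)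
    (Real.rpow_nonneg (h'.nonneg s t h1 h2 h3) _)
  superadditive s θ t h1 h2 h3 h4 := by
    have n1 := h.nonneg s θ h1 h2 (h3.trans h4)
    have n2 := h.nonneg θ t (h1.trans h2) h3 h4
    have n3 := h'.nonneg s θ h1 h2 (h3.trans h4)
    have n4 := h'.nonneg θ t (h1.trans h2) h3 h4
    refine (rpow_mul_rpow_add_le n1 n2 n3 n4 hx hy hx1 hxy).trans ?_
    have m1 := h.superadditive s θ t h1 h2 h3 h4
    have m2 := h'.superadditive s θ t h1 h2 h3 h4
    exact mul_le_mul (Real.rpow_le_rpow (by linarith) m1 hx.le)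
      (Real.rpow_le_rpow (by linarith) m2 hy.le) (Real.rpow_nonneg (by linarith) _)
      (Real.rpow_nonneg (by linarith) _)

/-! ### A sewing lemma with absorption -/

/-- The assumption `x ≤ y` covers `y = 0`, where the quotient says nothing. -/
lemma le_of_div_le {x y c : ℝ} (hx : 0 ≤ x) (hxy : x ≤ y) (h : x / y ≤ c) : x ≤ c * y := by
  rcases (hx.trans hxy).eq_or_lt with h0 | h0
  · rw [← h0] at hxy ⊢; simpa using hxy
  · exact (div_le_iff₀ h0).1 h

/-- The constant of the sewing lemma `sewing_absorb`. -/
noncomputable def sewingConst (α C : ℝ) : ℝ :=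
  Real.exp (C / (1 - 2 ^ (-((3 * α - 1) / 4)))) * (C * 3 ^ (3 * α) /
    (1 - (2 ^ (-((3 * α - 1) / 4) : ℝ) : ℝ) ^ 2))

lemma sewingConst_pos {α C : ℝ} (hα : 1 / 3 < α) (hC : 0 < C) : 0 < sewingConst α C := by
  have h1 : (2 : ℝ) ^ (-((3 * α - 1) / 4)) < 1 :=
    Real.rpow_lt_one_of_one_lt_of_neg (by norm_num) (by linarith)
  have h2 : (0 : ℝ) < 2 ^ (-((3 * α - 1) / 4)) := by positivity
  have h3 : 0 < 1 - ((2 : ℝ) ^ (-((3 * α - 1) / 4))) ^ 2 := by nlinarith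
  unfold sewingConst
  positivity

set_option maxHeartbeats 1000000 in
-- In generation `k` of a bisection take `l = r^{-k}` with `r < 1`. The errors of the `2^k`
-- intervals then add up to a multiple of `r^{2k}`, and the factors `1 + C r^k` have a finite
-- product. No a priori bound of order `3α` on `ν` is used, only that `ν` is eventually below `ε Ω`.
lemma sewing_absorb {a b α C M : ℝ} (hα : 1 / 3 < α) (hα' : α ≤ 1 / 2) (hC : 0 < C) (hM : 0 ≤ M)
    (hab : a ≤ b) {ω G : ℝ → ℝ → ℝ} (hω : IsControl a b ω) (hG : IsControl a b G)
    (hω1 : ω a b ≤ 1 / 3) {ν Ω : ℝ → ℝ → ℝ} 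
    (hΩ : ∀ s θ t, a ≤ s → s ≤ θ → θ ≤ t → t ≤ b → Ω s θ + Ω θ t ≤ Ω s t)
    (hfine : ∀ ε > 0, ∃ δ > 0, ∀ s t, a ≤ s → s ≤ t → t ≤ b → t - s ≤ δ → ν s t ≤ ε * Ω s t)
    (hν : ∀ s θ t l : ℝ, a ≤ s → s ≤ θ → θ ≤ t → t ≤ b → 1 ≤ l → l * ω s t ^ α ≤ 1 →
      ν s t ≤ ν s θ + ν θ t + C * (l ^ 2 * ω s t ^ (3 * α) * M + G s t ^ (3 * α))
        + C / l * ν s θ)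
    (hν0 : ∀ s t, a ≤ s → s ≤ t → t ≤ b → 0 ≤ ν s t) :
    ν a b ≤ sewingConst α C * (ω a b ^ (3 * α) * M + G a b ^ (3 * α)) := by
  -- Chosen so that `3α = 1 + 4β`: of the surplus `4β`, one half pays for `l² = r^{-2k}` and the
  -- other gives the decay `r^{2k}`.
  set β : ℝ := (3 * α - 1) / 4 with hβ
  set r : ℝ := 2 ^ (-β) with hr
  have hr0 : 0 < r := by positivity
  have hr1 : r < 1 := Real.rpow_lt_one_of_one_lt_of_neg (by norm_num) (by linarith)
  set E : ℝ := C * 3 ^ (3 * α) * (ω a b ^ (3 * α) * M + G a b ^ (3 * α)) with hE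
  have nω := hω.nonneg a b le_rfl hab le_rfl
  have nG := hG.nonneg a b le_rfl hab le_rfl
  have hE0 : 0 ≤ E := by positivity
  have hr2 : 0 < 1 - r ^ 2 := by nlinarith
  -- The fixed point of `D ↦ D r² + E`, so that the error term reproduces itself when passing from
  -- generation `k + 1` to `k`.
  set D : ℝ := E / (1 - r ^ 2) with hD
  have hD0 : 0 ≤ D := by positivity
  have hDE : D * r ^ 2 + E = D := by rw [hD]; field_simp; ring
  -- Dominates the tail product of the factors `1 + C r^j`, `j ≥ k`, since `1 + x ≤ exp x`.
  set q : ℕ → ℝ := fun k => Real.exp (C * r ^ k / (1 - r)) with hq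
  have hq0 : ∀ k, 0 < q k := fun k => Real.exp_pos _
  have hq1 : ∀ k, 1 ≤ q k := fun k => Real.one_le_exp (by have := sub_pos.2 hr1; positivity)
  have hqs : ∀ k, (1 + C * r ^ k) * q (k + 1) ≤ q k := by
    intro k
    have e : C * r ^ k / (1 - r) = C * r ^ k + C * r ^ (k + 1) / (1 - r) := by
      have := (sub_pos.2 hr1).ne'
      field_simp; ring
    simp only [hq]
    rw [e, Real.exp_add]
    refine mul_le_mul_of_nonneg_right ?_ (Real.exp_pos _).le
    linarith [Real.add_one_le_exp (C * r ^ k)]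
  -- the control used for bisection
  set κ : ℝ → ℝ → ℝ := fun s t => (ω a b)⁻¹ * ω s t + (G a b)⁻¹ * G s t + (b - a)⁻¹ * (t - s)
    with hκ
  have cκ : IsControl a b κ :=
    ((hω.const_mul (inv_nonneg.2 nω)).add (hG.const_mul (inv_nonneg.2 nG))).add
      ((IsControl.length a b).const_mul (inv_nonneg.2 (sub_nonneg.2 hab)))
  -- Each of the three normalised controls contributes at most `1`; a vanishing one contributes `0`,
  -- because `0⁻¹ = 0`.
  have hκab : κ a b ≤ 3 := by
    have e : ∀ x : ℝ, x⁻¹ * x ≤ 1 := fun x => by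
      rcases eq_or_ne x 0 with h | h
      · simp [h]
      · rw [inv_mul_cancel₀ h]
    have := e (ω a b); have := e (G a b); have := e (b - a)
    simp only [hκ]; linarith
  have parts : ∀ s t c, a ≤ s → s ≤ t → t ≤ b → κ s t ≤ c →
      ω s t ≤ c * ω a b ∧ G s t ≤ c * G a b ∧ t - s ≤ c * (b - a) := by
    intro s t c h1 h2 h3 hc
    have n1 := hω.nonneg s t h1 h2 h3
    have n2 := hG.nonneg s t h1 h2 h3
    have n3 := sub_nonneg.2 h2
    have p1 : 0 ≤ (ω a b)⁻¹ * ω s t := by positivity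
    have p2 : 0 ≤ (G a b)⁻¹ * G s t := by positivity
    have p3 : 0 ≤ (b - a)⁻¹ * (t - s) := mul_nonneg (inv_nonneg.2 (sub_nonneg.2 hab)) n3
    simp only [hκ] at hc
    refine ⟨le_of_div_le n1 (hω.mono le_rfl h1 h2 h3 le_rfl) ?_,
      le_of_div_le n2 (hG.mono le_rfl h1 h2 h3 le_rfl) ?_,
      le_of_div_le n3 (by linarith) ?_⟩ <;> rw [div_eq_inv_mul] <;> linarith
  have hrk : ∀ k : ℕ, r ^ k = ((2 : ℝ)⁻¹ ^ k) ^ β := by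
    intro k
    rw [hr, Real.rpow_neg (by norm_num), ← Real.inv_rpow (by norm_num), ← Real.rpow_natCast,
      ← Real.rpow_natCast, ← Real.rpow_mul (by norm_num), ← Real.rpow_mul (by norm_num), mul_comm]
  -- one step of the recursion
  have err : ∀ k : ℕ, ∀ s t, a ≤ s → s ≤ t → t ≤ b → κ s t ≤ 3 * 2⁻¹ ^ k →
      (r ^ k)⁻¹ * ω s t ^ α ≤ 1 ∧
      C * (((r ^ k)⁻¹) ^ 2 * ω s t ^ (3 * α) * M + G s t ^ (3 * α))
        ≤ E * (2⁻¹ ^ k * (r ^ k) ^ 2) := by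
    intro k s t h1 h2 h3 hk
    obtain ⟨p1, p2, -⟩ := parts s t _ h1 h2 h3 hk
    have n1 := hω.nonneg s t h1 h2 h3
    have n2 := hG.nonneg s t h1 h2 h3
    set y : ℝ := (2 : ℝ)⁻¹ ^ k with hy
    have y0 : 0 < y := by positivity
    have y1 : y ≤ 1 := pow_le_one₀ (by norm_num) (by norm_num)
    have ry : r ^ k = y ^ β := hrk k
    have rk0 : 0 < r ^ k := by positivity
    constructor
    -- The hypothesis `ω a b ≤ 1 / 3` cancels the factor `3` coming from `κ`, and `β ≤ α` makes `l =
    -- r^{-k}` admissible.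
    · have e1 : ω s t ^ α ≤ y ^ α := Real.rpow_le_rpow n1 (by nlinarith) (by linarith)
      have e2 : y ^ α ≤ y ^ β := Real.rpow_le_rpow_of_exponent_ge y0 y1 (by rw [hβ]; linarith)
      rw [inv_mul_le_iff₀ rk0, mul_one, ry]
      exact e1.trans e2
    · have y3 : y ^ (3 * α) = y * (r ^ k) ^ 2 * (r ^ k) ^ 2 := by
        rw [ry, ← Real.rpow_natCast, ← Real.rpow_mul y0.le, mul_assoc, ← Real.rpow_add y0]
        nth_rewrite 2 [← Real.rpow_one y]
        rw [← Real.rpow_add y0]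
        congr 1
        rw [hβ]; push_cast; ring
      have rk1 : (r ^ k) ^ 2 ≤ 1 := pow_le_one₀ rk0.le (pow_le_one₀ hr0.le hr1.le)
      have b1 : ω s t ^ (3 * α) ≤
          3 ^ (3 * α) * (y * (r ^ k) ^ 2 * (r ^ k) ^ 2) * ω a b ^ (3 * α) := by
        rw [← y3, ← Real.mul_rpow (by norm_num) y0.le, ← Real.mul_rpow (by positivity) nω]
        exact Real.rpow_le_rpow n1 p1 (by linarith)
      have b2 : G s t ^ (3 * α) ≤ 3 ^ (3 * α) * (y * (r ^ k) ^ 2) * G a b ^ (3 * α) := by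
        have : G s t ^ (3 * α) ≤
            3 ^ (3 * α) * (y * (r ^ k) ^ 2 * (r ^ k) ^ 2) * G a b ^ (3 * α) := by
          rw [← y3, ← Real.mul_rpow (by norm_num) y0.le, ← Real.mul_rpow (by positivity) nG]
          exact Real.rpow_le_rpow n2 p2 (by linarith)
        refine this.trans ?_
        have : y * (r ^ k) ^ 2 * (r ^ k) ^ 2 ≤ y * (r ^ k) ^ 2 :=
          mul_le_of_le_one_right (by positivity) rk1
        gcongr
      have b3 : ((r ^ k)⁻¹) ^ 2 * ω s t ^ (3 * α) ≤
          3 ^ (3 * α) * (y * (r ^ k) ^ 2) * ω a b ^ (3 * α) := by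
        calc _ ≤ ((r ^ k)⁻¹) ^ 2 *
              (3 ^ (3 * α) * (y * (r ^ k) ^ 2 * (r ^ k) ^ 2) * ω a b ^ (3 * α)) := by
              gcongr
          _ = _ := by field_simp
      calc _ ≤ C * (3 ^ (3 * α) * (y * (r ^ k) ^ 2) * ω a b ^ (3 * α) * M
            + 3 ^ (3 * α) * (y * (r ^ k) ^ 2) * G a b ^ (3 * α)) := by gcongr
        _ = _ := by rw [hE]; ring
  have step : ∀ ε > 0, ν a b ≤ q 0 * (D + ε * Ω a b) := by
    intro ε hε
    obtain ⟨δ, hδ, hf⟩ := hfine ε hε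
    obtain ⟨n, hn⟩ : ∃ n : ℕ, 3 * (2 : ℝ)⁻¹ ^ n * (b - a) ≤ δ := by
      have : Filter.Tendsto (fun n : ℕ => 3 * (2 : ℝ)⁻¹ ^ n * (b - a)) Filter.atTop
          (nhds (3 * 0 * (b - a))) :=
        ((tendsto_pow_atTop_nhds_zero_of_lt_one (by norm_num)
          (by norm_num)).const_mul 3).mul_const _
      simp only [mul_zero, zero_mul] at this
      exact ((this.eventually (gt_mem_nhds hδ)).exists).imp fun _ h => le_of_lt h
    -- Induction from the finest generation `n` back to `0`; `j` counts the generations still below.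
    have claim : ∀ j k : ℕ, k + j = n → ∀ s t, a ≤ s → s ≤ t → t ≤ b → κ s t ≤ 3 * 2⁻¹ ^ k →
        ν s t ≤ q k * (D * (2⁻¹ ^ k * (r ^ k) ^ 2) + ε * Ω s t) := by
      intro j
      induction j with
      | zero =>
        intro k hk s t h1 h2 h3 h4
        obtain rfl : k = n := by simpa using hk
        have hs := hf s t h1 h2 h3 ((parts s t _ h1 h2 h3 h4).2.2.trans hn)
        have h0 := hν0 s t h1 h2 h3
        have p : 0 ≤ D * (2⁻¹ ^ k * (r ^ k) ^ 2) := by positivity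
        nlinarith [hq1 k]
      | succ j ih =>
        intro k hk s t h1 h2 h3 h4
        obtain ⟨θ, t1, t2, t3, t4⟩ := cκ.exists_bisection h1 h2 h3
        have hk' : 3 * (2 : ℝ)⁻¹ ^ (k + 1) = 3 * 2⁻¹ ^ k / 2 := by rw [pow_succ]; ring
        have i1 := ih (k + 1) (by omega) s θ h1 t1 (t2.trans h3) (by rw [hk']; linarith)
        have i2 := ih (k + 1) (by omega) θ t (h1.trans t1) t2 h3 (by rw [hk']; linarith)
        obtain ⟨e1, e2⟩ := err k s t h1 h2 h3 h4
        have hl : 1 ≤ (r ^ k)⁻¹ := (one_le_inv₀ (by positivity)).2 (pow_le_one₀ hr0.le hr1.le)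
        have i3 := hν s θ t (r ^ k)⁻¹ h1 t1 t2 h3 hl e1
        have i4 := hΩ s θ t h1 t1 t2 h3
        rw [div_inv_eq_mul] at i3
        have n1 := hν0 s θ h1 t1 (t2.trans h3)
        have n2 := hν0 θ t (h1.trans t1) t2 h3
        have c0 : 0 < C * r ^ k := by positivity
        have s1 : ν s t ≤ (1 + C * r ^ k) * (ν s θ + ν θ t) + E * (2⁻¹ ^ k * (r ^ k) ^ 2) := by
          have : 0 ≤ C * r ^ k * ν θ t := mul_nonneg c0.le n2
          linarith
        set Q := (2 : ℝ)⁻¹ ^ k * (r ^ k) ^ 2 with hQ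
        have hQ0 : 0 ≤ Q := by positivity
        have hQ' : (2 : ℝ)⁻¹ ^ (k + 1) * (r ^ (k + 1)) ^ 2 = Q * r ^ 2 / 2 := by
          rw [hQ, pow_succ, pow_succ]; ring
        rw [hQ'] at i1 i2
        set Z := D * (Q * r ^ 2) + ε * Ω s t with hZ
        have s2 : ν s θ + ν θ t ≤ q (k + 1) * Z := by
          have : ε * (Ω s θ + Ω θ t) ≤ ε * Ω s t := mul_le_mul_of_nonneg_left i4 hε.le
          have h5 : q (k + 1) * (ε * (Ω s θ + Ω θ t)) ≤ q (k + 1) * (ε * Ω s t) :=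
            mul_le_mul_of_nonneg_left this (hq0 _).le
          rw [hZ]
          linarith
        -- `Ω` is not assumed nonnegative; the sign of `Z` is read off from `s2` and the
        -- nonnegativity of `ν`.
        have hZ0 : 0 ≤ Z := by
          have : 0 ≤ q (k + 1) * Z := by linarith
          exact nonneg_of_mul_nonneg_right this (hq0 _)
        calc ν s t ≤ (1 + C * r ^ k) * (q (k + 1) * Z) + E * Q := by
              refine s1.trans ?_
              gcongr
          _ = ((1 + C * r ^ k) * q (k + 1)) * Z + E * Q := by ring
          _ ≤ q k * Z + q k * (E * Q) := by
              exact add_le_add (mul_le_mul_of_nonneg_right (hqs k) hZ0)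
                (le_mul_of_one_le_left (by positivity) (hq1 k))
          _ = q k * ((D * r ^ 2 + E) * Q + ε * Ω s t) := by rw [hZ]; ring
          _ = _ := by rw [hDE]
    have := claim n 0 (by simp) a b le_rfl hab le_rfl (by simpa using hκab)
    simpa using this
  have lim : ν a b ≤ q 0 * D := by
    have ht : Filter.Tendsto (fun ε : ℝ => q 0 * (D + ε * Ω a b)) (nhdsWithin 0 (Ioi 0))
        (nhds (q 0 * (D + 0 * Ω a b))) := by
      refine Filter.Tendsto.mono_left (Continuous.tendsto ?_ 0) nhdsWithin_le_nhds
      fun_prop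
    have := ge_of_tendsto ht (Filter.eventually_of_mem self_mem_nhdsWithin fun ε hε => step ε hε)
    simpa using this
  refine lim.trans (le_of_eq ?_)
  simp only [hq, hD, hE, sewingConst, pow_zero, mul_one]
  rw [← hβ, ← hr]
  ring

/-! ### Averages of translates -/

section Average

variable {d : ℕ} {p : ℝ≥0∞} {S : Type*} [MeasurableSpace S] {μ : Measure S} [IsFiniteMeasure μ]
  {Y : S → Sp d}

lemma rpow_lintegral_le_of_one_le {S : Type*} [MeasurableSpace S] (μ : Measure S) {h : S → ℝ≥0∞}
    (hh : Measurable h) {r : ℝ} (hr : 1 ≤ r) :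
    (∫⁻ o, h o ∂μ) ^ r ≤ μ univ ^ (r - 1) * ∫⁻ o, h o ^ r ∂μ := by
  have hr0 : 0 < r := by linarith
  have key := eLpNorm_le_eLpNorm_mul_rpow_measure_univ (μ := μ) (f := h)
    (p := 1) (q := ENNReal.ofReal r) (by simpa using hr) hh.aestronglyMeasurable
  rw [eLpNorm_one_eq_lintegral_enorm, eLpNorm_eq_lintegral_rpow_enorm_toReal (by simpa using hr0)
    ENNReal.ofReal_ne_top] at key
  simp only [enorm_eq_self, ENNReal.toReal_ofReal hr0.le, ENNReal.toReal_one, div_one] at key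
  calc _ ≤ ((∫⁻ o, h o ^ r ∂μ) ^ (1 / r) * μ univ ^ (1 - 1 / r)) ^ r :=
        ENNReal.rpow_le_rpow key hr0.le
    _ = _ := by
        rw [ENNReal.mul_rpow_of_nonneg _ _ hr0.le, ← ENNReal.rpow_mul, ← ENNReal.rpow_mul, mul_comm]
        congr 2
        · field_simp
        · rw [one_div, inv_mul_cancel₀ hr0.ne', ENNReal.rpow_one]

/-- Minkowski's inequality for averages of translates. -/
lemma eLpNorm_lintegral_translate_le (hY : Measurable Y) (hp : 1 ≤ p) {f : Sp d → ℝ≥0∞}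
    (hf : Measurable f) :
    eLpNorm (fun x => ∫⁻ o, f (x - Y o) ∂μ) p volume ≤ μ univ * eLpNorm f p volume := by
  have hm : Measurable (fun z : Sp d × S => f (z.1 - Y z.2)) := by fun_prop
  rcases eq_or_ne p ∞ with rfl | hpt
  · simp only [eLpNorm_exponent_top]
    -- For each fixed `o` the bound holds for almost every `x` by translation invariance; the order
    -- of the two quantifiers is then exchanged.
    have h1 : ∀ᵐ x ∂(volume : Measure (Sp d)), ∀ᵐ o ∂μ, f (x - Y o) ≤ eLpNormEssSup f volume := by
      rw [Measure.ae_ae_comm (p := fun (x : Sp d) o => f (x - Y o) ≤ eLpNormEssSup f volume)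
        (hm measurableSet_Iic)]
      refine .of_forall fun o => ?_
      have := enorm_ae_le_eLpNormEssSup f (volume : Measure (Sp d))
      exact (measurePreserving_sub_right volume (Y o)).quasiMeasurePreserving.ae this
    refine essSup_le_of_ae_le _ ?_
    filter_upwards [h1] with x hx
    simp only [enorm_eq_self]
    calc _ ≤ ∫⁻ o, eLpNormEssSup f volume ∂μ := lintegral_mono_ae hx
      _ = _ := by rw [lintegral_const, mul_comm]
  · have hp0 : p ≠ 0 := (zero_lt_one.trans_le hp).ne'
    have hr : 1 ≤ p.toReal := by
      rw [← ENNReal.toReal_one]; exact ENNReal.toReal_mono hpt hp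
    set r := p.toReal
    have hr0 : 0 < r := by linarith
    rw [eLpNorm_eq_lintegral_rpow_enorm_toReal hp0 hpt,
      eLpNorm_eq_lintegral_rpow_enorm_toReal hp0 hpt]
    simp only [enorm_eq_self]
    have hle : ∫⁻ x : Sp d, (∫⁻ o, f (x - Y o) ∂μ) ^ r ≤
        μ univ ^ r * ∫⁻ x, f x ^ r := by
      calc ∫⁻ x : Sp d, (∫⁻ o, f (x - Y o) ∂μ) ^ r
          ≤ ∫⁻ x : Sp d, μ univ ^ (r - 1) * ∫⁻ o, f (x - Y o) ^ r ∂μ :=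
            lintegral_mono fun x => rpow_lintegral_le_of_one_le μ (by fun_prop) hr
        _ = μ univ ^ (r - 1) * ∫⁻ x : Sp d, ∫⁻ o, f (x - Y o) ^ r ∂μ :=
            lintegral_const_mul' _ _ (ENNReal.rpow_ne_top_of_nonneg (by linarith)
              (measure_ne_top _ _))
        _ = μ univ ^ (r - 1) * ∫⁻ o, (∫⁻ x : Sp d, f (x - Y o) ^ r) ∂μ := by
            rw [lintegral_lintegral_swap]
            exact (hm.pow_const r).aemeasurable
        _ = μ univ ^ (r - 1) * ∫⁻ _, (∫⁻ x : Sp d, f x ^ r) ∂μ := by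
            congr 2; ext o
            exact lintegral_sub_right_eq_self (fun x => f x ^ r) (Y o)
        _ = μ univ ^ r * ∫⁻ x, f x ^ r := by
            rw [lintegral_const, mul_comm (lintegral _ _), ← mul_assoc]
            congr 1
            nth_rewrite 2 [← ENNReal.rpow_one (μ univ)]
            rw [← ENNReal.rpow_add_of_nonneg _ _ (by linarith) zero_le_one]
            congr 1; ring
    calc _ ≤ (μ univ ^ r * ∫⁻ x, f x ^ r) ^ (1 / r) :=
          ENNReal.rpow_le_rpow hle (by positivity)
      _ = _ := by
          rw [ENNReal.mul_rpow_of_nonneg _ _ (by positivity), ← ENNReal.rpow_mul,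
            mul_one_div_cancel hr0.ne', ENNReal.rpow_one]

lemma eLpNorm_integral_translate_le (hY : Measurable Y) (hp : 1 ≤ p) {f : Sp d → ℝ}
    (hf : Measurable f) :
    eLpNorm (fun x => ∫ o, f (x - Y o) ∂μ) p volume ≤ μ univ * eLpNorm f p volume := by
  have h := eLpNorm_lintegral_translate_le (μ := μ) hY hp (f := fun x => ‖f x‖ₑ) (by fun_prop)
  rw [eLpNorm_enorm] at h
  refine le_trans (eLpNorm_mono_enorm fun x => ?_) h
  rw [enorm_eq_self]
  exact enorm_integral_le_lintegral_enorm _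

lemma memLp_integral_translate (hY : Measurable Y) (hp : 1 ≤ p) {f : Sp d → ℝ}
    (hf : Measurable f) (hfp : eLpNorm f p volume < ∞) :
    MemLp (fun x => ∫ o, f (x - Y o) ∂μ) p volume := by
  refine ⟨?_, (eLpNorm_integral_translate_le hY hp hf).trans_lt
    (ENNReal.mul_lt_top (measure_lt_top _ _) hfp)⟩
  have hm : Measurable (fun z : Sp d × S => f (z.1 - Y z.2)) := by fun_prop
  exact (hm.stronglyMeasurable.integral_prod_right (ν := μ)).aestronglyMeasurable

/-- Needed for additivity of averages: the integral of a non-integrable function is `0` by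
convention. Finiteness follows from Minkowski's inequality applied to `|f|`. -/
lemma ae_integrable_translate (hY : Measurable Y) (hp : 1 ≤ p) {f : Sp d → ℝ}
    (hf : Measurable f) (hfp : eLpNorm f p volume < ∞) :
    ∀ᵐ x ∂(volume : Measure (Sp d)), Integrable (fun o => f (x - Y o)) μ := by
  have h := eLpNorm_lintegral_translate_le (μ := μ) hY hp (f := fun x => ‖f x‖ₑ) (by fun_prop)
  rw [eLpNorm_enorm] at h
  have hm : Measurable (fun x : Sp d => ∫⁻ o, ‖f (x - Y o)‖ₑ ∂μ) := by
    refine Measurable.lintegral_prod_right (f := fun (x : Sp d) o => ‖f (x - Y o)‖ₑ) ?_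
    have : Measurable (fun z : Sp d × S => f (z.1 - Y z.2)) := by fun_prop
    exact this.enorm
  have h2 : ∀ᵐ x ∂(volume : Measure (Sp d)), ∫⁻ o, ‖f (x - Y o)‖ₑ ∂μ < ∞ := by
    have h3 : eLpNorm (fun x : Sp d => ∫⁻ o, ‖f (x - Y o)‖ₑ ∂μ) p volume ≠ ∞ :=
      (h.trans_lt (ENNReal.mul_lt_top (measure_lt_top _ _) hfp)).ne
    rcases eq_or_ne p ∞ with rfl | hpt
    · rw [eLpNorm_exponent_top] at h3
      filter_upwards [enorm_ae_le_eLpNormEssSup (fun x : Sp d => ∫⁻ o, ‖f (x - Y o)‖ₑ ∂μ) volume]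
        with x hx
      exact hx.trans_lt h3.lt_top
    · have hp0 : p ≠ 0 := (zero_lt_one.trans_le hp).ne'
      have h4 := lintegral_rpow_enorm_lt_top_of_eLpNorm_lt_top hp0 hpt h3.lt_top
      filter_upwards [ae_lt_top (by fun_prop) h4.ne] with x hx
      rw [enorm_eq_self] at hx
      exact (ENNReal.rpow_lt_top_iff_of_pos (ENNReal.toReal_pos hp0 hpt)).1 hx
  filter_upwards [h2] with x hx
  exact ⟨(by fun_prop : Measurable fun o => f (x - Y o)).aestronglyMeasurable, hx⟩

/-- This makes averages independent of the representative in `L^p`: the map `(o, x) ↦ x - Y o` pulls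
null sets back to null sets, by Fubini. -/
lemma ae_ae_translate (hY : Measurable Y) {P : Sp d → Prop} (hP : ∀ᵐ x, P x) :
    ∀ᵐ x ∂(volume : Measure (Sp d)), ∀ᵐ o ∂μ, P (x - Y o) := by
  have hq : Measure.QuasiMeasurePreserving (fun z : S × Sp d => z.2 - Y z.1)
      (μ.prod volume) volume := by
    refine ⟨by fun_prop, Measure.AbsolutelyContinuous.mk fun s hs h0 => ?_⟩
    rw [Measure.map_apply (by fun_prop) hs, Measure.measure_prod_null
      ((by fun_prop : Measurable fun z : S × Sp d => z.2 - Y z.1) hs)]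
    refine .of_forall fun o => ?_
    exact (measurePreserving_sub_right volume (Y o)).quasiMeasurePreserving.preimage_null h0
  have h1 : ∀ᵐ z ∂(μ.prod (volume : Measure (Sp d))), P (z.2 - Y z.1) := hq.ae hP
  have h2 : ∀ᵐ z ∂((volume : Measure (Sp d)).prod μ), P (z.1 - Y z.2) :=
    (Measure.measurePreserving_swap).quasiMeasurePreserving.ae h1
  exact Measure.ae_ae_of_ae_prod h2

/-- The operator `f ↦ ∫ f(· - Y(o)) dμ(o)` on `L^p(ℝ^d)`. -/
noncomputable def avg [hp : Fact (1 ≤ p)] (μ : Measure S) [IsFiniteMeasure μ] {Y : S → Sp d}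
    (hY : Measurable Y) : LpSp d p →ₗ[ℝ] LpSp d p where
  toFun f := (memLp_integral_translate (μ := μ) hY hp.out (Lp.stronglyMeasurable f).measurable
    (Lp.eLpNorm_lt_top f)).toLp _
  map_add' f g := by
    rw [← MemLp.toLp_add, MemLp.toLp_eq_toLp_iff]
    filter_upwards [ae_ae_translate (μ := μ) hY (Lp.coeFn_add f g),
      ae_integrable_translate (μ := μ) hY hp.out (Lp.stronglyMeasurable f).measurable
        (Lp.eLpNorm_lt_top f),
      ae_integrable_translate (μ := μ) hY hp.out (Lp.stronglyMeasurable g).measurable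
        (Lp.eLpNorm_lt_top g)] with x hx hf hg
    rw [Pi.add_apply, ← integral_add hf hg]
    exact integral_congr_ae hx
  map_smul' c f := by
    rw [RingHom.id_apply, ← MemLp.toLp_const_smul, MemLp.toLp_eq_toLp_iff]
    filter_upwards [ae_ae_translate (μ := μ) hY (Lp.coeFn_smul c f)] with x hx
    rw [Pi.smul_apply, smul_eq_mul, ← integral_const_mul]
    exact integral_congr_ae hx

variable [hp : Fact (1 ≤ p)]

lemma coeFn_avg (hY : Measurable Y) (f : LpSp d p) :
    avg μ hY f =ᵐ[volume] fun x => ∫ o, f (x - Y o) ∂μ :=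
  MemLp.coeFn_toLp (memLp_integral_translate (μ := μ) hY hp.out
    (Lp.stronglyMeasurable f).measurable (Lp.eLpNorm_lt_top f))

lemma norm_avg_le (hY : Measurable Y) (f : LpSp d p) :
    ‖avg μ hY f‖ ≤ μ.real univ * ‖f‖ := by
  have h := eLpNorm_integral_translate_le (μ := μ) hY hp.out (Lp.stronglyMeasurable f).measurable
  rw [← eLpNorm_congr_ae (coeFn_avg hY f)] at h
  rw [Lp.norm_def, Lp.norm_def, Measure.real, ← ENNReal.toReal_mul]
  exact ENNReal.toReal_mono (ENNReal.mul_ne_top (measure_ne_top _ _) (Lp.eLpNorm_ne_top f)) h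

/-- Translates of test functions. -/
noncomputable def translate (y : Sp d) (φ : 𝓓((⊤ : TopologicalSpace.Opens (Sp d)), ℝ)) :
    𝓓((⊤ : TopologicalSpace.Opens (Sp d)), ℝ) where
  toFun x := φ (x + y)
  contDiff' := φ.contDiff.comp (contDiff_id.add contDiff_const)
  hasCompactSupport' := φ.hasCompactSupport.comp_homeomorph (Homeomorph.addRight y)
  tsupport_subset' := fun _ _ => trivial

@[simp]
lemma translate_apply (y : Sp d) (φ : 𝓓((⊤ : TopologicalSpace.Opens (Sp d)), ℝ)) (x : Sp d) :
    translate y φ x = φ (x + y) := rfl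

lemma lineDerivOp_testFunction_apply (w : Sp d) (φ : 𝓓((⊤ : TopologicalSpace.Opens (Sp d)), ℝ))
    (x : Sp d) : (∂_{w} φ) x = fderiv ℝ φ x w := by
  have h := TestFunction.fderivCLM_apply_of_le (𝕜 := ℝ) (n := ⊤) (k := ⊤) φ (by simp)
  exact congrArg (fun L : Sp d → Sp d →L[ℝ] ℝ => L x w) h

lemma lineDerivOp_translate (w y : Sp d) (φ : 𝓓((⊤ : TopologicalSpace.Opens (Sp d)), ℝ)) :
    ∂_{w} (translate y φ) = translate y (∂_{w} φ) := by
  ext x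
  rw [translate_apply, lineDerivOp_testFunction_apply, lineDerivOp_testFunction_apply]
  exact congrArg (fun L : Sp d →L[ℝ] ℝ => L w) (fderiv_comp_add_right (𝕜 := ℝ) (f := φ) (x := x) y)

/-- Derivatives commute with translations, so `ψ`, which is `φ` differentiated up to sign, serves
all `y` at once. This uniformity is what allows integrating over `y`. -/
lemma exists_iteratedLineDerivOp_translate {n : ℕ} (v : Fin n → Sp d)
    (φ : 𝓓((⊤ : TopologicalSpace.Opens (Sp d)), ℝ)) :
    ∃ ψ : 𝓓((⊤ : TopologicalSpace.Opens (Sp d)), ℝ), ∀ (y : Sp d) (u : Dist d),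
      (∂^{v} u) (translate y φ) = u (translate y ψ) := by
  induction n generalizing φ with
  | zero => exact ⟨φ, fun y u => rfl⟩
  | succ n ih =>
    obtain ⟨ψ, hψ⟩ := ih (Fin.tail v) (-∂_{v 0} φ)
    refine ⟨ψ, fun y u => ?_⟩
    rw [LineDeriv.iteratedLineDerivOp_succ_left, Distribution.lineDerivOp_apply_apply,
      lineDerivOp_translate]
    exact hψ y _

/-- Justifies Fubini when an average is paired with a test function. Hölder's inequality in `x`
gives a bound that does not depend on `o`, and `μ` is finite. -/
lemma integrable_prod_translate (hY : Measurable Y) {Z : S → Sp d} (hZ : Measurable Z)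
    (φ : 𝓓((⊤ : TopologicalSpace.Opens (Sp d)), ℝ)) (f : LpSp d p) :
    Integrable (fun z : S × Sp d => φ (z.2 + Z z.1) * f (z.2 - Y z.1)) (μ.prod volume) := by
  have hpq : ENNReal.HolderConjugate p (1 - p⁻¹)⁻¹ :=
    ENNReal.HolderConjugate.inv_one_sub_inv' hp.out
  have hφm : Measurable φ := φ.continuous.measurable
  have hfm : Measurable f := (Lp.stronglyMeasurable f).measurable
  have hφ : MemLp φ (1 - p⁻¹)⁻¹ (volume : Measure (Sp d)) :=
    φ.continuous.memLp_of_hasCompactSupport φ.hasCompactSupport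
  have hm : Measurable (fun z : S × Sp d => φ (z.2 + Z z.1) * f (z.2 - Y z.1)) := by fun_prop
  refine ⟨hm.aestronglyMeasurable, ?_⟩
  rw [hasFiniteIntegral_iff_enorm, lintegral_prod _ hm.enorm.aemeasurable]
  refine lt_of_le_of_lt (lintegral_mono
    (g := fun _ => eLpNorm f p volume * eLpNorm φ (1 - p⁻¹)⁻¹ volume) fun o => ?_) ?_
  · have h1 : eLpNorm (fun x => f (x - Y o)) p volume = eLpNorm f p volume :=
      eLpNorm_comp_measurePreserving hfm.aestronglyMeasurable
        (measurePreserving_sub_right volume (Y o))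
    have h2 : eLpNorm (fun x => φ (x + Z o)) (1 - p⁻¹)⁻¹ volume = eLpNorm φ (1 - p⁻¹)⁻¹ volume :=
      eLpNorm_comp_measurePreserving hφm.aestronglyMeasurable
        (measurePreserving_add_right volume (Z o))
    have h3 := eLpNorm_smul_le_mul_eLpNorm (p := p) (q := (1 - p⁻¹)⁻¹) (r := 1)
      (μ := (volume : Measure (Sp d)))
      (f := fun x => φ (x + Z o)) (φ := fun x => f (x - Y o))
      (by fun_prop) (by fun_prop : Measurable fun x => f (x - Y o)).aestronglyMeasurable
    rw [h1, h2, eLpNorm_one_eq_lintegral_enorm] at h3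
    refine le_trans (le_of_eq ?_) h3
    congr 1; ext x
    simp only [Pi.smul_apply', smul_eq_mul, mul_comm]
  · rw [lintegral_const]
    exact ENNReal.mul_lt_top (ENNReal.mul_lt_top (Lp.eLpNorm_lt_top f) hφ.2) (measure_lt_top _ _)

lemma lpDist_translate_apply (f : LpSp d p) (φ : 𝓓((⊤ : TopologicalSpace.Opens (Sp d)), ℝ))
    (y : Sp d) : lpDist f (translate y φ) = ∫ x, φ x * f (x - y) := by
  rw [lpDist_apply, ← integral_sub_right_eq_self (fun x => translate y φ x * f x) y]
  simp

lemma integrable_lpDist_translate (hY : Measurable Y) (f : LpSp d p)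
    (φ : 𝓓((⊤ : TopologicalSpace.Opens (Sp d)), ℝ)) :
    Integrable (fun o => lpDist f (translate (Y o) φ)) μ := by
  have := (integrable_prod_translate (μ := μ) hY (Z := fun _ => 0) measurable_const φ
    f).integral_prod_left
  simpa [lpDist_translate_apply] using this

lemma lpDist_avg_apply (hY : Measurable Y) (f : LpSp d p)
    (φ : 𝓓((⊤ : TopologicalSpace.Opens (Sp d)), ℝ)) :
    lpDist (avg μ hY f) φ = ∫ o, lpDist f (translate (Y o) φ) ∂μ := by
  have hi := integrable_prod_translate (μ := μ) hY (Z := fun _ => 0) measurable_const φ f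
  simp only [add_zero] at hi
  simp only [lpDist_translate_apply]
  rw [integral_integral_swap (f := fun o x => φ x * f (x - Y o)) hi, lpDist_apply]
  refine integral_congr_ae ?_
  filter_upwards [coeFn_avg (μ := μ) hY f] with x hx
  rw [hx, integral_const_mul]

/-- Averaging is dual to averaging on the test functions. -/
lemma lpDist_avg_apply' (hY : Measurable Y) (f : LpSp d p)
    (φ : 𝓓((⊤ : TopologicalSpace.Opens (Sp d)), ℝ)) :
    lpDist (avg μ hY f) φ = ∫ x, (∫ o, φ (x + Y o) ∂μ) * f x := by
  have hi := integrable_prod_translate (μ := μ) (Y := fun _ => 0) measurable_const hY φ f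
  simp only [sub_zero] at hi
  rw [lpDist_avg_apply]
  simp only [lpDist_apply, translate_apply]
  rw [integral_integral_swap (f := fun o x => φ (x + Y o) * f x) hi]
  simp only [integral_mul_const]

/-- Averaging preserves the linear relations between derivatives of `L^p` functions. -/
lemma sum_iteratedLineDerivOp_avg_eq_zero {ι : Type*} [Fintype ι] (hY : Measurable Y)
    (n : ι → ℕ) (w : ∀ i, Fin (n i) → Sp d) (F : ι → LpSp d p)
    (h : ∑ i, ∂^{w i} (lpDist (F i)) = 0) : ∑ i, ∂^{w i} (lpDist (avg μ hY (F i))) = 0 := by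
  have ev : ∀ (g : ι → Dist d) (φ : 𝓓((⊤ : TopologicalSpace.Opens (Sp d)), ℝ)),
      (∑ i, g i) φ = ∑ i, g i φ := fun g φ =>
    map_sum ({ toFun := fun u => u φ, map_zero' := rfl, map_add' := fun _ _ => rfl } :
      Dist d →+ ℝ) g Finset.univ
  ext φ
  choose ψ hψ using fun i => exists_iteratedLineDerivOp_translate (w i) φ
  have h0 : translate (0 : Sp d) φ = φ := by ext; simp
  have h0' : ∀ i, translate (0 : Sp d) (ψ i) = ψ i := fun i => by ext; simp
  have h1 : ∀ y, ∑ i, lpDist (F i) (translate y (ψ i)) = 0 := by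
    intro y
    have := congrArg (fun u : Dist d => u (translate y φ)) h
    simp only [ev, hψ] at this
    exact this
  have h2 : ∀ i, (∂^{w i} (lpDist (avg μ hY (F i)))) φ
      = ∫ o, lpDist (F i) (translate (Y o) (ψ i)) ∂μ := by
    intro i
    have := hψ i 0 (lpDist (avg μ hY (F i)))
    rw [h0, h0'] at this
    rw [this, lpDist_avg_apply]
  rw [ev]
  simp only [h2]
  rw [← integral_finsetSum _ fun i _ => integrable_lpDist_translate hY (F i) (ψ i)]
  simp only [h1, integral_zero]
  rfl

end Average

section Smoothing

variable {d : ℕ} {p : ℝ≥0∞} [hp : Fact (1 ≤ p)]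

lemma lpDist_add (f g : LpSp d p) : lpDist (f + g) = lpDist f + lpDist g := by
  ext φ
  have e : ∀ c : LpSp d p, Integrable (fun x => φ x * c x) (volume : Measure (Sp d)) :=
    fun c => TestFunction.integrable_bilin (ContinuousLinearMap.mul ℝ ℝ)
      (((Lp.memLp c).locallyIntegrable Fact.out).locallyIntegrableOn _) φ
  change lpDist (f + g) φ = lpDist f φ + lpDist g φ
  rw [lpDist_apply, lpDist_apply, lpDist_apply, ← integral_add (e f) (e g)]
  refine integral_congr_ae ?_
  filter_upwards [Lp.coeFn_add f g] with x hx
  rw [hx, Pi.add_apply, mul_add]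

lemma lpDist_smul (c : ℝ) (f : LpSp d p) : lpDist (c • f) = c • lpDist f := by
  ext φ
  change lpDist (c • f) φ = c * lpDist f φ
  rw [lpDist_apply, lpDist_apply, ← integral_const_mul]
  refine integral_congr_ae ?_
  filter_upwards [Lp.coeFn_smul c f] with x hx
  rw [hx, Pi.smul_apply, smul_eq_mul]
  ring

variable (d p) in
/-- The embedding of `L^p` into the distributions as a linear map. -/
noncomputable def lpDistL : LpSp d p →ₗ[ℝ] Dist d where
  toFun := lpDist
  map_add' := lpDist_add
  map_smul' := lpDist_smul

@[simp] lemma lpDistL_apply (f : LpSp d p) : lpDistL d p f = lpDist f := rfl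

lemma lpDist_sub (f g : LpSp d p) : lpDist (f - g) = lpDist f - lpDist g :=
  map_sub (lpDistL d p) f g
lemma lpDist_neg (f : LpSp d p) : lpDist (-f) = -lpDist f := map_neg (lpDistL d p) f
lemma lpDist_zero : lpDist (0 : LpSp d p) = 0 := map_zero (lpDistL d p)

/-! ### Averages along a segment -/

/-- The linear operator `A` on `L^p` preserves the linear relations between derivatives of `L^p`
functions. -/
def PreservesRelations (A : LpSp d p →ₗ[ℝ] LpSp d p) : Prop :=
  ∀ (ι : Type) [Fintype ι] (n : ι → ℕ) (w : ∀ i, Fin (n i) → Sp d) (F : ι → LpSp d p),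
    ∑ i, ∂^{w i} (lpDist (F i)) = 0 → ∑ i, ∂^{w i} (lpDist (A (F i))) = 0

/-- The relation used has two terms, `∂_w f` and `-g` with no derivative, indexed by `Bool`. -/
lemma PreservesRelations.lineDerivOp_eq {A : LpSp d p →ₗ[ℝ] LpSp d p} (hA : PreservesRelations A)
    {w : Sp d} {f g : LpSp d p} (h : ∂_{w} (lpDist f) = lpDist g) :
    ∂_{w} (lpDist (A f)) = lpDist (A g) := by
  have key := hA Bool (fun b => if b then 1 else 0) (fun _ _ => w) (fun b => if b then f else -g)
  simp only [Fintype.sum_bool] at key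
  have e : ∀ a b : LpSp d p,
      (∂^{fun _ : Fin 1 => w} (lpDist a)) + (∂^{fun _ : Fin 0 => w} (lpDist b))
      = ∂_{w} (lpDist a) + lpDist b := fun a b => rfl
  have key2 := key (by
    refine (e f (-g)).trans ?_
    rw [h, lpDist_neg, add_neg_cancel])
  have key3 : ∂_{w} (lpDist (A f)) + lpDist (A (-g)) = 0 := key2
  rw [map_neg, lpDist_neg] at key3
  exact eq_of_sub_eq_zero (by rw [sub_eq_add_neg]; exact key3)

lemma integral_lineDerivOp_segment (e : Sp d) (φ : 𝓓((⊤ : TopologicalSpace.Opens (Sp d)), ℝ))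
    (x : Sp d) (η : ℝ) :
    ∫ h in (0 : ℝ)..η, (∂_{e} φ) (x + h • e) = φ (x + η • e) - φ x := by
  have hd : ∀ h : ℝ, HasDerivAt (fun h : ℝ => φ (x + h • e)) ((∂_{e} φ) (x + h • e)) h := by
    intro h
    rw [lineDerivOp_testFunction_apply]
    have h1 : HasDerivAt (fun h : ℝ => x + h • e) e h := by
      simpa using ((hasDerivAt_id h).smul_const e).const_add x
    exact ((φ.contDiff.differentiable (by simp)) (x + h • e)).hasFDerivAt.comp_hasDerivAt h h1
  rw [intervalIntegral.integral_eq_sub_of_hasDerivAt (fun h _ => hd h)]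
  · simp
  · exact Continuous.intervalIntegrable (by fun_prop) _ _

/-- Integration by parts along the segment: the weight `1 - h/η` equals `1` at `0` and vanishes at
`η`, so only one boundary term remains. -/
lemma integral_mul_lineDerivOp_segment (e : Sp d)
    (φ : 𝓓((⊤ : TopologicalSpace.Opens (Sp d)), ℝ)) (x : Sp d) {η : ℝ} (hη : 0 < η) :
    ∫ h in (0 : ℝ)..η, (1 - η⁻¹ * h) * (∂_{e} φ) (x + h • e)
      = η⁻¹ * (∫ h in (0 : ℝ)..η, φ (x + h • e)) - φ x := by
  have hd : ∀ h : ℝ, HasDerivAt (fun h : ℝ => (1 - η⁻¹ * h) * φ (x + h • e))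
      ((0 - η⁻¹ * 1) * φ (x + h • e) + (1 - η⁻¹ * h) * (∂_{e} φ) (x + h • e)) h := by
    intro h
    rw [lineDerivOp_testFunction_apply]
    have h1 : HasDerivAt (fun h : ℝ => x + h • e) e h := by
      simpa using ((hasDerivAt_id h).smul_const e).const_add x
    exact (((hasDerivAt_const h 1).sub ((hasDerivAt_id h).const_mul η⁻¹))).mul
      (((φ.contDiff.differentiable (by simp)) (x + h • e)).hasFDerivAt.comp_hasDerivAt h h1)
  have key := intervalIntegral.integral_eq_sub_of_hasDerivAt (a := 0) (b := η) (fun h _ => hd h)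
    (Continuous.intervalIntegrable (by fun_prop) _ _)
  rw [intervalIntegral.integral_add (Continuous.intervalIntegrable (by fun_prop) _ _)
    (Continuous.intervalIntegrable (by fun_prop) _ _), intervalIntegral.integral_const_mul,
    inv_mul_cancel₀ hη.ne'] at key
  simp only [mul_one, zero_sub, sub_self, zero_mul, mul_zero, sub_zero, one_mul, zero_smul,
    add_zero] at key
  linarith

/-- The uniform probability measure on `(0, η]`. -/
noncomputable def unifMeasure (η : ℝ) : Measure ℝ :=
  ENNReal.ofReal η⁻¹ • volume.restrict (Ioc 0 η)

/-- The measure with density `1 - h / η` on `(0, η]`. -/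
noncomputable def hatMeasure (η : ℝ) : Measure ℝ :=
  (volume.restrict (Ioc 0 η)).withDensity fun h => ENNReal.ofReal (1 - η⁻¹ * h)

lemma unifMeasure_univ {η : ℝ} (hη : 0 < η) : unifMeasure η univ = 1 := by
  simp [unifMeasure, ← ENNReal.ofReal_mul (inv_nonneg.2 hη.le), inv_mul_cancel₀ hη.ne']

lemma hatMeasure_univ_le {η : ℝ} : hatMeasure η univ ≤ ENNReal.ofReal η := by
  rw [hatMeasure, withDensity_apply _ MeasurableSet.univ, Measure.restrict_univ]
  calc _ ≤ ∫⁻ _ in Ioc 0 η, 1 := by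
        refine setLIntegral_mono measurable_const fun h hh => ?_
        rw [← ENNReal.ofReal_one]
        refine ENNReal.ofReal_le_ofReal ?_
        have : 0 ≤ η⁻¹ * h := mul_nonneg (inv_nonneg.2 (hh.1.le.trans hh.2)) hh.1.le
        linarith
    _ = _ := by simp

instance (η : ℝ) : IsFiniteMeasure (unifMeasure η) :=
  ⟨by
    rw [unifMeasure, Measure.smul_apply, smul_eq_mul]
    exact ENNReal.mul_lt_top ENNReal.ofReal_lt_top (measure_lt_top _ _)⟩

instance (η : ℝ) : IsFiniteMeasure (hatMeasure η) :=
  ⟨hatMeasure_univ_le.trans_lt ENNReal.ofReal_lt_top⟩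

lemma integral_unifMeasure {η : ℝ} (hη : 0 < η) (g : ℝ → ℝ) :
    ∫ h, g h ∂(unifMeasure η) = η⁻¹ * ∫ h in (0 : ℝ)..η, g h := by
  rw [unifMeasure, integral_smul_measure, intervalIntegral.integral_of_le hη.le,
    ENNReal.toReal_ofReal (inv_nonneg.2 hη.le), smul_eq_mul]

lemma integral_hatMeasure {η : ℝ} (hη : 0 < η) (g : ℝ → ℝ) :
    ∫ h, g h ∂(hatMeasure η) = ∫ h in (0 : ℝ)..η, (1 - η⁻¹ * h) * g h := by
  rw [hatMeasure, integral_withDensity_eq_integral_toReal_smul (by fun_prop) (by simp),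
    intervalIntegral.integral_of_le hη.le]
  refine setIntegral_congr_fun measurableSet_Ioc fun h hh => ?_
  rw [ENNReal.toReal_ofReal, smul_eq_mul]
  rw [sub_nonneg, inv_mul_le_iff₀ hη, mul_one]
  exact hh.2

/-- Averaging along a segment of length of order `η` in the direction `e`. -/
lemma exists_directional_average (e : Sp d) {η : ℝ} (hη : 0 < η) :
    ∃ (A : LpSp d p →ₗ[ℝ] LpSp d p) (K D : LpSp d p → LpSp d p),
      PreservesRelations A ∧ (∀ f, ‖A f‖ ≤ ‖f‖) ∧
      (∀ f, ∂_{e} (lpDist (A f)) = lpDist (D f)) ∧ (∀ f, ‖D f‖ ≤ 2 / η * ‖f‖) ∧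
      (∀ f, lpDist f - lpDist (A f) = ∂_{e} (lpDist (K f))) ∧ ∀ f, ‖K f‖ ≤ η * ‖f‖ := by
  have hY : Measurable (fun h : ℝ => h • e) := by fun_prop
  have hY' : Measurable (fun _ : ℝ => η • e) := measurable_const
  have hfi : ∀ (φ : 𝓓((⊤ : TopologicalSpace.Opens (Sp d)), ℝ)) (f : LpSp d p),
      Integrable (fun x => φ x * f x) volume := fun φ f =>
    TestFunction.integrable_bilin (ContinuousLinearMap.mul ℝ ℝ)
      (((Lp.memLp f).locallyIntegrable Fact.out).locallyIntegrableOn _) φ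
  -- The derivative of the uniform average is a difference quotient, which is `D`. The measure
  -- `hatMeasure η` is the primitive of the difference between the unit mass at `0` and `unifMeasure
  -- η`; its mass at most `η` is the gain for one lost derivative. The identities are checked on
  -- test functions by duality.
  refine ⟨avg (unifMeasure η) hY, avg (hatMeasure η) hY,
    fun f => η⁻¹ • (f - avg (Measure.dirac (0 : ℝ)) hY' f), ?_, ?_, ?_, ?_, ?_, ?_⟩
  · intro ι _ n w F h
    exact sum_iteratedLineDerivOp_avg_eq_zero hY n w F h
  · intro f
    refine (norm_avg_le hY f).trans (le_of_eq ?_)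
    rw [Measure.real, unifMeasure_univ hη, ENNReal.toReal_one, one_mul]
  · intro f
    ext φ
    rw [Distribution.lineDerivOp_apply_apply, lpDist_smul, lpDist_sub, map_neg]
    change _ = η⁻¹ * (lpDist f φ - lpDist (avg (Measure.dirac (0 : ℝ)) hY' f) φ)
    rw [lpDist_avg_apply', lpDist_avg_apply hY']
    simp only [integral_dirac, lpDist_apply, translate_apply]
    have h1 : Integrable (fun x => φ (x + η • e) * f x) volume := hfi (translate (η • e) φ) f
    rw [← integral_sub (hfi φ f) h1, ← integral_const_mul, ← integral_neg]
    refine integral_congr_ae (.of_forall fun x => ?_)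
    simp only [integral_unifMeasure hη, integral_lineDerivOp_segment]
    ring
  · intro f
    have h1 := norm_avg_le (μ := Measure.dirac (0 : ℝ)) hY' f
    rw [probReal_univ, one_mul] at h1
    rw [norm_smul, Real.norm_of_nonneg (inv_nonneg.2 hη.le), div_eq_inv_mul, mul_assoc]
    have h2 := norm_sub_le f (avg (Measure.dirac (0 : ℝ)) hY' f)
    have : ‖f - (avg (Measure.dirac (0 : ℝ)) hY') f‖ ≤ 2 * ‖f‖ := by linarith
    gcongr
  · intro f
    ext φ
    rw [Distribution.lineDerivOp_apply_apply, map_neg]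
    change lpDist f φ - lpDist (avg (unifMeasure η) hY f) φ = _
    have hi := (integrable_prod_translate (μ := unifMeasure η) (Y := fun _ => 0) measurable_const hY
      φ f).integral_prod_right
    simp only [sub_zero, integral_mul_const] at hi
    rw [lpDist_avg_apply', lpDist_avg_apply', lpDist_apply, ← integral_sub (hfi φ f) hi,
      ← integral_neg]
    refine integral_congr_ae (.of_forall fun x => ?_)
    simp only [integral_unifMeasure hη, integral_hatMeasure hη,
      integral_mul_lineDerivOp_segment e φ x hη]
    ring
  · intro f
    refine (norm_avg_le hY f).trans (mul_le_mul_of_nonneg_right ?_ (norm_nonneg _))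
    exact ENNReal.toReal_le_of_le_ofReal hη.le hatMeasure_univ_le

/-! ### Averages over boxes -/

/-- The unit coordinate vectors. -/
noncomputable abbrev coordVec (i : Fin d) : Sp d := EuclideanSpace.single i (1 : ℝ)

/-- Segment averages are composed one direction at a time. Earlier derivative bounds survive because
the new average commutes with derivatives, and `f - A R f = (f - R f) + (R f - A R f)` adds one term
to the representation. -/
lemma exists_box_average_finset {η : ℝ} (hη : 0 < η) (s : Finset (Fin d)) :
    ∃ R : LpSp d p →ₗ[ℝ] LpSp d p, PreservesRelations R ∧ (∀ f, ‖R f‖ ≤ ‖f‖) ∧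
      (∀ i ∈ s, ∀ f, ∃ g : LpSp d p, ∂_{coordVec i} (lpDist (R f)) = lpDist g ∧ ‖g‖ ≤ 2 / η * ‖f‖) ∧
      ∀ f, ∃ k : Fin d → LpSp d p, lpDist f - lpDist (R f) = ∑ i, ∂_{coordVec i} (lpDist (k i)) ∧
        ∑ i, ‖k i‖ ≤ s.card * (η * ‖f‖) := by
  classical
  induction s using Finset.induction with
  | empty =>
    refine ⟨LinearMap.id, fun ι _ n w F h => h, fun f => le_rfl, by simp, fun f => ⟨0, ?_, by simp⟩⟩
    simp [lpDist_zero]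
  | insert j s hj ih =>
    obtain ⟨R, hR1, hR2, hR3, hR4⟩ := ih
    obtain ⟨A, K, D, hA1, hA2, hD1, hD2, hK1, hK2⟩ :=
      exists_directional_average (p := p) (coordVec j) hη
    refine ⟨A ∘ₗ R, ?_, ?_, ?_, ?_⟩
    · intro ι _ n w F h
      exact hA1 ι n w _ (hR1 ι n w F h)
    · exact fun f => (hA2 _).trans (hR2 f)
    · intro i hi f
      rcases Finset.mem_insert.1 hi with rfl | hi
      · refine ⟨D (R f), hD1 _, (hD2 _).trans ?_⟩
        have := hR2 f
        gcongr
      · obtain ⟨g, hg1, hg2⟩ := hR3 i hi f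
        exact ⟨A g, hA1.lineDerivOp_eq hg1, (hA2 g).trans hg2⟩
    · intro f
      obtain ⟨k, hk1, hk2⟩ := hR4 f
      refine ⟨k + Pi.single j (K (R f)), ?_, ?_⟩
      · have e : ∀ i, ∂_{coordVec i} (lpDist ((k + Pi.single j (K (R f)) : Fin d → LpSp d p) i)) =
            ∂_{coordVec i} (lpDist (k i)) +
              if i = j then ∂_{coordVec j} (lpDist (K (R f))) else 0 := by
          intro i
          rw [Pi.add_apply, lpDist_add, LineDeriv.lineDerivOp_add]
          congr 1
          split_ifs with h
          · subst h; simp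
          · simp [h, lpDist_zero]
        simp only [e]
        rw [Finset.sum_add_distrib, Finset.sum_ite_eq' Finset.univ j, if_pos (Finset.mem_univ _),
          ← hk1, ← hK1 (R f)]
        simp
      · have e : ∑ i, ‖(Pi.single j (K (R f)) : Fin d → LpSp d p) i‖ = ‖K (R f)‖ := by
          rw [Finset.sum_eq_single j]
          · simp
          · intro i _ hi; simp [hi]
          · simp
        calc _ ≤ ∑ i, (‖k i‖ + ‖(Pi.single j (K (R f)) : Fin d → LpSp d p) i‖) :=
              Finset.sum_le_sum fun i _ => norm_add_le _ _
          _ ≤ s.card * (η * ‖f‖) + η * ‖f‖ := by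
              rw [Finset.sum_add_distrib, e]
              refine add_le_add hk2 ((hK2 _).trans ?_)
              have := hR2 f
              gcongr
          _ = _ := by
              rw [Finset.card_insert_of_notMem hj]; push_cast; ring

/-- Averaging over a box of side `η`. -/
lemma exists_box_average {η : ℝ} (hη : 0 < η) :
    ∃ R : LpSp d p →ₗ[ℝ] LpSp d p, PreservesRelations R ∧ (∀ f, ‖R f‖ ≤ ‖f‖) ∧
      (∀ (i : Fin d) (f : LpSp d p), ∃ g : LpSp d p, ∂_{coordVec i} (lpDist (R f)) = lpDist g ∧
        ‖g‖ ≤ 2 / η * ‖f‖) ∧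
      ∀ f, ∃ k : Fin d → LpSp d p, lpDist f - lpDist (R f) = ∑ i, ∂_{coordVec i} (lpDist (k i)) ∧
        ∑ i, ‖k i‖ ≤ d * (η * ‖f‖) := by
  simpa using exists_box_average_finset (p := p) hη (Finset.univ : Finset (Fin d))

end Smoothing

/-! ### Negative Sobolev norms through representations -/

section NegNorm

variable {d : ℕ} {p : ℝ≥0∞} [hp : Fact (1 ≤ p)]

variable (p) in
/-- The norm of `W^{-k,p}`, for `k ≥ 0`, defined by representations for `k = 0` as well. -/
noncomputable def negNorm (k : ℕ) (u : Dist d) : ℝ≥0∞ :=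
  ⨅ (g : LpFam d k p) (_ : divMap d k p g = u), ‖g‖ₑ

lemma sobNorm_neg_one (u : Dist d) : sobNorm p (-1) u = negNorm p 1 u := rfl

lemma negNorm_divMap_le {k : ℕ} (g : LpFam d k p) : negNorm p k (divMap d k p g) ≤ ‖g‖ₑ :=
  iInf₂_le (f := fun (h : LpFam d k p) (_ : divMap d k p h = divMap d k p g) => ‖h‖ₑ) g rfl

lemma enorm_lpFam {k : ℕ} (g : LpFam d k p) : ‖g‖ₑ = ∑ m, ‖g m‖ₑ := by
  have h : ‖g‖ = ∑ m, ‖g m‖ := PiLp.norm_eq_of_L1 g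
  rw [← ofReal_norm, h, ENNReal.ofReal_sum_of_nonneg fun _ _ => norm_nonneg _]
  simp only [ofReal_norm]

lemma divMap_apply {k : ℕ} (g : LpFam d k p) :
    divMap d k p g = ∑ m, partialD m (lpDist (g m)) := rfl

/-- The iterated derivative along coordinate directions. -/
noncomputable def coordDeriv {n : ℕ} (w : Fin n → Fin d) (u : Dist d) : Dist d :=
  ∂^{fun i => (coordVec (w i) : Sp d)} u

lemma coordDeriv_add {n : ℕ} (w : Fin n → Fin d) (u u' : Dist d) :
    coordDeriv w (u + u') = coordDeriv w u + coordDeriv w u' :=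
  LineDeriv.iteratedLineDerivOp_add _ _ _

lemma coordDeriv_sub {n : ℕ} (w : Fin n → Fin d) (u u' : Dist d) :
    coordDeriv w (u - u') = coordDeriv w u - coordDeriv w u' := by
  rw [sub_eq_add_neg, coordDeriv_add, coordDeriv, coordDeriv, coordDeriv,
    LineDeriv.iteratedLineDerivOp_neg, sub_eq_add_neg]

lemma coordDeriv_sum {n : ℕ} (w : Fin n → Fin d) {ι : Type*} (s : Finset ι) (u : ι → Dist d) :
    coordDeriv w (∑ i ∈ s, u i) = ∑ i ∈ s, coordDeriv w (u i) :=
  LineDeriv.iteratedLineDerivOp_sum _ _ _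

lemma coordDeriv_lineDerivOp {n : ℕ} (w : Fin n → Fin d) (i : Fin d) (u : Dist d) :
    coordDeriv w (∂_{(coordVec i : Sp d)} u)
      = coordDeriv (Fin.snoc w i : Fin (n + 1) → Fin d) u := by
  rw [coordDeriv, coordDeriv, LineDeriv.iteratedLineDerivOp_succ_right]
  simp only [Fin.snoc_last]
  congr 1
  ext j : 1
  simp [Fin.init]

open Classical in
lemma divMap_single {k : ℕ} (m₀ : DerivIdx d k) (f : LpSp d p) :
    divMap d k p (WithLp.toLp 1 (Pi.single m₀ f)) = coordDeriv m₀.2 (lpDist f) := by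
  rw [divMap_apply, Finset.sum_eq_single m₀]
  · simp only [Pi.single_eq_same]
    rfl
  · intro m _ hm
    simp only [Pi.single_eq_of_ne hm, lpDist_zero]
    exact LineDeriv.iteratedLineDerivOp_zero _
  · simp

lemma negNorm_coordDeriv_le {k n : ℕ} (hn : n ≤ k) (w : Fin n → Fin d) (f : LpSp d p) :
    negNorm p k (coordDeriv w (lpDist f)) ≤ ‖f‖ₑ := by
  classical
  have h := divMap_single (p := p) (⟨⟨n, Nat.lt_succ_of_le hn⟩, w⟩ : DerivIdx d k) f
  have h' := negNorm_divMap_le (WithLp.toLp 1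
    (Pi.single (⟨⟨n, Nat.lt_succ_of_le hn⟩, w⟩ : DerivIdx d k) f) : LpFam d k p)
  rw [← ofReal_norm, PiLp.norm_toLp_single, ofReal_norm] at h'
  convert h' using 2
  convert h.symm

lemma negNorm_lpDist_le (k : ℕ) (f : LpSp d p) : negNorm p k (lpDist f) ≤ ‖f‖ₑ :=
  negNorm_coordDeriv_le (Nat.zero_le k) Fin.elim0 f

lemma sobNorm_zero_lpDist_le (f : LpSp d p) : sobNorm p 0 (lpDist f) ≤ ‖f‖ₑ := by
  refine (iInf₂_le (WithLp.toLp 1 fun _ => f : LpFam d 0 p) fun m => ?_).trans ?_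
  · obtain ⟨j, w⟩ := m
    obtain ⟨j, hj⟩ := j
    obtain rfl : j = 0 := Nat.lt_one_iff.1 hj
    rfl
  · rw [enorm_lpFam]
    simp only [Finset.sum_const, nsmul_eq_mul]
    simp [Fintype.card_sigma]

lemma exists_lt_of_negNorm_lt {k : ℕ} {u : Dist d} {c : ℝ≥0∞} (h : negNorm p k u < c) :
    ∃ g : LpFam d k p, divMap d k p g = u ∧ ‖g‖ₑ < c := by
  simp only [negNorm, iInf_lt_iff] at h
  obtain ⟨g, hg, hc⟩ := h
  exact ⟨g, hg, hc⟩

lemma negNorm_add_le (k : ℕ) (u u' : Dist d) :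
    negNorm p k (u + u') ≤ negNorm p k u + negNorm p k u' := by
  refine ENNReal.le_of_forall_pos_le_add fun ε hε hfin => ?_
  have hfin' := ENNReal.add_lt_top.1 hfin
  have hε2 : ((ε / 2 : NNReal) : ℝ≥0∞) ≠ 0 := by
    simpa using hε.ne'
  obtain ⟨g, hg, hg'⟩ := exists_lt_of_negNorm_lt (ENNReal.lt_add_right hfin'.1.ne hε2)
  obtain ⟨h, hh, hh'⟩ := exists_lt_of_negNorm_lt (ENNReal.lt_add_right hfin'.2.ne hε2)
  rw [← hg, ← hh, ← map_add]
  refine (negNorm_divMap_le _).trans ((enorm_add_le _ _).trans ?_)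
  rw [hg, hh]
  refine (add_le_add hg'.le hh'.le).trans (le_of_eq ?_)
  rw [add_add_add_comm, ← ENNReal.coe_add, add_halves]

lemma negNorm_zero (k : ℕ) : negNorm p k (0 : Dist d) = 0 := by
  have := negNorm_divMap_le (0 : LpFam d k p)
  rw [map_zero, enorm_zero] at this
  exact le_antisymm this zero_le

lemma negNorm_neg (k : ℕ) (u : Dist d) : negNorm p k (-u) = negNorm p k u := by
  have : ∀ u : Dist d, negNorm p k (-u) ≤ negNorm p k u := by
    intro u
    refine le_iInf₂ fun g hg => ?_
    rw [← hg, ← map_neg, ← enorm_neg g]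
    exact negNorm_divMap_le _
  exact le_antisymm (this u) (by simpa using this (-u))

lemma negNorm_sub_le (k : ℕ) (u u' : Dist d) :
    negNorm p k (u - u') ≤ negNorm p k u + negNorm p k u' := by
  rw [sub_eq_add_neg, ← negNorm_neg k u']
  exact negNorm_add_le k _ _

lemma negNorm_sum_le (k : ℕ) {ι : Type*} (s : Finset ι) (u : ι → Dist d) :
    negNorm p k (∑ i ∈ s, u i) ≤ ∑ i ∈ s, negNorm p k (u i) :=
  Finset.le_sum_of_subadditive _ (negNorm_zero k).le (negNorm_add_le k) _ _

/-- A linear map is bounded from `W^{-k,p}` to `W^{-l,p}` if it is so on the derivatives of order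
at most `k` of functions in `L^p`. -/
lemma negNorm_map_le_of_coordDeriv {k k' : ℕ} (Φ : Dist d →ₗ[ℝ] Dist d) {c : ℝ} (hc : 0 < c)
    (h : ∀ n ≤ k, ∀ (w : Fin n → Fin d) (f : LpSp d p),
      negNorm p k' (Φ (coordDeriv w (lpDist f))) ≤ ENNReal.ofReal c * ‖f‖ₑ) (u : Dist d) :
    negNorm p k' (Φ u) ≤ ENNReal.ofReal c * negNorm p k u := by
  have hc0 : ENNReal.ofReal c ≠ 0 := by simpa using hc
  rw [← ENNReal.div_le_iff' hc0 ENNReal.ofReal_ne_top]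
  refine le_iInf₂ fun g hg => ?_
  rw [ENNReal.div_le_iff' hc0 ENNReal.ofReal_ne_top, ← hg, divMap_apply, map_sum, enorm_lpFam,
    Finset.mul_sum]
  refine (negNorm_sum_le _ _ _).trans (Finset.sum_le_sum fun m _ => ?_)
  exact h _ (Nat.le_of_lt_succ m.1.2) m.2 (g m)

lemma negNorm_mono {k k' : ℕ} (h : k ≤ k') (u : Dist d) : negNorm p k' u ≤ negNorm p k u := by
  have := negNorm_map_le_of_coordDeriv (p := p) (k := k) (k' := k') LinearMap.id one_pos
    (fun n hn w f => by
      rw [ENNReal.ofReal_one, one_mul]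
      exact negNorm_coordDeriv_le (hn.trans h) w f) u
  simpa using this

lemma negNorm_negDist_le (q : NegSobolev d 2 p) : negNorm p 2 (negDist q) ≤ ‖q‖ₑ := by
  refine ENNReal.le_of_forall_pos_le_add fun ε hε _ => ?_
  obtain ⟨g, hg, hg'⟩ := Submodule.Quotient.norm_mk_lt q (NNReal.coe_pos.2 hε)
  have e : negDist q = divMap d 2 p g := by rw [← hg]; rfl
  rw [e]
  refine (negNorm_divMap_le g).trans ?_
  rw [← ofReal_norm, ← ofReal_norm, ← ENNReal.ofReal_coe_nnreal]
  exact (ENNReal.ofReal_le_ofReal hg'.le).trans ENNReal.ofReal_add_le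

/-! ### Smoothing operators -/

/-- Acting on each function of a representation respects the kernel of `divMap`, hence defines an
operator on its range, that is, on `W^{-N,p}`. It is then extended to all distributions by linear
algebra; no bound is claimed outside the range. -/
lemma PreservesRelations.exists_extension {R : LpSp d p →ₗ[ℝ] LpSp d p}
    (hR : PreservesRelations R) (N : ℕ) :
    ∃ Φ : Dist d →ₗ[ℝ] Dist d, ∀ n ≤ N, ∀ (w : Fin n → Fin d) (f : LpSp d p),
      Φ (coordDeriv w (lpDist f)) = coordDeriv w (lpDist (R f)) := by
  let Rf : LpFam d N p →ₗ[ℝ] LpFam d N p :=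
    { toFun := fun g => WithLp.toLp 1 fun m => R (g m)
      map_add' := fun g h => by ext1 m; simp
      map_smul' := fun c g => by ext1 m; simp }
  have hker : LinearMap.ker (divMap d N p) ≤ LinearMap.ker (divMap d N p ∘ₗ Rf) := by
    intro g hg
    rw [LinearMap.mem_ker] at hg ⊢
    exact hR _ (fun m : DerivIdx d N => (m.1 : ℕ)) (fun m i => coordVec (m.2 i)) (fun m => g m) hg
  let Ψ := (LinearMap.ker (divMap d N p)).liftQ (divMap d N p ∘ₗ Rf) hker
  obtain ⟨Φ, hΦ⟩ := LinearMap.exists_extend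
    (Ψ ∘ₗ (divMap d N p).quotKerEquivRange.symm.toLinearMap)
  have key : ∀ g, Φ (divMap d N p g) = divMap d N p (Rf g) := by
    intro g
    have h1 := congrArg (fun L => L ⟨divMap d N p g, LinearMap.mem_range_self _ g⟩) hΦ
    simp only [LinearMap.comp_apply, Submodule.subtype_apply, LinearEquiv.coe_coe] at h1
    rw [h1, LinearMap.quotKerEquivRange_symm_apply_image]
    rfl
  refine ⟨Φ, fun n hn w f => ?_⟩
  classical
  set m₀ : DerivIdx d N := ⟨⟨n, Nat.lt_succ_of_le hn⟩, w⟩ with hm₀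
  have e : ∀ f : LpSp d p,
      divMap d N p (WithLp.toLp 1 (Pi.single m₀ f)) = coordDeriv w (lpDist f) := fun f => by
    convert divMap_single m₀ f
  rw [← e f, key, ← e (R f)]
  congr 1
  ext1 m
  change R ((Pi.single m₀ f : DerivIdx d N → LpSp d p) m)
    = (Pi.single m₀ (R f) : DerivIdx d N → LpSp d p) m
  rcases eq_or_ne m m₀ with rfl | h
  · simp
  · simp [Pi.single_eq_of_ne h]

lemma enorm_le_ofReal_mul {f g : LpSp d p} {c : ℝ} (h : ‖g‖ ≤ c * ‖f‖) (hc : 0 ≤ c) :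
    ‖g‖ₑ ≤ ENNReal.ofReal c * ‖f‖ₑ := by
  rw [← ofReal_norm, ← ofReal_norm, ← ENNReal.ofReal_mul hc]
  exact ENNReal.ofReal_le_ofReal h

/-- Smoothing operators of order one. -/
lemma exists_smoothing_one (N : ℕ) {η : ℝ} (hη : 0 < η) (hη1 : η ≤ 1) :
    ∃ R : Dist d →ₗ[ℝ] Dist d, ∀ u : Dist d,
      (∀ k ≤ N, negNorm p k (R u) ≤ negNorm p k u) ∧
      (∀ k, k + 1 ≤ N → negNorm p k (R u) ≤ ENNReal.ofReal ((d + 2) / η) * negNorm p (k + 1) u) ∧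
      (∀ k, k + 1 ≤ N →
        negNorm p (k + 1) (u - R u) ≤ ENNReal.ofReal ((d + 2) * η) * negNorm p k u) := by
  obtain ⟨R₀, hR1, hR2, hR3, hR4⟩ := exists_box_average (d := d) (p := p) hη
  obtain ⟨R, hR⟩ := hR1.exists_extension N
  have hd : (0 : ℝ) ≤ d := Nat.cast_nonneg d
  have hR2' : ∀ f : LpSp d p, ‖R₀ f‖ₑ ≤ ‖f‖ₑ := fun f => by
    simpa using enorm_le_ofReal_mul (c := 1) (by simpa using hR2 f) zero_le_one
  refine ⟨R, fun u => ⟨fun k hk => ?_, fun k hk => ?_, fun k hk => ?_⟩⟩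
  · have := negNorm_map_le_of_coordDeriv (p := p) (k := k) (k' := k) R one_pos
      (fun n hn w f => by
        rw [ENNReal.ofReal_one, one_mul, hR n (hn.trans hk)]
        exact (negNorm_coordDeriv_le hn w _).trans (hR2' f)) u
    simpa using this
  · have hc : 2 / η ≤ (d + 2) / η := by gcongr; linarith
    have hc1 : 1 ≤ (d + 2) / η := by rw [le_div_iff₀ hη]; linarith
    refine negNorm_map_le_of_coordDeriv R (by positivity) (fun n hn w f => ?_) u
    rw [hR n (hn.trans hk)]
    -- Only derivatives of top order `k + 1` must lose one: the innermost is moved onto `R₀ f`.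
    -- Those of lower order lie in `W^{-k,p}` already, and `η ≤ 1` gives `1 ≤ (d + 2) / η`.
    rcases Nat.lt_or_ge k n with h | h
    · obtain rfl : n = k + 1 := le_antisymm hn h
      obtain ⟨g, hg, hg'⟩ := hR3 (w (Fin.last k)) f
      have e : coordDeriv w (lpDist (R₀ f)) = coordDeriv (Fin.init w) (lpDist g) := by
        rw [← hg, coordDeriv_lineDerivOp, Fin.snoc_init_self]
      rw [e]
      refine (negNorm_coordDeriv_le le_rfl _ g).trans (enorm_le_ofReal_mul ?_ (by positivity))
      exact hg'.trans (by gcongr)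
    · refine (negNorm_coordDeriv_le h w _).trans ((hR2' f).trans ?_)
      calc ‖f‖ₑ = 1 * ‖f‖ₑ := (one_mul _).symm
        _ ≤ _ := by
          gcongr
          rw [← ENNReal.ofReal_one]
          exact ENNReal.ofReal_le_ofReal hc1
  · refine negNorm_map_le_of_coordDeriv (p := p) (c := (d + 2) * η) (LinearMap.id - R)
      (by positivity) (fun n hn w f => ?_) u
    rw [LinearMap.sub_apply, LinearMap.id_apply, hR n (by omega), ← coordDeriv_sub]
    obtain ⟨s, hs, hs'⟩ := hR4 f
    rw [hs, coordDeriv_sum]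
    refine (negNorm_sum_le _ _ _).trans ?_
    calc _ ≤ ∑ i, ‖s i‖ₑ := Finset.sum_le_sum fun i _ => by
          rw [coordDeriv_lineDerivOp]
          exact negNorm_coordDeriv_le (by omega) _ _
      _ = ENNReal.ofReal (∑ i, ‖s i‖) := by
          rw [ENNReal.ofReal_sum_of_nonneg fun _ _ => norm_nonneg _]
          simp only [ofReal_norm]
      _ ≤ ENNReal.ofReal ((d + 2) * η * ‖f‖) := by
          refine ENNReal.ofReal_le_ofReal (hs'.trans ?_)
          rw [mul_assoc]
          gcongr
          linarith
      _ = _ := by rw [ENNReal.ofReal_mul (by positivity), ofReal_norm]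

/-- Smoothing operators of order two. -/
lemma exists_smoothing_two {η : ℝ} (hη : 0 < η) (hη1 : η ≤ 1) :
    ∃ J : Dist d →ₗ[ℝ] Dist d, ∀ u : Dist d,
      (∀ k ≤ 3, negNorm p k (J u) ≤ ENNReal.ofReal (4 * (d + 2) ^ 2) * negNorm p k u) ∧
      (∀ k ≤ 2, negNorm p k (J u) ≤ ENNReal.ofReal (4 * (d + 2) ^ 2 / η) * negNorm p (k + 1) u) ∧
      (∀ k ≤ 1, negNorm p k (J u) ≤
        ENNReal.ofReal (4 * (d + 2) ^ 2 / η ^ 2) * negNorm p (k + 2) u) ∧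
      (∀ k ≤ 2, negNorm p (k + 1) (u - J u) ≤
        ENNReal.ofReal (4 * (d + 2) ^ 2 * η) * negNorm p k u) ∧
      (∀ k ≤ 1, negNorm p (k + 2) (u - J u) ≤
        ENNReal.ofReal (4 * (d + 2) ^ 2 * η ^ 2) * negNorm p k u) := by
  obtain ⟨R, hR⟩ := exists_smoothing_one (d := d) (p := p) 3 hη hη1
  have R1 : ∀ k ≤ 3, ∀ u, negNorm p k (R u) ≤ negNorm p k u := fun k hk u => (hR u).1 k hk
  have R2 : ∀ k, k + 1 ≤ 3 → ∀ u,
      negNorm p k (R u) ≤ ENNReal.ofReal ((d + 2) / η) * negNorm p (k + 1) u :=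
    fun k hk u => (hR u).2.1 k hk
  have R3 : ∀ k, k + 1 ≤ 3 → ∀ u,
      negNorm p (k + 1) (u - R u) ≤ ENNReal.ofReal ((d + 2) * η) * negNorm p k u :=
    fun k hk u => (hR u).2.2 k hk
  have hd : (0 : ℝ) ≤ d := Nat.cast_nonneg d
  have mul2 : ∀ (a b : ℝ) (x : ℝ≥0∞), 0 ≤ a →
      ENNReal.ofReal a * (ENNReal.ofReal b * x) = ENNReal.ofReal (a * b) * x := fun a b x ha => by
    rw [← mul_assoc, ENNReal.ofReal_mul ha]
  have le2 : ∀ (a b : ℝ) (x : ℝ≥0∞), a ≤ b → ENNReal.ofReal a * x ≤ ENNReal.ofReal b * x :=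
    fun a b x h => by gcongr
  have add1 : ∀ k (u v : Dist d) {x : ℝ≥0∞}, negNorm p k u ≤ x → negNorm p k v ≤ x →
      negNorm p k (u + v) ≤ ENNReal.ofReal 2 * x := fun k u v x hu hv => by
    rw [ENNReal.ofReal_ofNat, two_mul]
    exact (negNorm_add_le _ _ _).trans (add_le_add hu hv)
  -- `P = 1 - R²`
  let P : Dist d →ₗ[ℝ] Dist d := LinearMap.id - R ∘ₗ R
  have hP : ∀ u, P u = (u + R u) - R (u + R u) := fun u => by
    simp only [P, LinearMap.sub_apply, LinearMap.id_apply, LinearMap.comp_apply, map_add]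
    abel
  have P1 : ∀ k ≤ 3, ∀ u, negNorm p k (P u) ≤ ENNReal.ofReal 2 * negNorm p k u := by
    intro k hk u
    have e : P u = u + -(R (R u)) := by simp [P, sub_eq_add_neg]
    rw [e]
    refine add1 k _ _ le_rfl ?_
    rw [negNorm_neg]
    exact (R1 k hk _).trans (R1 k hk _)
  -- From `1 - R² = (1 - R)(1 + R)`, so `P` gains a factor `η` per order given up, just as `1 - R`
  -- does.
  have P2 : ∀ k ≤ 2, ∀ u,
      negNorm p (k + 1) (P u) ≤ ENNReal.ofReal (2 * (d + 2) * η) * negNorm p k u := by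
    intro k hk u
    rw [hP]
    refine (R3 k (by omega) _).trans ?_
    refine (mul_le_mul_right (add1 k u (R u) le_rfl (R1 k (by omega) u)) _).trans ?_
    rw [mul2 _ _ _ (by positivity)]
    exact le2 _ _ _ (by linarith)
  -- `J = R²(2 - R²)`, hence `1 - J = (1 - R²)² = P²`. The two factors `R` smooth by two orders, and
  -- the two factors `P` yield `η²` for two orders, which `1 - R` alone would not.
  let J : Dist d →ₗ[ℝ] Dist d := R ∘ₗ R ∘ₗ (LinearMap.id + P)
  have hJ : ∀ u, J u = R (R (u + P u)) := fun u => rfl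
  have hJ' : ∀ u, u - J u = P (P u) := fun u => by
    simp only [J, P, LinearMap.sub_apply, LinearMap.id_apply, LinearMap.comp_apply, map_sub,
      LinearMap.add_apply, map_add]
    abel
  have Q : ∀ k ≤ 3, ∀ u, negNorm p k (u + P u) ≤ ENNReal.ofReal 4 * negNorm p k u := by
    intro k hk u
    refine (add1 k u (P u) (x := ENNReal.ofReal 2 * negNorm p k u) ?_ (P1 k hk u)).trans ?_
    · nth_rewrite 1 [← one_mul (negNorm p k u), ← ENNReal.ofReal_one]
      exact le2 _ _ _ (by norm_num)
    · rw [mul2 _ _ _ (by norm_num)]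
      exact le2 _ _ _ (by norm_num)
  have h1 : (1 : ℝ) ≤ (d + 2) ^ 2 := by nlinarith
  have h2 : (d + 2 : ℝ) ≤ (d + 2) ^ 2 := by nlinarith
  refine ⟨J, fun u => ⟨fun k hk => ?_, fun k hk => ?_, fun k hk => ?_, fun k hk => ?_,
    fun k hk => ?_⟩⟩
  · rw [hJ]
    refine (R1 k hk _).trans ((R1 k hk _).trans ((Q k hk u).trans (le2 _ _ _ ?_)))
    linarith
  · rw [hJ]
    refine (R1 k (by omega) _).trans ((R2 k (by omega) _).trans ?_)
    refine (mul_le_mul_right (Q (k + 1) (by omega) u) _).trans ?_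
    rw [mul2 _ _ _ (by positivity), div_mul_eq_mul_div]
    exact le2 _ _ _ (div_le_div_of_nonneg_right (by linarith) hη.le)
  · rw [hJ]
    refine (R2 k (by omega) _).trans ?_
    refine (mul_le_mul_right (R2 (k + 1) (by omega) _) _).trans ?_
    rw [mul2 _ _ _ (by positivity)]
    refine (mul_le_mul_right (Q (k + 2) (by omega) u) _).trans ?_
    rw [mul2 _ _ _ (by positivity)]
    exact le2 _ _ _ (le_of_eq (by field_simp))
  · rw [hJ']
    refine (P2 k hk _).trans ?_
    refine (mul_le_mul_right (P1 k (by omega) u) _).trans ?_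
    rw [mul2 _ _ _ (by positivity)]
    refine le2 _ _ _ ?_
    nlinarith
  · rw [hJ']
    refine (P2 (k + 1) (by omega) _).trans ?_
    refine (mul_le_mul_right (P2 k (by omega) u) _).trans ?_
    rw [mul2 _ _ _ (by positivity)]
    exact le2 _ _ _ (le_of_eq (by ring))

end NegNorm

/-! ### Lower semicontinuity of the `L^p` norm -/

section LowerSemicontinuity

variable {d : ℕ} {p : ℝ≥0∞} [hp : Fact (1 ≤ p)]

/-- The probability measure with density a normalised bump function. -/
noncomputable def bumpMeasure (b : ContDiffBump (0 : Sp d)) : Measure (Sp d) :=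
  volume.withDensity fun y => ENNReal.ofReal (b.normed volume y)

lemma bumpMeasure_univ (b : ContDiffBump (0 : Sp d)) : bumpMeasure b univ = 1 := by
  rw [bumpMeasure, withDensity_apply _ MeasurableSet.univ, Measure.restrict_univ,
    ← ofReal_integral_eq_lintegral_ofReal b.integrable_normed
      (.of_forall fun x => b.nonneg_normed x), b.integral_normed, ENNReal.ofReal_one]

instance (b : ContDiffBump (0 : Sp d)) : IsFiniteMeasure (bumpMeasure b) :=
  ⟨by rw [bumpMeasure_univ]; exact ENNReal.one_lt_top⟩

lemma convolution_normed_eq (b : ContDiffBump (0 : Sp d)) (f : Sp d → ℝ) :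
    convolution (b.normed volume) f (ContinuousLinearMap.lsmul ℝ ℝ) volume
      = fun x => ∫ y, f (x - y) ∂(bumpMeasure b) := by
  ext x
  have hm : Measurable (fun y => ENNReal.ofReal (b.normed volume y)) :=
    ENNReal.measurable_ofReal.comp b.continuous_normed.measurable
  rw [bumpMeasure, integral_withDensity_eq_integral_toReal_smul hm (by simp)]
  simp only [ENNReal.toReal_ofReal (b.nonneg_normed _)]
  rfl

/-- The test function `y ↦ ρ (x - y)` for a normalised bump function `ρ`. -/
noncomputable def bumpTest (b : ContDiffBump (0 : Sp d)) (x : Sp d) :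
    𝓓((⊤ : TopologicalSpace.Opens (Sp d)), ℝ) where
  toFun y := b.normed volume (x - y)
  contDiff' := b.contDiff_normed.comp (contDiff_const.sub contDiff_id)
  hasCompactSupport' := b.hasCompactSupport_normed.comp_homeomorph (Homeomorph.subLeft x)
  tsupport_subset' := fun _ _ => trivial

/-- Turns convergence of distributions into pointwise convergence of mollifications. -/
lemma convolution_normed_eq_lpDist (b : ContDiffBump (0 : Sp d)) (f : LpSp d p) (x : Sp d) :
    convolution (b.normed volume) f (ContinuousLinearMap.lsmul ℝ ℝ) volume x
      = lpDist f (bumpTest b x) := by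
  rw [lpDist_apply, convolution_def,
    ← integral_sub_left_eq_self (fun y => bumpTest b x y * f y) volume x]
  refine integral_congr_ae (.of_forall fun y => ?_)
  change _ = b.normed volume (x - (x - y)) * f (x - y)
  rw [sub_sub_cancel]
  rfl

/-- The norm of `L^p` is lower semicontinuous for convergence of distributions. -/
lemma norm_le_of_tendsto_lpDist {f : LpSp d p} {F : ℕ → LpSp d p} {M : ℝ}
    (hF : ∀ n, ‖F n‖ ≤ M)
    (h : ∀ φ, Filter.Tendsto (fun n => lpDist (F n) φ) Filter.atTop (nhds (lpDist f φ))) :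
    ‖f‖ ≤ M := by
  have hM : 0 ≤ M := (norm_nonneg _).trans (hF 0)
  have hconv : ∀ (b : ContDiffBump (0 : Sp d)) (g : LpSp d p),
      MemLp (convolution (b.normed volume) g (ContinuousLinearMap.lsmul ℝ ℝ) volume) p volume := fun b g => by
    rw [convolution_normed_eq]
    exact memLp_integral_translate measurable_id hp.out (Lp.stronglyMeasurable g).measurable
      (Lp.eLpNorm_lt_top g)
  have hle : ∀ g : LpSp d p, ‖g‖ ≤ M → eLpNorm g p volume ≤ ENNReal.ofReal M := fun g hg => by
    rw [← Lp.enorm_def, ← ofReal_norm]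
    exact ENNReal.ofReal_le_ofReal hg
  -- Fatou is used twice: here as `n → ∞` with the mollifier fixed, and below as the mollifier
  -- shrinks, by Lebesgue differentiation. No duality is involved, so `p = 1` and `p = ∞` are
  -- included.
  have hb : ∀ b : ContDiffBump (0 : Sp d), eLpNorm (convolution (b.normed volume) f
      (ContinuousLinearMap.lsmul ℝ ℝ) volume) p volume ≤ ENNReal.ofReal M := by
    intro b
    refine (Lp.eLpNorm_lim_le_liminf_eLpNorm (f := fun n => convolution (b.normed volume) (F n)
      (ContinuousLinearMap.lsmul ℝ ℝ) volume) (fun n => (hconv b (F n)).1) _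
      (.of_forall fun x => ?_)).trans ?_
    · simp only [convolution_normed_eq_lpDist]
      exact h _
    · refine (Filter.liminf_le_liminf (v := fun _ => ENNReal.ofReal M)
        (.of_forall fun n => ?_)).trans (by simp)
      rw [convolution_normed_eq]
      refine (eLpNorm_integral_translate_le measurable_id hp.out
        (Lp.stronglyMeasurable (F n)).measurable).trans ?_
      rw [bumpMeasure_univ, one_mul]
      exact hle _ (hF n)
  let b : ℕ → ContDiffBump (0 : Sp d) := fun n =>
    { rIn := 1 / ((n : ℝ) + 1) / 2
      rOut := 1 / ((n : ℝ) + 1)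
      rIn_pos := by positivity
      rIn_lt_rOut := half_lt_self (by positivity) }
  have hlim := ContDiffBump.ae_convolution_tendsto_right_of_locallyIntegrable (μ := volume)
    (φ := b) (l := Filter.atTop) (K := 2) (g := f) tendsto_one_div_add_atTop_nhds_zero_nat
    (.of_forall fun n => by simp only [b]; linarith)
    ((Lp.memLp f).locallyIntegrable hp.out)
  have key : eLpNorm f p volume ≤ ENNReal.ofReal M :=
    (Lp.eLpNorm_lim_le_liminf_eLpNorm (fun n => (hconv (b n) f).1) _ hlim).trans
    ((Filter.liminf_le_liminf (v := fun _ => ENNReal.ofReal M)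
      (.of_forall fun n => hb (b n))).trans (by simp))
  rw [Lp.norm_def]
  exact ENNReal.toReal_le_of_le_ofReal hM key

end LowerSemicontinuity

/-! ### Local and global variation -/

lemma IsControl.exists_small {a b : ℝ} {ω : ℝ → ℝ → ℝ} (h : IsControl a b ω) {ε : ℝ} (hε : 0 < ε) :
    ∃ δ > 0, ∀ s t, a ≤ s → s ≤ t → t ≤ b → t - s ≤ δ → ω s t ≤ ε := by
  have hK : IsCompact {q : ℝ × ℝ | a ≤ q.1 ∧ q.1 ≤ q.2 ∧ q.2 ≤ b} := by
    refine (isCompact_Icc (a := a) (b := b)).prod (isCompact_Icc (a := a) (b := b))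
      |>.of_isClosed_subset ?_ ?_
    · exact (isClosed_le continuous_const continuous_fst).inter
        ((isClosed_le continuous_fst continuous_snd).inter
          (isClosed_le continuous_snd continuous_const))
    · rintro ⟨x, y⟩ ⟨h1, h2, h3⟩
      exact ⟨⟨h1, h2.trans h3⟩, ⟨h1.trans h2, h3⟩⟩
  have hu := hK.uniformContinuousOn_of_continuous h.continuousOn
  rw [Metric.uniformContinuousOn_iff] at hu
  obtain ⟨δ, hδ, hu⟩ := hu ε hε
  refine ⟨δ / 2, by positivity, fun s t h1 h2 h3 h4 => ?_⟩
  have := hu (s, t) ⟨h1, h2, h3⟩ (s, s) ⟨h1, le_rfl, h2.trans h3⟩ (by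
    rw [Prod.dist_eq, dist_self, max_eq_right dist_nonneg, Real.dist_eq,
      abs_of_nonneg (sub_nonneg.2 h2)]
    linarith)
  rw [Real.dist_eq] at this
  simp only [h.diag h1 (h2.trans h3), sub_zero] at this
  exact (le_abs_self _).trans this.le

lemma varNorm_le {X : Type*} {N : X → ℝ≥0∞} {γ a b : ℝ} {g : ℝ → ℝ → X} {ω : ℝ → ℝ → ℝ}
    (hω : IsControl a b ω)
    (h : ∀ s t, a ≤ s → s ≤ t → t ≤ b → N (g s t) ≤ ENNReal.ofReal (ω s t ^ γ)) :
    varNorm N γ a b g ≤ ENNReal.ofReal (ω a b ^ γ) :=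
  iInf₂_le (f := fun (ω : ℝ → ℝ → ℝ) (_ : IsControl a b ω ∧ ∀ s t, a ≤ s → s ≤ t → t ≤ b →
    N (g s t) ≤ ENNReal.ofReal (ω s t ^ γ)) => ENNReal.ofReal (ω a b ^ γ)) ω ⟨hω, h⟩

/-- Locally finite `1/z`-variation with `z > 1` gives a superadditive bound which is negligible on
small intervals. -/
lemma LocFiniteVar.exists_superadditive {X : Type*} {N : X → ℝ≥0∞} {z T : ℝ} {g : ℝ → ℝ → X}
    (hz : 1 < z) (hg : LocFiniteVar N z T g) :
    ∃ Ω : ℝ → ℝ → ℝ, (∀ s t, 0 ≤ s → s ≤ t → t ≤ T → 0 ≤ Ω s t) ∧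
      (∀ s θ t, 0 ≤ s → s ≤ θ → θ ≤ t → t ≤ T → Ω s θ + Ω θ t ≤ Ω s t) ∧
      ∀ ε > 0, ∃ δ > 0, ∀ s t, 0 ≤ s → s ≤ t → t ≤ T → t - s ≤ δ →
        N (g s t) ≤ ENNReal.ofReal (ε * Ω s t) := by
  classical
  choose! ρ hρ hfin using hg
  have hex : ∀ r ∈ Icc (0 : ℝ) T, ∃ ω : ℝ → ℝ → ℝ,
      IsControl (max 0 (r - ρ r)) (min T (r + ρ r)) ω ∧
      ∀ s t, max 0 (r - ρ r) ≤ s → s ≤ t → t ≤ min T (r + ρ r) →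
        N (g s t) ≤ ENNReal.ofReal (ω s t ^ z) := by
    intro r hr
    have := hfin r hr
    simp only [varNorm, iInf_lt_iff] at this
    obtain ⟨ω, hω, -⟩ := this
    exact ⟨ω, hω⟩
  choose! w hw hwN using hex
  obtain ⟨F, hF⟩ := (isCompact_Icc (a := (0 : ℝ)) (b := T)).elim_finite_subcover
    (fun r : Icc (0 : ℝ) T => Metric.ball (r : ℝ) (ρ r)) (fun _ => Metric.isOpen_ball)
    (fun r hr => mem_iUnion.2 ⟨⟨r, hr⟩, Metric.mem_ball_self (hρ r hr)⟩)
  -- the clamped controls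
  let A : Icc (0 : ℝ) T → ℝ := fun r => max 0 (r - ρ r)
  let B : Icc (0 : ℝ) T → ℝ := fun r => min T (r + ρ r)
  have hAB : ∀ r, A r ≤ B r := fun r => by
    have h1 := hρ r r.2
    have h2 := r.2.1
    have h3 := r.2.2
    exact max_le (le_min (h2.trans h3) (by linarith)) (le_min (by linarith) (by linarith))
  let cl : Icc (0 : ℝ) T → ℝ → ℝ := fun r x => max (A r) (min (B r) x)
  have cl1 : ∀ r x, A r ≤ cl r x := fun r x => le_max_left _ _
  have cl2 : ∀ r x, cl r x ≤ B r := fun r x => max_le (hAB r) (min_le_left _ _)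
  have cl3 : ∀ r x y, x ≤ y → cl r x ≤ cl r y := fun r x y h =>
    max_le_max le_rfl (min_le_min le_rfl h)
  have cl4 : ∀ r x, A r ≤ x → x ≤ B r → cl r x = x := fun r x h1 h2 => by
    simp only [cl, min_eq_right h2, max_eq_right h1]
  have hnn : ∀ r : Icc (0 : ℝ) T, ∀ s t, s ≤ t → 0 ≤ w r (cl r s) (cl r t) := fun r s t h =>
    (hw r r.2).nonneg _ _ (cl1 r s) (cl3 r s t h) (cl2 r t)
  refine ⟨fun s t => ∑ r ∈ F, w r.1 (cl r s) (cl r t), fun s t _ h _ =>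
    Finset.sum_nonneg fun r _ => hnn r s t h, fun s θ t _ h1 h2 _ => ?_, fun ε hε => ?_⟩
  · rw [← Finset.sum_add_distrib]
    exact Finset.sum_le_sum fun r _ => (hw r r.2).superadditive _ _ _ (cl1 r s) (cl3 r s θ h1)
      (cl3 r θ t h2) (cl2 r t)
  -- A short interval lies inside one set of the finite cover, where clamping does nothing and a
  -- single term of the sum already controls `g`.
  · obtain ⟨δ₀, hδ₀, hleb⟩ := lebesgue_number_lemma_of_metric
      (isCompact_Icc (a := (0 : ℝ)) (b := T))
      (c := fun r : F => Metric.ball ((r : Icc (0 : ℝ) T) : ℝ) (ρ (r : Icc (0 : ℝ) T)))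
      (fun _ => Metric.isOpen_ball) (by
        refine hF.trans fun x hx => ?_
        obtain ⟨r, hr, hx⟩ := mem_iUnion₂.1 hx
        exact mem_iUnion.2 ⟨⟨r, hr⟩, hx⟩)
    have hz1 : 0 < z - 1 := by linarith
    -- The threshold that makes `w^z = w^{z-1} w ≤ ε w`.
    have hsm : ∀ r : Icc (0 : ℝ) T, ∃ δ > 0, ∀ s t, A r ≤ s → s ≤ t → t ≤ B r → t - s ≤ δ →
        w r s t ≤ ε ^ (1 / (z - 1)) := fun r =>
      (hw r r.2).exists_small (by positivity)
    choose δ hδ hsm using hsm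
    obtain ⟨δ₁, hδ₁, hδF⟩ : ∃ δ₁ > 0, ∀ r ∈ F, δ₁ ≤ δ r := by
      rcases F.eq_empty_or_nonempty with h | h
      · exact ⟨1, one_pos, by simp [h]⟩
      · obtain ⟨r₀, _, hr₀⟩ := F.exists_min_image δ h
        exact ⟨δ r₀, hδ r₀, hr₀⟩
    refine ⟨min δ₁ (δ₀ / 2), by positivity, fun s t h1 h2 h3 h4 => ?_⟩
    obtain ⟨⟨r, hr⟩, hball⟩ := hleb s ⟨h1, h2.trans h3⟩
    have hs := hball (Metric.mem_ball_self hδ₀)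
    have ht : t ∈ Metric.ball s δ₀ := by
      rw [Metric.mem_ball, Real.dist_eq, abs_of_nonneg (sub_nonneg.2 h2)]
      have := h4.trans (min_le_right _ _)
      linarith
    have ht := hball ht
    simp only [Metric.mem_ball, Real.dist_eq, abs_lt] at hs ht
    have e1 : A r ≤ s := max_le h1 (by linarith)
    have e2 : t ≤ B r := le_min h3 (by linarith)
    have n0 := (hw r r.2).nonneg s t e1 h2 e2
    have e3 := hsm r s t e1 h2 e2 (h4.trans ((min_le_left _ _).trans (hδF r hr)))
    refine (hwN r r.2 s t e1 h2 e2).trans (ENNReal.ofReal_le_ofReal ?_)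
    calc w r s t ^ z ≤ ε * w r s t := by
          rcases n0.eq_or_lt with h0 | h0
          · rw [← h0, Real.zero_rpow (by linarith), mul_zero]
          · have : z = (z - 1) + 1 := by ring
            rw [this, Real.rpow_add h0, Real.rpow_one]
            refine mul_le_mul_of_nonneg_right ?_ n0
            calc _ ≤ (ε ^ (1 / (z - 1))) ^ (z - 1) := Real.rpow_le_rpow n0 e3 hz1.le
              _ = ε := by
                rw [← Real.rpow_mul hε.le, one_div, inv_mul_cancel₀ hz1.ne', Real.rpow_one]
      _ ≤ _ := by
          refine mul_le_mul_of_nonneg_left ?_ hε.le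
          have := Finset.single_le_sum (f := fun r => w r.1 (cl r s) (cl r t))
            (fun r _ => hnn r s t h2) hr
          simpa only [cl4 r s e1 (h2.trans e2), cl4 r t (e1.trans h2) e2] using this

/-! ### Estimates for rough drivers -/

section Driver

variable {d : ℕ} {p : ℝ≥0∞} [hp : Fact (1 ≤ p)] {α T : ℝ} {B₁ B₂ : ℝ → ℝ → Dist d →ₗ[ℝ] Dist d}
  {ω : ℝ → ℝ → ℝ} {v : ℝ → LpSp d p} {f : ℝ → NegSobolev d 2 p}

lemma negNorm_lpDist_lt_top (k : ℕ) (g : LpSp d p) : negNorm p k (lpDist g) < ∞ :=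
  (negNorm_lpDist_le k g).trans_lt enorm_lt_top

lemma negNorm_lpDist_le_ofReal (k : ℕ) {g : LpSp d p} {M : ℝ} (h : ‖g‖ ≤ M) :
    negNorm p k (lpDist g) ≤ ENNReal.ofReal M := by
  refine (negNorm_lpDist_le k g).trans ?_
  rw [← ofReal_norm]
  exact ENNReal.ofReal_le_ofReal h

lemma sobNorm_zero_lpDist_le_ofReal {g : LpSp d p} {M : ℝ} (h : ‖g‖ ≤ M) :
    sobNorm p 0 (lpDist g) ≤ ENNReal.ofReal M := by
  refine (sobNorm_zero_lpDist_le g).trans ?_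
  rw [← ofReal_norm]
  exact ENNReal.ofReal_le_ofReal h

lemma IsRoughDriver.negNorm_one_le (hB : IsRoughDriver p α T B₁ B₂ ω) {s t M : ℝ} (hs : 0 ≤ s)
    (hst : s ≤ t) (ht : t ≤ T) {g : LpSp d p} (hg : ‖g‖ ≤ M) :
    negNorm p 1 (B₁ s t (lpDist g)) ≤ ENNReal.ofReal (ω s t ^ α * M) := by
  have h0 := sobNorm_zero_lpDist_le_ofReal hg
  have h := hB.bound₁ s t hs hst ht 0 (by norm_num) (by norm_num) (lpDist g)
    (h0.trans_lt ENNReal.ofReal_lt_top)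
  rw [ENNReal.ofReal_mul (Real.rpow_nonneg (hB.control.nonneg s t hs hst ht) _)]
  exact h.trans (by gcongr)

lemma IsRoughDriver.negNorm_two_le (hB : IsRoughDriver p α T B₁ B₂ ω) {s t M : ℝ} (hs : 0 ≤ s)
    (hst : s ≤ t) (ht : t ≤ T) {g : LpSp d p} (hg : ‖g‖ ≤ M) :
    negNorm p 2 (B₂ s t (lpDist g)) ≤ ENNReal.ofReal (ω s t ^ (2 * α) * M) := by
  have h0 := sobNorm_zero_lpDist_le_ofReal hg
  have h := hB.bound₂ s t hs hst ht 0 (by norm_num) (by norm_num) (lpDist g)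
    (h0.trans_lt ENNReal.ofReal_lt_top)
  rw [ENNReal.ofReal_mul (Real.rpow_nonneg (hB.control.nonneg s t hs hst ht) _)]
  exact h.trans (by gcongr)

lemma negNorm_integral_le {s t : ℝ} (hst : s ≤ t) :
    negNorm p 2 (negDist (∫ r in s..t, f r)) ≤ ENNReal.ofReal (∫ r in s..t, ‖f r‖) := by
  refine (negNorm_negDist_le _).trans ?_
  rw [← ofReal_norm]
  exact ENNReal.ofReal_le_ofReal (intervalIntegral.norm_integral_le_integral_norm hst)

/-- The defect of additivity of the remainder. -/
lemma IsRoughDriver.remainder_eq (hB : IsRoughDriver p α T B₁ B₂ ω)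
    (hf : IntervalIntegrable f volume 0 T) {s θ t : ℝ} (hs : 0 ≤ s) (hsθ : s ≤ θ) (hθt : θ ≤ t)
    (ht : t ≤ T) :
    remainder B₁ B₂ v f s t = remainder B₁ B₂ v f s θ + remainder B₁ B₂ v f θ t
      + B₁ θ t (incr v s θ - B₁ s θ (lpDist (v s))) + B₂ θ t (incr v s θ) := by
  have hT : (0 : ℝ) ≤ T := ((hs.trans hsθ).trans hθt).trans ht
  have hi : ∀ x y, 0 ≤ x → x ≤ y → y ≤ T → IntervalIntegrable f volume x y := fun x y h1 h2 h3 =>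
    hf.mono_set (by rw [uIcc_of_le h2, uIcc_of_le hT]; exact Icc_subset_Icc h1 h3)
  have hI := intervalIntegral.integral_add_adjacent_intervals (hi s θ hs hsθ (hθt.trans ht))
    (hi θ t (hs.trans hsθ) hθt ht)
  have c1 := hB.chen₁ s θ t hs hsθ hθt ht (lpDist (v s)) (negNorm_lpDist_lt_top 2 (v s))
  have c2 := hB.chen₂ s θ t hs hsθ hθt ht (lpDist (v s)) (negNorm_lpDist_lt_top 1 (v s))
  have c1' : B₁ s t (lpDist (v s)) = B₁ s θ (lpDist (v s)) + B₁ θ t (lpDist (v s)) := by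
    rw [sub_sub, sub_eq_zero] at c1; exact c1
  have c2' : B₂ s t (lpDist (v s)) = B₁ θ t (B₁ s θ (lpDist (v s))) + B₂ s θ (lpDist (v s))
      + B₂ θ t (lpDist (v s)) := by
    rw [← c2]; abel
  simp only [remainder, incr, ← hI, c1', c2', map_add, map_sub]
  abel

lemma incr_eq (s t : ℝ) :
    incr v s t = negDist (∫ r in s..t, f r) + B₁ s t (lpDist (v s)) + B₂ s t (lpDist (v s))
      + remainder B₁ B₂ v f s t := by
  simp only [remainder]; abel

lemma negNorm_incr_le (k : ℕ) {s t M : ℝ} (hs : ‖v s‖ ≤ M) (ht : ‖v t‖ ≤ M) :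
    negNorm p k (incr v s t) ≤ ENNReal.ofReal (2 * M) := by
  have hM : 0 ≤ M := (norm_nonneg _).trans hs
  refine (negNorm_sub_le _ _ _).trans ((add_le_add (negNorm_lpDist_le_ofReal k ht)
    (negNorm_lpDist_le_ofReal k hs)).trans (le_of_eq ?_))
  rw [← ENNReal.ofReal_add hM hM, two_mul]

/-- Allows the sewing argument to run with real-valued norms. -/
lemma IsRoughDriver.remainder_lt_top (hB : IsRoughDriver p α T B₁ B₂ ω) {s t : ℝ} (hs : 0 ≤ s)
    (hst : s ≤ t) (ht : t ≤ T) : negNorm p 3 (remainder B₁ B₂ v f s t) < ∞ := by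
  have h1 : negNorm p 3 (B₁ s t (lpDist (v s))) < ∞ := (negNorm_mono (by norm_num) _).trans_lt
    ((hB.negNorm_one_le hs hst ht le_rfl).trans_lt ENNReal.ofReal_lt_top)
  have h2 : negNorm p 3 (B₂ s t (lpDist (v s))) < ∞ := (negNorm_mono (by norm_num) _).trans_lt
    ((hB.negNorm_two_le hs hst ht le_rfl).trans_lt ENNReal.ofReal_lt_top)
  have h3 : negNorm p 3 (negDist (∫ r in s..t, f r)) < ∞ := (negNorm_mono (by norm_num) _).trans_lt
    ((negNorm_integral_le hst).trans_lt ENNReal.ofReal_lt_top)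
  have h4 : negNorm p 3 (incr v s t) < ∞ := (negNorm_incr_le 3 (le_max_left ‖v s‖ ‖v t‖)
    (le_max_right _ _)).trans_lt ENNReal.ofReal_lt_top
  exact (negNorm_sub_le _ _ _).trans_lt (ENNReal.add_lt_top.2
    ⟨(negNorm_sub_le _ _ _).trans_lt (ENNReal.add_lt_top.2 ⟨h4, h3⟩),
      (negNorm_add_le _ _ _).trans_lt (ENNReal.add_lt_top.2 ⟨h1, h2⟩)⟩)

lemma ofReal_mul_le_ofReal {a b : ℝ} (ha : 0 ≤ a) {x : ℝ≥0∞} (h : x ≤ ENNReal.ofReal b) :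
    ENNReal.ofReal a * x ≤ ENNReal.ofReal (a * b) := by
  rw [ENNReal.ofReal_mul ha]
  gcongr

lemma negNorm_add_le_ofReal {k : ℕ} {u u' : Dist d} {a b : ℝ} (ha : 0 ≤ a) (hb : 0 ≤ b)
    (h : negNorm p k u ≤ ENNReal.ofReal a) (h' : negNorm p k u' ≤ ENNReal.ofReal b) :
    negNorm p k (u + u') ≤ ENNReal.ofReal (a + b) := by
  rw [ENNReal.ofReal_add ha hb]
  exact (negNorm_add_le _ _ _).trans (add_le_add h h')

lemma negNorm_sub_le_ofReal {k : ℕ} {u u' : Dist d} {a b : ℝ} (ha : 0 ≤ a) (hb : 0 ≤ b)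
    (h : negNorm p k u ≤ ENNReal.ofReal a) (h' : negNorm p k u' ≤ ENNReal.ofReal b) :
    negNorm p k (u - u') ≤ ENNReal.ofReal (a + b) := by
  rw [ENNReal.ofReal_add ha hb]
  exact (negNorm_sub_le _ _ _).trans (add_le_add h h')

/-- The constant in the estimates for the smoothing operators. -/
noncomputable def smoothingConst (d : ℕ) : ℝ := 4 * (d + 2) ^ 2

lemma smoothingConst_pos (d : ℕ) : 0 < smoothingConst d := by
  unfold smoothingConst; positivity

/-- Split `δv = (1 - J)δv + Jδv` and insert the equation into the second part only. Each term is
measured where it is known: `δv` in `L^p`, `B¹v` in `W^{-1,p}`, the drift and `B²v` in `W^{-2,p}`,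
the remainder in `W^{-3,p}`. Every order gained by `J` costs `1/η`, and every order given up by `1 -
J` yields `η`. -/
lemma IsRoughDriver.interpolation (hB : IsRoughDriver p α T B₁ B₂ ω) {s t M η ν : ℝ} (hs : 0 ≤ s)
    (hst : s ≤ t) (ht : t ≤ T) (hvs : ‖v s‖ ≤ M) (hvt : ‖v t‖ ≤ M) (hη : 0 < η) (hη1 : η ≤ 1)
    (hν0 : 0 ≤ ν) (hν : negNorm p 3 (remainder B₁ B₂ v f s t) ≤ ENNReal.ofReal ν) :
    negNorm p 2 (incr v s t - B₁ s t (lpDist (v s))) ≤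
        ENNReal.ofReal (smoothingConst d * (2 * η ^ 2 * M + η * ω s t ^ α * M
          + (∫ r in s..t, ‖f r‖) + ω s t ^ (2 * α) * M + ν / η)) ∧
      negNorm p 1 (incr v s t) ≤
        ENNReal.ofReal (smoothingConst d * (2 * η * M + ω s t ^ α * M
          + ((∫ r in s..t, ‖f r‖) + ω s t ^ (2 * α) * M) / η + ν / η ^ 2)) := by
  obtain ⟨J, hJ⟩ := exists_smoothing_two (d := d) (p := p) hη hη1
  rw [← smoothingConst] at hJ
  set c := smoothingConst d with hc
  have hc0 : 0 < c := smoothingConst_pos d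
  have hM : 0 ≤ M := (norm_nonneg _).trans hvs
  have hw := hB.control.nonneg s t hs hst ht
  have hw1 : 0 ≤ ω s t ^ α := Real.rpow_nonneg hw _
  have hw2 : 0 ≤ ω s t ^ (2 * α) := Real.rpow_nonneg hw _
  have hF : 0 ≤ ∫ r in s..t, ‖f r‖ :=
    intervalIntegral.integral_nonneg hst fun _ _ => norm_nonneg _
  have b1 := hB.negNorm_one_le hs hst ht hvs
  have b2 := hB.negNorm_two_le hs hst ht hvs
  have b3 := negNorm_integral_le (f := f) hst
  set I := negDist (∫ r in s..t, f r)
  set F := ∫ r in s..t, ‖f r‖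
  set b := B₁ s t (lpDist (v s))
  set b' := B₂ s t (lpDist (v s))
  set x := incr v s t with hx
  set ρ := remainder B₁ B₂ v f s t
  have ex : x = I + b + b' + ρ := incr_eq (B₁ := B₁) (B₂ := B₂) (f := f) s t
  have x0 : ∀ k, negNorm p k x ≤ ENNReal.ofReal (2 * M) := fun k => negNorm_incr_le k hvs hvt
  constructor
  · have e : x - b = ((x - J x) - (b - J b)) + ((J I + J b') + J ρ) := by
      have : J x = J I + J b + J b' + J ρ := by rw [ex]; simp only [map_add]
      rw [this]; abel
    have k1 : negNorm p 2 (x - J x) ≤ ENNReal.ofReal (c * η ^ 2 * (2 * M)) :=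
      ((hJ x).2.2.2.2 0 (by norm_num)).trans (ofReal_mul_le_ofReal (by positivity) (x0 0))
    have k2 : negNorm p 2 (b - J b) ≤ ENNReal.ofReal (c * η * (ω s t ^ α * M)) :=
      ((hJ b).2.2.2.1 1 (by norm_num)).trans (ofReal_mul_le_ofReal (by positivity) b1)
    have k3 : negNorm p 2 (J I) ≤ ENNReal.ofReal (c * F) :=
      ((hJ I).1 2 (by norm_num)).trans (ofReal_mul_le_ofReal (by positivity) b3)
    have k4 : negNorm p 2 (J b') ≤ ENNReal.ofReal (c * (ω s t ^ (2 * α) * M)) :=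
      ((hJ b').1 2 (by norm_num)).trans (ofReal_mul_le_ofReal (by positivity) b2)
    have k5 : negNorm p 2 (J ρ) ≤ ENNReal.ofReal (c / η * ν) :=
      ((hJ ρ).2.1 2 (by norm_num)).trans (ofReal_mul_le_ofReal (by positivity) hν)
    rw [e]
    refine (negNorm_add_le_ofReal (by positivity) (by positivity)
      (negNorm_sub_le_ofReal (by positivity) (by positivity) k1 k2)
      (negNorm_add_le_ofReal (by positivity) (by positivity)
        (negNorm_add_le_ofReal (by positivity) (by positivity) k3 k4) k5)).trans (le_of_eq ?_)
    congr 1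
    field_simp
    ring
  · have e : x = (x - J x) + ((J b + (J I + J b')) + J ρ) := by
      have : J x = J I + J b + J b' + J ρ := by rw [ex]; simp only [map_add]
      rw [this]; abel
    have k1 : negNorm p 1 (x - J x) ≤ ENNReal.ofReal (c * η * (2 * M)) :=
      ((hJ x).2.2.2.1 0 (by norm_num)).trans (ofReal_mul_le_ofReal (by positivity) (x0 0))
    have k2 : negNorm p 1 (J b) ≤ ENNReal.ofReal (c * (ω s t ^ α * M)) :=
      ((hJ b).1 1 (by norm_num)).trans (ofReal_mul_le_ofReal (by positivity) b1)
    have k3 : negNorm p 1 (J I) ≤ ENNReal.ofReal (c / η * F) :=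
      ((hJ I).2.1 1 (by norm_num)).trans (ofReal_mul_le_ofReal (by positivity) b3)
    have k4 : negNorm p 1 (J b') ≤ ENNReal.ofReal (c / η * (ω s t ^ (2 * α) * M)) :=
      ((hJ b').2.1 1 (by norm_num)).trans (ofReal_mul_le_ofReal (by positivity) b2)
    have k5 : negNorm p 1 (J ρ) ≤ ENNReal.ofReal (c / η ^ 2 * ν) :=
      ((hJ ρ).2.2.1 1 (by norm_num)).trans (ofReal_mul_le_ofReal (by positivity) hν)
    rw [e]
    refine (negNorm_add_le_ofReal (by positivity) (by positivity) k1
      (negNorm_add_le_ofReal (by positivity) (by positivity)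
        (negNorm_add_le_ofReal (by positivity) (by positivity) k2
        (negNorm_add_le_ofReal (by positivity) (by positivity) k3 k4)) k5)).trans (le_of_eq ?_)
    congr 1
    field_simp
    ring

/-- The almost additivity of the norm of the remainder. -/
lemma IsRoughDriver.remainder_almost_additive (hB : IsRoughDriver p α T B₁ B₂ ω)
    (hα : 0 < α) (hf : IntervalIntegrable f volume 0 T) {s θ t M l : ℝ} (hs : 0 ≤ s)
    (hsθ : s ≤ θ) (hθt : θ ≤ t) (ht : t ≤ T) (hvs : ‖v s‖ ≤ M) (hvθ : ‖v θ‖ ≤ M) (hl : 1 ≤ l)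
    (hlω : l * ω s t ^ α ≤ 1) :
    (negNorm p 3 (remainder B₁ B₂ v f s t)).toReal ≤
      (negNorm p 3 (remainder B₁ B₂ v f s θ)).toReal
        + (negNorm p 3 (remainder B₁ B₂ v f θ t)).toReal
        + 8 * smoothingConst d * (l ^ 2 * ω s t ^ (3 * α) * M + ω s t ^ α * ∫ r in s..t, ‖f r‖)
        + 8 * smoothingConst d / l * (negNorm p 3 (remainder B₁ B₂ v f s θ)).toReal := by
  have hM : 0 ≤ M := (norm_nonneg _).trans hvs
  have hT : (0 : ℝ) ≤ T := ((hs.trans hsθ).trans hθt).trans ht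
  have hst := hsθ.trans hθt
  set c := smoothingConst d with hc
  have hc0 : 0 < c := smoothingConst_pos d
  have hω0 := hB.control.nonneg s t hs hst ht
  have cF := IsControl.integral (g := fun r => ‖f r‖) hT hf.norm (fun _ => norm_nonneg _)
  have fin : ∀ x y, 0 ≤ x → x ≤ y → y ≤ T → negNorm p 3 (remainder B₁ B₂ v f x y) =
      ENNReal.ofReal (negNorm p 3 (remainder B₁ B₂ v f x y)).toReal := fun x y h1 h2 h3 =>
    (ENNReal.ofReal_toReal (hB.remainder_lt_top h1 h2 h3).ne).symm
  set ν₁ := (negNorm p 3 (remainder B₁ B₂ v f s θ)).toReal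
  set ν₂ := (negNorm p 3 (remainder B₁ B₂ v f θ t)).toReal
  have hν₁ : 0 ≤ ν₁ := ENNReal.toReal_nonneg
  have hν₂ : 0 ≤ ν₂ := ENNReal.toReal_nonneg
  set F := ∫ r in s..t, ‖f r‖
  have hF0 : 0 ≤ F := cF.nonneg s t hs hst ht
  set W := ω s t ^ α with hW
  have hW0 : 0 ≤ W := Real.rpow_nonneg hω0 _
  have hW3 : ω s t ^ (3 * α) = W ^ 3 := by
    rw [hW, ← Real.rpow_natCast, ← Real.rpow_mul hω0]; congr 1; push_cast; ring
  have mono1 : ∀ x y, s ≤ x → x ≤ y → y ≤ t → ω x y ^ α ≤ W ∧ ω x y ^ (2 * α) ≤ W ^ 2 := by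
    intro x y h1 h2 h3
    have n := hB.control.nonneg x y (hs.trans h1) h2 (h3.trans ht)
    have m := hB.control.mono hs h1 h2 h3 ht
    have m1 : ω x y ^ α ≤ W := Real.rpow_le_rpow n m hα.le
    refine ⟨m1, ?_⟩
    have : ω x y ^ (2 * α) = (ω x y ^ α) ^ 2 := by
      rw [← Real.rpow_natCast, ← Real.rpow_mul n]; congr 1; push_cast; ring
    rw [this]
    exact pow_le_pow_left₀ (Real.rpow_nonneg n _) m1 2
  have key : ∃ X Y : ℝ, 0 ≤ X ∧ 0 ≤ Y ∧
      negNorm p 2 (incr v s θ - B₁ s θ (lpDist (v s))) ≤ ENNReal.ofReal X ∧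
      negNorm p 1 (incr v s θ) ≤ ENNReal.ofReal Y ∧
      W * X + W ^ 2 * Y ≤ 8 * c * (l ^ 2 * W ^ 3 * M + W * F) + 8 * c / l * ν₁ := by
    -- The scale is `η = l W`, so that both occurrences of the remainder, `W ν₁/η` and `W² ν₁/η²`,
    -- carry at least a factor `1/l`. For `W = 0` this scale is not positive, but then the left side
    -- vanishes and any finite `X` and `Y` will do.
    rcases hW0.eq_or_lt with h0 | h0
    · have h1 := hB.interpolation (f := f) (M := M) (η := 1) (ν := ν₁) hs hsθ (hθt.trans ht) hvs hvθ
        one_pos le_rfl hν₁ (fin s θ hs hsθ (hθt.trans ht)).le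
      refine ⟨_, _, le_max_left 0 _, le_max_left 0 _,
        h1.1.trans (ENNReal.ofReal_le_ofReal (le_max_right 0 _)),
        h1.2.trans (ENNReal.ofReal_le_ofReal (le_max_right 0 _)), ?_⟩
      rw [← h0]
      have : 0 ≤ 8 * c / l * ν₁ := by positivity
      simpa using this
    · have hη0 : 0 < l * W := by positivity
      have h1 := hB.interpolation (f := f) (M := M) (η := l * W) (ν := ν₁) hs hsθ (hθt.trans ht) hvs
        hvθ hη0 hlω hν₁ (fin s θ hs hsθ (hθt.trans ht)).le
      obtain ⟨m1, m2⟩ := mono1 s θ le_rfl hsθ hθt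
      have mF : ∫ r in s..θ, ‖f r‖ ≤ F := cF.mono hs le_rfl hsθ hθt ht
      refine ⟨c * (2 * (l * W) ^ 2 * M + l * W * W * M + F + W ^ 2 * M + ν₁ / (l * W)),
        c * (2 * (l * W) * M + W * M + (F + W ^ 2 * M) / (l * W) + ν₁ / (l * W) ^ 2),
        by positivity, by positivity, h1.1.trans (ENNReal.ofReal_le_ofReal ?_),
        h1.2.trans (ENNReal.ofReal_le_ofReal ?_), ?_⟩
      · gcongr
      · gcongr
      · have hl0 : 0 < l := by linarith
        have e : W * (c * (2 * (l * W) ^ 2 * M + l * W * W * M + F + W ^ 2 * M + ν₁ / (l * W)))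
            + W ^ 2 * (c * (2 * (l * W) * M + W * M + (F + W ^ 2 * M) / (l * W)
              + ν₁ / (l * W) ^ 2)) = c * ((2 * l ^ 2 + l + 1 + 2 * l + 1 + 1 / l) * (W ^ 3 * M)
              + (1 + 1 / l) * (W * F) + (1 / l + 1 / l * (1 / l)) * ν₁) := by
          field_simp
          ring
        have i1 : 1 / l ≤ 1 := by rw [div_le_one hl0]; exact hl
        have i0 : 0 < 1 / l := by positivity
        have i2 : 1 / l * (1 / l) ≤ 1 / l := mul_le_of_le_one_right i0.le i1
        -- The source of the factor `8`: each power of `l` on the left is at most `l²`, and the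
        -- coefficients add up to `8`.
        have i3 : 2 * l ^ 2 + l + 1 + 2 * l + 1 + 1 / l ≤ 8 * l ^ 2 := by nlinarith
        have e2 : 8 * c * (l ^ 2 * W ^ 3 * M + W * F) + 8 * c / l * ν₁
            = c * ((8 * l ^ 2) * (W ^ 3 * M) + 8 * (W * F) + (8 * (1 / l)) * ν₁) := by
          field_simp
        rw [e, e2]
        gcongr
        · linarith
        · linarith
  obtain ⟨X, Y, hX, hY, hX', hY', hXY⟩ := key
  obtain ⟨m1, m2⟩ := mono1 θ t hsθ hθt le_rfl
  have g1 : negNorm p 3 (B₁ θ t (incr v s θ - B₁ s θ (lpDist (v s)))) ≤ ENNReal.ofReal (W * X) := by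
    have h := hB.bound₁ θ t (hs.trans hsθ) hθt ht (-2) (by norm_num) (by norm_num)
      (incr v s θ - B₁ s θ (lpDist (v s)))
      (hX'.trans_lt ENNReal.ofReal_lt_top)
    rw [ENNReal.ofReal_mul hW0]
    exact h.trans (mul_le_mul' (ENNReal.ofReal_le_ofReal m1) hX')
  have g2 : negNorm p 3 (B₂ θ t (incr v s θ)) ≤ ENNReal.ofReal (W ^ 2 * Y) := by
    have h := hB.bound₂ θ t (hs.trans hsθ) hθt ht (-1) (by norm_num) (by norm_num)
      (incr v s θ) (by rw [sobNorm_neg_one]; exact hY'.trans_lt ENNReal.ofReal_lt_top)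
    rw [ENNReal.ofReal_mul (by positivity)]
    exact h.trans (mul_le_mul' (ENNReal.ofReal_le_ofReal m2) hY')
  have total : negNorm p 3 (remainder B₁ B₂ v f s t) ≤
      ENNReal.ofReal (ν₁ + ν₂ + W * X + W ^ 2 * Y) := by
    rw [hB.remainder_eq hf hs hsθ hθt ht]
    exact negNorm_add_le_ofReal (by positivity) (by positivity)
      (negNorm_add_le_ofReal (by positivity) (by positivity)
      (negNorm_add_le_ofReal hν₁ hν₂ (fin s θ hs hsθ (hθt.trans ht)).le
        (fin θ t (hs.trans hsθ) hθt ht).le) g1) g2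
  refine (ENNReal.toReal_le_of_le_ofReal (by positivity) total).trans ?_
  rw [hW3]
  linarith

end Driver

section Solution

variable {d : ℕ} {p : ℝ≥0∞} [hp : Fact (1 ≤ p)] {α T : ℝ} {B₁ B₂ : ℝ → ℝ → Dist d →ₗ[ℝ] Dist d}
  {ω : ℝ → ℝ → ℝ} {v : ℝ → LpSp d p} {f : ℝ → NegSobolev d 2 p}

/-! ### Bounds at every time -/

variable (p) in
-- Convergence in `W^{-k,p}` implies convergence of distributions: pairing with `φ` is a bounded
-- functional on representations, and the infimum over these is taken last.
lemma exists_enorm_apply_le (k : ℕ) (φ : 𝓓((⊤ : TopologicalSpace.Opens (Sp d)), ℝ)) :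
    ∃ c : ℝ, 0 < c ∧ ∀ u : Dist d, ‖u φ‖ₑ ≤ ENNReal.ofReal c * negNorm p k u := by
  have hev : ∀ g : LpFam d k p, (divMap d k p g) φ = ∑ m, (partialD m (lpDist (g m))) φ := fun g =>
    map_sum ({ toFun := fun u => u φ, map_zero' := rfl, map_add' := fun _ _ => rfl } :
      Dist d →+ ℝ) (fun m => partialD m (lpDist (g m))) Finset.univ
  let ℓ : LpFam d k p →ₗ[ℝ] ℝ :=
    { toFun := fun g => divMap d k p g φ
      map_add' := fun g h => by rw [map_add]; rfl
      map_smul' := fun c g => by rw [map_smul]; rfl }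
  have hc : Continuous ℓ := by
    change Continuous fun g => divMap d k p g φ
    simp only [hev]
    refine continuous_finsetSum _ fun m _ => ?_
    obtain ⟨ψ, hψ⟩ := exists_testFunction_iteratedLineDerivOp
      (fun i => (EuclideanSpace.single (m.2 i) (1 : ℝ) : Sp d)) φ
    have e : ∀ g : LpFam d k p, (partialD m (lpDist (g m))) φ = lpDist (g m) ψ := fun g => hψ _
    simp only [e]
    exact (continuous_lpDist_apply ψ).comp (by fun_prop)
  let L : LpFam d k p →L[ℝ] ℝ := ⟨ℓ, hc⟩
  have hL : 0 < ‖L‖ + 1 := by positivity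
  refine ⟨‖L‖ + 1, hL, fun u => ?_⟩
  have h0 : ENNReal.ofReal (‖L‖ + 1) ≠ 0 := by simpa using hL
  rw [← ENNReal.div_le_iff' h0 ENNReal.ofReal_ne_top]
  refine le_iInf₂ fun g hg => ?_
  rw [ENNReal.div_le_iff' h0 ENNReal.ofReal_ne_top, ← hg, ← ofReal_norm, ← ofReal_norm,
    ← ENNReal.ofReal_mul hL.le]
  refine ENNReal.ofReal_le_ofReal ((L.le_opNorm g).trans ?_)
  gcongr
  linarith

/-- The increments of a solution are small in `W^{-3,p}` on small intervals. -/
lemma IsRoughDriver.exists_incr_small (hB : IsRoughDriver p α T B₁ B₂ ω) (hα : 0 < α)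
    (hf : IntervalIntegrable f volume 0 T) (hT : 0 ≤ T) (hS : SolvesRough T B₁ B₂ v f) {M ε : ℝ}
    (hM : 0 ≤ M) (hε : 0 < ε) :
    ∃ δ > 0, ∀ s t, 0 ≤ s → s ≤ t → t ≤ T → t - s ≤ δ → ‖v s‖ ≤ M →
      negNorm p 3 (incr v s t) ≤ ENNReal.ofReal ε := by
  obtain ⟨z, hz, hloc⟩ := hS
  obtain ⟨Ω, hΩ0, hΩ, hfine⟩ := hloc.exists_superadditive hz
  have cF := IsControl.integral (g := fun r => ‖f r‖) hT hf.norm (fun _ => norm_nonneg _)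
  have hM1 : 0 < M + 1 := by linarith
  set ε' := ε / 4 / (M + 1) with hε'
  have hε'0 : 0 < ε' := by positivity
  have hεM : ε' * M ≤ ε / 4 := by
    rw [hε', div_mul_eq_mul_div, div_le_iff₀ hM1]
    nlinarith
  obtain ⟨δ₁, hδ₁, h1⟩ := cF.exists_small (show 0 < ε / 4 by positivity)
  obtain ⟨δ₂, hδ₂, h2⟩ := hB.control.exists_small (show 0 < ε' ^ (1 / α) by positivity)
  obtain ⟨δ₃, hδ₃, h3⟩ := hB.control.exists_small (show 0 < ε' ^ (1 / (2 * α)) by positivity)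
  have hΩT := hΩ0 0 T le_rfl hT le_rfl
  obtain ⟨δ₄, hδ₄, h4⟩ := hfine (ε / 4 / (Ω 0 T + 1)) (by positivity)
  refine ⟨min (min δ₁ δ₂) (min δ₃ δ₄), by positivity, fun s t hs hst ht hd hv => ?_⟩
  have d1 := hd.trans ((min_le_left _ _).trans (min_le_left _ _))
  have d2 := hd.trans ((min_le_left _ _).trans (min_le_right _ _))
  have d3 := hd.trans ((min_le_right _ _).trans (min_le_left _ _))
  have d4 := hd.trans ((min_le_right _ _).trans (min_le_right _ _))
  have n := hB.control.nonneg s t hs hst ht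
  have pw : ∀ q : ℝ, 0 < q → ω s t ≤ ε' ^ (1 / q) → ω s t ^ q * M ≤ ε / 4 := by
    intro q hq h
    refine le_trans (mul_le_mul_of_nonneg_right ?_ hM) hεM
    calc _ ≤ (ε' ^ (1 / q)) ^ q := Real.rpow_le_rpow n h hq.le
      _ = ε' := by rw [← Real.rpow_mul hε'0.le, one_div, inv_mul_cancel₀ hq.ne', Real.rpow_one]
  have e1 : negNorm p 3 (negDist (∫ r in s..t, f r)) ≤ ENNReal.ofReal (ε / 4) :=
    (negNorm_mono (by norm_num) _).trans ((negNorm_integral_le hst).trans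
      (ENNReal.ofReal_le_ofReal (h1 s t hs hst ht d1)))
  have e2 : negNorm p 3 (B₁ s t (lpDist (v s))) ≤ ENNReal.ofReal (ε / 4) :=
    (negNorm_mono (by norm_num) _).trans ((hB.negNorm_one_le hs hst ht hv).trans
      (ENNReal.ofReal_le_ofReal (pw α hα (h2 s t hs hst ht d2))))
  have e3 : negNorm p 3 (B₂ s t (lpDist (v s))) ≤ ENNReal.ofReal (ε / 4) :=
    (negNorm_mono (by norm_num) _).trans ((hB.negNorm_two_le hs hst ht hv).trans
      (ENNReal.ofReal_le_ofReal (pw (2 * α) (by positivity) (h3 s t hs hst ht d3))))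
  have e4 : negNorm p 3 (remainder B₁ B₂ v f s t) ≤ ENNReal.ofReal (ε / 4) := by
    refine (h4 s t hs hst ht d4).trans (ENNReal.ofReal_le_ofReal ?_)
    have m : Ω s t ≤ Ω 0 T := by
      have a1 := hΩ 0 s t le_rfl hs hst ht
      have a2 := hΩ 0 t T le_rfl (hs.trans hst) ht le_rfl
      have a3 := hΩ0 0 s le_rfl hs (hst.trans ht)
      have a4 := hΩ0 t T (hs.trans hst) ht le_rfl
      linarith
    rw [div_mul_eq_mul_div, div_le_iff₀ (by positivity)]
    nlinarith
  have h4 : 0 ≤ ε / 4 := by positivity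
  rw [incr_eq (B₁ := B₁) (B₂ := B₂) (f := f) s t]
  refine (negNorm_add_le_ofReal (by positivity) h4 (negNorm_add_le_ofReal (by positivity) h4
    (negNorm_add_le_ofReal h4 h4 e1 e2) e3) e4).trans (ENNReal.ofReal_le_ofReal ?_)
  linarith

/-- The essential supremum bound of a solution holds at every time. -/
lemma IsRoughDriver.norm_le_essSup (hB : IsRoughDriver p α T B₁ B₂ ω) (hα : 0 < α)
    (hf : IntervalIntegrable f volume 0 T) (hS : SolvesRough T B₁ B₂ v f)
    (hv : eLpNorm v ∞ (volume.restrict (Icc 0 T)) < ∞) {a b : ℝ} (ha : 0 ≤ a) (hab : a < b)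
    (hb : b ≤ T) {r : ℝ} (har : a ≤ r) (hrb : r ≤ b) :
    ‖v r‖ ≤ (eLpNorm v ∞ (volume.restrict (Icc a b))).toReal := by
  have hT : 0 ≤ T := ha.trans (hab.le.trans hb)
  set M := (eLpNorm v ∞ (volume.restrict (Icc a b))).toReal with hMdef
  have hM : 0 ≤ M := ENNReal.toReal_nonneg
  have hfin : eLpNorm v ∞ (volume.restrict (Icc a b)) < ∞ :=
    (eLpNorm_mono_measure v (Measure.restrict_mono (Icc_subset_Icc ha hb) le_rfl)).trans_lt hv
  have hae : ∀ᵐ x ∂(volume.restrict (Icc a b)), ‖v x‖ ≤ M := by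
    rw [eLpNorm_exponent_top] at hfin hMdef
    filter_upwards [enorm_ae_le_eLpNormEssSup v (volume.restrict (Icc a b))] with x hx
    have := ENNReal.toReal_mono hfin.ne hx
    rwa [toReal_enorm, ← hMdef] at this
  -- Times obeying the essential bound are dense, since open intervals have positive measure.
  have good : ∀ x y, a ≤ x → x < y → y ≤ b → ∃ q, x < q ∧ q < y ∧ ‖v q‖ ≤ M := by
    intro x y h1 h2 h3
    have h4 := ae_restrict_of_ae_restrict_of_subset
      (s := Ioo x y) (t := Icc a b) (fun q hq => ⟨h1.trans hq.1.le, hq.2.le.trans h3⟩) hae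
    have : (ae (volume.restrict (Ioo x y))).NeBot := by
      rw [ae_neBot, Ne, Measure.restrict_eq_zero, Real.volume_Ioo]
      simpa using h2
    obtain ⟨q, hq1, hq2⟩ := (h4.and (ae_restrict_mem measurableSet_Ioo)).exists
    exact ⟨q, hq2.1, hq2.2, hq1⟩
  have approx : ∀ ε > 0, ∃ q, ‖v q‖ ≤ M ∧
      negNorm p 3 (lpDist (v q) - lpDist (v r)) ≤ ENNReal.ofReal ε := by
    intro ε hε
    -- Smallness of an increment needs a bound on `v` at its left end only. For `r < b` that end is
    -- `r` itself, with the bound `‖v r‖`; for `r = b` it is a good time, with the bound `M`.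
    rcases hrb.lt_or_eq with h | h
    · obtain ⟨δ, hδ, hinc⟩ := hB.exists_incr_small hα hf hT hS (norm_nonneg (v r)) hε
      obtain ⟨q, q1, q2, q3⟩ := good r (min b (r + δ)) har (lt_min h (by linarith))
        (min_le_left _ _)
      have q4 := q2.trans_le (min_le_left _ _)
      have q5 := q2.trans_le (min_le_right _ _)
      exact ⟨q, q3, hinc r q (ha.trans har) q1.le (q4.le.trans hb) (by linarith) le_rfl⟩
    · obtain ⟨δ, hδ, hinc⟩ := hB.exists_incr_small hα hf hT hS hM hε
      obtain ⟨q, q1, q2, q3⟩ := good (max a (r - δ)) r (le_max_left _ _)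
        (max_lt (h ▸ hab) (by linarith)) hrb
      have q4 := (le_max_left _ _).trans_lt q1
      have q5 := (le_max_right _ _).trans_lt q1
      refine ⟨q, q3, ?_⟩
      rw [← negNorm_neg, neg_sub]
      exact hinc q r (ha.trans q4.le) q2.le (hrb.trans hb) (by linarith) q3
  choose q hq1 hq2 using fun n : ℕ => approx (1 / ((n : ℝ) + 1)) (by positivity)
  refine norm_le_of_tendsto_lpDist (F := fun n => v (q n)) hq1 fun φ => ?_
  obtain ⟨c, hc, hφ⟩ := exists_enorm_apply_le p 3 φ
  rw [tendsto_iff_norm_sub_tendsto_zero]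
  refine squeeze_zero (fun n => norm_nonneg _) (g := fun n : ℕ => c * (1 / ((n : ℝ) + 1)))
    (fun n => ?_) ?_
  · have h1 := (hφ (lpDist (v (q n)) - lpDist (v r))).trans
      (ofReal_mul_le_ofReal hc.le (hq2 n))
    have h2 := ENNReal.toReal_le_of_le_ofReal (by positivity) h1
    rwa [toReal_enorm] at h2
  · simpa using (tendsto_one_div_add_atTop_nhds_zero_nat (𝕜 := ℝ)).const_mul c

/-! ### The remainder estimates -/

/-- The constant in the remainder estimate. -/
noncomputable def remainderConst (d : ℕ) (α : ℝ) : ℝ := sewingConst α (8 * smoothingConst d)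

lemma remainderConst_pos (d : ℕ) {α : ℝ} (hα : 1 / 3 < α) : 0 < remainderConst d α :=
  sewingConst_pos hα (mul_pos (by norm_num) (smoothingConst_pos d))

/-- The control `ω^{1/3} F^{1/(3α)}`. -/
lemma isControl_mixed {a b : ℝ} {ω F : ℝ → ℝ → ℝ} (hω : IsControl a b ω) (hF : IsControl a b F)
    (hα : 1 / 3 < α) (hα' : α ≤ 1 / 2) :
    IsControl a b (fun s t => ω s t ^ (1 / 3 : ℝ) * F s t ^ (1 / (3 * α))) := by
  refine hω.rpow_mul_rpow hF (by norm_num) (by positivity) (by norm_num) ?_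
  -- Superadditivity needs the exponents `1/3` and `1/(3α)` to sum to at least `1`, which amounts to
  -- `α ≤ 1/2`.
  have : 2 / 3 ≤ 1 / (3 * α) := by
    rw [div_le_div_iff₀ (by norm_num) (by linarith)]; linarith
  linarith

lemma mixed_rpow {x y : ℝ} (hx : 0 ≤ x) (hy : 0 ≤ y) (hα : 0 < α) :
    (x ^ (1 / 3 : ℝ) * y ^ (1 / (3 * α))) ^ (3 * α) = x ^ α * y := by
  rw [Real.mul_rpow (by positivity) (by positivity), ← Real.rpow_mul hx, ← Real.rpow_mul hy,
    one_div_mul_cancel (by positivity), Real.rpow_one]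
  congr 2; ring

lemma IsRoughDriver.remainder_le (hB : IsRoughDriver p α T B₁ B₂ ω) (hα : 1 / 3 < α)
    (hα' : α ≤ 1 / 2) (hf : IntervalIntegrable f volume 0 T) (hS : SolvesRough T B₁ B₂ v f)
    {a b M : ℝ} (ha : 0 ≤ a) (hab : a ≤ b) (hb : b ≤ T) (hv : ∀ r, a ≤ r → r ≤ b → ‖v r‖ ≤ M)
    (hω : ω a b ≤ 1 / 3) :
    negNorm p 3 (remainder B₁ B₂ v f a b) ≤ ENNReal.ofReal (remainderConst d α *
      (ω a b ^ (3 * α) * M + ω a b ^ α * ∫ r in a..b, ‖f r‖)) := by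
  have hM : 0 ≤ M := (norm_nonneg _).trans (hv a le_rfl hab)
  have hT : 0 ≤ T := ha.trans (hab.trans hb)
  have hα0 : 0 < α := by linarith
  obtain ⟨z, hz, hloc⟩ := hS
  obtain ⟨Ω, hΩ0, hΩ, hfine⟩ := hloc.exists_superadditive hz
  have cω := hB.control.restrict ha hb
  have cF := (IsControl.integral (g := fun r => ‖f r‖) hT hf.norm
    (fun _ => norm_nonneg _)).restrict ha hb
  have cG := isControl_mixed cω cF hα hα'
  rw [← ENNReal.ofReal_toReal (hB.remainder_lt_top (f := f) (v := v) ha hab hb).ne]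
  refine ENNReal.ofReal_le_ofReal ?_
  have hG : ∀ s t, a ≤ s → s ≤ t → t ≤ b → (ω s t ^ (1 / 3 : ℝ) *
      (∫ r in s..t, ‖f r‖) ^ (1 / (3 * α))) ^ (3 * α) = ω s t ^ α * ∫ r in s..t, ‖f r‖ :=
    fun s t h1 h2 h3 => mixed_rpow (cω.nonneg s t h1 h2 h3) (cF.nonneg s t h1 h2 h3) hα0
  have key := sewing_absorb (C := 8 * smoothingConst d) (M := M) hα hα'
    (mul_pos (by norm_num) (smoothingConst_pos d)) hM hab cω cG hω
    (ν := fun s t => (negNorm p 3 (remainder B₁ B₂ v f s t)).toReal) (Ω := Ω)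
    (fun s θ t h1 h2 h3 h4 => hΩ s θ t (ha.trans h1) h2 h3 (h4.trans hb)) ?_ ?_
    (fun _ _ _ _ _ => ENNReal.toReal_nonneg)
  · rw [hG a b le_rfl hab le_rfl] at key
    exact key
  · intro ε hε
    obtain ⟨δ, hδ, h⟩ := hfine ε hε
    refine ⟨δ, hδ, fun s t h1 h2 h3 h4 => ENNReal.toReal_le_of_le_ofReal
      (mul_nonneg hε.le (hΩ0 s t (ha.trans h1) h2 (h3.trans hb)))
      (h s t (ha.trans h1) h2 (h3.trans hb) h4)⟩
  · intro s θ t l h1 h2 h3 h4 h5 h6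
    rw [hG s t h1 (h2.trans h3) h4]
    exact hB.remainder_almost_additive hα0 hf (ha.trans h1) h2 h3 (h4.trans hb)
      (hv s h1 ((h2.trans h3).trans h4)) (hv θ (h1.trans h2) (h3.trans h4)) h5 h6

lemma add_rpow_le_mul_add {x y q : ℝ} (hx : 0 ≤ x) (hy : 0 ≤ y) (hq : 0 ≤ q) :
    (x + y) ^ q ≤ 2 ^ q * (x ^ q + y ^ q) := by
  have hxq := Real.rpow_nonneg hx q
  have hyq := Real.rpow_nonneg hy q
  calc (x + y) ^ q ≤ (2 * max x y) ^ q := Real.rpow_le_rpow (by positivity)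
        (by linarith [le_max_left x y, le_max_right x y]) hq
    _ = 2 ^ q * (max x y) ^ q := Real.mul_rpow (by norm_num) (le_max_of_le_left hx)
    _ ≤ _ := by
      refine mul_le_mul_of_nonneg_left ?_ (by positivity)
      rcases max_choice x y with h | h <;> rw [h] <;> linarith

/-- The variation estimate for the remainder. -/
lemma IsRoughDriver.varNorm_remainder_le (hB : IsRoughDriver p α T B₁ B₂ ω) (hα : 1 / 3 < α)
    (hα' : α ≤ 1 / 2) (hf : IntervalIntegrable f volume 0 T) (hS : SolvesRough T B₁ B₂ v f)
    {a b M : ℝ} (ha : 0 ≤ a) (hab : a ≤ b) (hb : b ≤ T) (hv : ∀ r, a ≤ r → r ≤ b → ‖v r‖ ≤ M)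
    (hω : ω a b ≤ 1 / 3) :
    varNorm (sobNorm p (-3)) (3 * α) a b (remainder B₁ B₂ v f) ≤
      ENNReal.ofReal (remainderConst d α * 2 ^ (3 * α) *
        (ω a b ^ (3 * α) * M + ω a b ^ α * ∫ r in a..b, ‖f r‖)) := by
  have hM : 0 ≤ M := (norm_nonneg _).trans (hv a le_rfl hab)
  have hT : 0 ≤ T := ha.trans (hab.trans hb)
  have hα0 : 0 < α := by linarith
  have hK := remainderConst_pos d hα
  have h3α : 0 < 3 * α := by positivity
  have cω := hB.control.restrict ha hb
  have cF := (IsControl.integral (g := fun r => ‖f r‖) hT hf.norm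
    (fun _ => norm_nonneg _)).restrict ha hb
  set K := remainderConst d α with hKdef
  have cG := isControl_mixed cω cF hα hα'
  -- One control for all subintervals. Since `3α ≥ 1`, the sum of the powers is at most the power of
  -- the sum; the converse, needed on `[a,b]` only, costs `2 ^ (3 * α)`.
  have cH := ((cω.const_mul (Real.rpow_nonneg hM (1 / (3 * α)))).add cG).const_mul
    (Real.rpow_nonneg hK.le (1 / (3 * α)))
  have inv_rpow : ∀ x : ℝ, 0 ≤ x → (x ^ (1 / (3 * α))) ^ (3 * α) = x := fun x hx => by
    rw [← Real.rpow_mul hx, one_div_mul_cancel h3α.ne', Real.rpow_one]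
  have parts : ∀ s t, a ≤ s → s ≤ t → t ≤ b → 0 ≤ M ^ (1 / (3 * α)) * ω s t ∧
      0 ≤ ω s t ^ (1 / 3 : ℝ) * (∫ r in s..t, ‖f r‖) ^ (1 / (3 * α)) ∧
      (M ^ (1 / (3 * α)) * ω s t) ^ (3 * α) + (ω s t ^ (1 / 3 : ℝ) *
      (∫ r in s..t, ‖f r‖) ^ (1 / (3 * α))) ^ (3 * α)
        = ω s t ^ (3 * α) * M + ω s t ^ α * ∫ r in s..t, ‖f r‖ := by
    intro s t h1 h2 h3
    have n := cω.nonneg s t h1 h2 h3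
    refine ⟨by positivity, cG.nonneg s t h1 h2 h3, ?_⟩
    rw [mixed_rpow n (cF.nonneg s t h1 h2 h3) hα0, Real.mul_rpow (by positivity) n, inv_rpow M hM,
      mul_comm M]
  refine (varNorm_le cH fun s t h1 h2 h3 => ?_).trans (ENNReal.ofReal_le_ofReal ?_)
  · obtain ⟨n1, n2, e⟩ := parts s t h1 h2 h3
    have := hB.remainder_le hα hα' hf hS (ha.trans h1) h2 (h3.trans hb)
      (fun r h4 h5 => hv r (h1.trans h4) (h5.trans h3))
      ((cω.mono le_rfl h1 h2 h3 le_rfl).trans hω)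
    refine this.trans (ENNReal.ofReal_le_ofReal ?_)
    rw [Real.mul_rpow (by positivity) (by positivity), inv_rpow _ hK.le, ← e]
    exact mul_le_mul_of_nonneg_left (Real.add_rpow_le_rpow_add n1 n2 (by linarith)) hK.le
  · obtain ⟨n1, n2, e⟩ := parts a b le_rfl hab le_rfl
    rw [Real.mul_rpow (by positivity) (by positivity), inv_rpow _ hK.le, ← e, mul_assoc]
    exact mul_le_mul_of_nonneg_left (add_rpow_le_mul_add n1 n2 h3α.le) hK.le

/-- The increments of a solution in `W^{-1,p}`. -/
lemma IsRoughDriver.incr_le (hB : IsRoughDriver p α T B₁ B₂ ω) (hα : 1 / 3 < α)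
    (hα' : α ≤ 1 / 2) (hf : IntervalIntegrable f volume 0 T) (hS : SolvesRough T B₁ B₂ v f)
    {a b M : ℝ} (ha : 0 ≤ a) (hab : a ≤ b) (hb : b ≤ T) (hv : ∀ r, a ≤ r → r ≤ b → ‖v r‖ ≤ M)
    (hω : ω a b + (∫ r in a..b, ‖f r‖) ≤ 1 / 8) :
    negNorm p 1 (incr v a b) ≤ ENNReal.ofReal (smoothingConst d * (4 + remainderConst d α) *
      (1 + M) * ((∫ r in a..b, ‖f r‖) ^ α + ω a b ^ α)) := by
  have hM : 0 ≤ M := (norm_nonneg _).trans (hv a le_rfl hab)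
  have hα0 : 0 < α := by linarith
  have hK := remainderConst_pos d hα
  have hc := smoothingConst_pos d
  have hω0 := hB.control.nonneg a b ha hab hb
  have hF0 : 0 ≤ ∫ r in a..b, ‖f r‖ :=
    intervalIntegral.integral_nonneg hab fun _ _ => norm_nonneg _
  have hR := hB.remainder_le hα hα' hf hS ha hab hb hv (by linarith)
  set F := ∫ r in a..b, ‖f r‖ with hF
  set K := remainderConst d α
  set c := smoothingConst d
  set x := ω a b ^ α with hx
  set y := F ^ α with hy
  have hx0 : 0 ≤ x := Real.rpow_nonneg hω0 _
  have hy0 : 0 ≤ y := Real.rpow_nonneg hF0 _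
  have half : ∀ q : ℝ, 0 ≤ q → q ≤ 1 / 8 → q ^ α ≤ 1 / 2 := by
    intro q h0 h1
    calc q ^ α ≤ (1 / 8 : ℝ) ^ α := Real.rpow_le_rpow h0 h1 hα0.le
      _ ≤ (1 / 8 : ℝ) ^ (1 / 3 : ℝ) :=
        Real.rpow_le_rpow_of_exponent_ge (by norm_num) (by norm_num) hα.le
      _ = 1 / 2 := by
        rw [show (1 / 8 : ℝ) = (1 / 2) ^ (3 : ℝ) by norm_num, ← Real.rpow_mul (by norm_num)]
        norm_num
  have hη1 : y + x ≤ 1 := by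
    have := half _ hω0 (by linarith)
    have := half _ hF0 (by linarith)
    linarith
  have hx2 : ω a b ^ (2 * α) = x ^ 2 := by
    rw [hx, ← Real.rpow_natCast, ← Real.rpow_mul hω0]; congr 1; push_cast; ring
  have hx3 : ω a b ^ (3 * α) = x ^ 3 := by
    rw [hx, ← Real.rpow_natCast, ← Real.rpow_mul hω0]; congr 1; push_cast; ring
  rw [hx3] at hR
  -- Uses `F ≤ 1` and `2α ≤ 1`.
  have hFy : F ≤ y ^ 2 := by
    rcases hF0.eq_or_lt with h | h
    · rw [← h]; positivity
    · rw [hy, ← Real.rpow_natCast, ← Real.rpow_mul hF0]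
      nth_rewrite 1 [← Real.rpow_one F]
      exact Real.rpow_le_rpow_of_exponent_ge h (by linarith) (by push_cast; linarith)
  -- The intended scale is `η = F^α + ω^α`, at most `1` because each summand is at most `(1/8)^{1/3}
  -- = 1/2`. Stating the bound for all larger `η` also covers the case where this sum is zero, by
  -- letting `η` tend to `0`.
  have main : ∀ η : ℝ, 0 < η → η ≤ 1 → y + x ≤ η →
      negNorm p 1 (incr v a b) ≤ ENNReal.ofReal (c * (4 + K) * (1 + M) * η) := by
    intro η hη hη1 hle
    have h := (hB.interpolation (f := f) ha hab hb (hv a le_rfl hab) (hv b hab le_rfl) hη hη1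
      (by positivity) hR).2
    refine h.trans (ENNReal.ofReal_le_ofReal ?_)
    have e : c * (4 + K) * (1 + M) * η = c * ((4 + K) * ((1 + M) * η)) := by ring
    rw [hx2, e]
    refine mul_le_mul_of_nonneg_left ?_ hc.le
    have hxη : x ≤ η := by linarith
    have hyη : y ≤ η := by linarith
    have i1 : (F + x ^ 2 * M) / η ≤ y + x * M := by
      rw [div_le_iff₀ hη]
      have : y ^ 2 ≤ y * η := by nlinarith
      have : x ^ 2 * M ≤ x * M * η := by nlinarith [mul_nonneg hx0 hM]
      nlinarith
    have i2 : K * (x ^ 3 * M + x * F) / η ^ 2 ≤ K * (x * M + y) := by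
      rw [div_le_iff₀ (by positivity), mul_assoc]
      refine mul_le_mul_of_nonneg_left ?_ hK.le
      have j1 : x ^ 2 ≤ η ^ 2 := pow_le_pow_left₀ hx0 hxη 2
      have j2 : x * y ≤ η ^ 2 := by nlinarith
      have j3 : x ^ 3 * M ≤ x * M * η ^ 2 := by
        have := mul_le_mul_of_nonneg_left j1 (mul_nonneg hx0 hM)
        nlinarith
      have j4 : x * F ≤ y * η ^ 2 := by
        have := mul_le_mul_of_nonneg_left j2 hy0
        have := mul_le_mul_of_nonneg_left hFy hx0
        nlinarith
      linarith
    have k1 : x * M ≤ η * M := mul_le_mul_of_nonneg_right hxη hM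
    have k2 : K * (x * M + y) ≤ K * (η * M + η) := mul_le_mul_of_nonneg_left (by linarith) hK.le
    nlinarith
  rcases (add_nonneg hy0 hx0).eq_or_lt with h | h
  · rw [← h, mul_zero, ENNReal.ofReal_zero]
    refine ENNReal.le_of_forall_pos_le_add fun ε hε _ => ?_
    have hD : 0 < c * (4 + K) * (1 + M) := by positivity
    set D := c * (4 + K) * (1 + M)
    have hε' : (0 : ℝ) < ε := hε
    have := main (min 1 (ε / D)) (by positivity) (min_le_left _ _) (by rw [← h]; positivity)
    rw [zero_add, ← ENNReal.ofReal_coe_nnreal]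
    refine this.trans (ENNReal.ofReal_le_ofReal ?_)
    calc D * min 1 (ε / D) ≤ D * (ε / D) := by gcongr; exact min_le_right _ _
      _ = ε := by field_simp
  · exact main _ h hη1 le_rfl

/-- The variation estimate for the increments of a solution. -/
lemma IsRoughDriver.varNorm_incr_le (hB : IsRoughDriver p α T B₁ B₂ ω) (hα : 1 / 3 < α)
    (hα' : α ≤ 1 / 2) (hf : IntervalIntegrable f volume 0 T) (hS : SolvesRough T B₁ B₂ v f)
    {a b M : ℝ} (ha : 0 ≤ a) (hab : a ≤ b) (hb : b ≤ T) (hv : ∀ r, a ≤ r → r ≤ b → ‖v r‖ ≤ M)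
    (hω : ω a b + (∫ r in a..b, ‖f r‖) ≤ 1 / 8) :
    varNorm (sobNorm p (-1)) α a b (incr v) ≤
      ENNReal.ofReal (2 * (smoothingConst d * (4 + remainderConst d α)) * (1 + M) *
        ((∫ r in a..b, ‖f r‖) ^ α + ω a b ^ α)) := by
  have hM : 0 ≤ M := (norm_nonneg _).trans (hv a le_rfl hab)
  have hT : 0 ≤ T := ha.trans (hab.trans hb)
  have hα0 : 0 < α := by linarith
  have hK := remainderConst_pos d hα
  have hc := smoothingConst_pos d
  have cω := hB.control.restrict ha hb
  have cF := (IsControl.integral (g := fun r => ‖f r‖) hT hf.norm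
    (fun _ => norm_nonneg _)).restrict ha hb
  set D := smoothingConst d * (4 + remainderConst d α)
  have hD : 0 < D := by positivity
  have hE : 0 ≤ 2 * D * (1 + M) := by positivity
  -- The factor `2` comes from `F^α + ω^α ≤ 2 (F + ω)^α`; on `[a,b]` the way back is free, since `α
  -- ≤ 1`.
  have cH := (cF.add cω).const_mul (Real.rpow_nonneg hE (1 / α))
  have pw : ∀ s t, a ≤ s → s ≤ t → t ≤ b →
      ((2 * D * (1 + M)) ^ (1 / α) * ((∫ r in s..t, ‖f r‖) + ω s t)) ^ α
        = 2 * D * (1 + M) * ((∫ r in s..t, ‖f r‖) + ω s t) ^ α := by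
    intro s t h1 h2 h3
    rw [Real.mul_rpow (by positivity) ((cF.add cω).nonneg s t h1 h2 h3), ← Real.rpow_mul hE,
      one_div_mul_cancel hα0.ne', Real.rpow_one]
  refine (varNorm_le cH fun s t h1 h2 h3 => ?_).trans (ENNReal.ofReal_le_ofReal ?_)
  · have n1 := cω.nonneg s t h1 h2 h3
    have n2 := cF.nonneg s t h1 h2 h3
    have m1 := cω.mono le_rfl h1 h2 h3 le_rfl
    have m2 := cF.mono le_rfl h1 h2 h3 le_rfl
    refine (hB.incr_le hα hα' hf hS (ha.trans h1) h2 (h3.trans hb)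
      (fun r h4 h5 => hv r (h1.trans h4) (h5.trans h3)) (by linarith)).trans
      (ENNReal.ofReal_le_ofReal ?_)
    rw [pw s t h1 h2 h3]
    have e1 : ω s t ^ α ≤ ((∫ r in s..t, ‖f r‖) + ω s t) ^ α :=
      Real.rpow_le_rpow n1 (by linarith) hα0.le
    have e2 : (∫ r in s..t, ‖f r‖) ^ α ≤ ((∫ r in s..t, ‖f r‖) + ω s t) ^ α :=
      Real.rpow_le_rpow n2 (by linarith) hα0.le
    have : 0 ≤ D * (1 + M) := by positivity
    nlinarith
  · rw [pw a b le_rfl hab le_rfl]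
    exact mul_le_mul_of_nonneg_left (Real.rpow_add_le_add_rpow (cF.nonneg a b le_rfl hab le_rfl)
      (cω.nonneg a b le_rfl hab le_rfl) hα0.le (by linarith)) hE

end Solution

end RoughPDE

/-! ### Conclusion -/

theorem proposition3p5 (d : ℕ) (α : ℝ) (hα : 1 / 3 < α) (hα' : α ≤ 1 / 2) :
    ∃ C > (0 : ℝ), ∃ L > (0 : ℝ), ∀ (p : ℝ≥0∞) [Fact (1 ≤ p)] (T : ℝ), 0 < T →
      ∀ (B₁ B₂ : ℝ → ℝ → RoughPDE.Dist d →ₗ[ℝ] RoughPDE.Dist d) (ω : ℝ → ℝ → ℝ),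
      RoughPDE.IsRoughDriver p α T B₁ B₂ ω →
      ∀ (v : ℝ → RoughPDE.LpSp d p), eLpNorm v ∞ (volume.restrict (Icc 0 T)) < ∞ →
      ∀ (f : ℝ → RoughPDE.NegSobolev d 2 p), MemLp f p (volume.restrict (Icc 0 T)) →
      RoughPDE.SolvesRough T B₁ B₂ v f →
        RoughPDE.LocFiniteVar (RoughPDE.sobNorm p (-3)) (3 * α) T (RoughPDE.remainder B₁ B₂ v f) ∧
        (∀ s t, 0 ≤ s → s ≤ t → t ≤ T → ω s t ≤ L →
          RoughPDE.varNorm (RoughPDE.sobNorm p (-3)) (3 * α) s t (RoughPDE.remainder B₁ B₂ v f) ≤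
            ENNReal.ofReal (C *
              (ω s t ^ (3 * α) * (eLpNorm v ∞ (volume.restrict (Icc s t))).toReal +
                ω s t ^ α * ∫ r in s..t, ‖f r‖))) ∧
        (∀ s t, 0 ≤ s → s ≤ t → t ≤ T → ω s t + (∫ r in s..t, ‖f r‖) ≤ L →
          RoughPDE.varNorm (RoughPDE.sobNorm p (-1)) α s t (RoughPDE.incr v) ≤
            ENNReal.ofReal (C * (1 + (eLpNorm v ∞ (volume.restrict (Icc s t))).toReal) *
              ((∫ r in s..t, ‖f r‖) ^ α + ω s t ^ α))) := by
  have hα0 : 0 < α := by linarith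
  have hK := RoughPDE.remainderConst_pos d hα
  have hc := RoughPDE.smoothingConst_pos d
  have hC₁ : 0 < RoughPDE.remainderConst d α * 2 ^ (3 * α) := by positivity
  have hC₂ : 0 < 2 * (RoughPDE.smoothingConst d * (4 + RoughPDE.remainderConst d α)) := by
    positivity
  refine ⟨RoughPDE.remainderConst d α * 2 ^ (3 * α)
    + 2 * (RoughPDE.smoothingConst d * (4 + RoughPDE.remainderConst d α)), by positivity,
    1 / 8, by norm_num, ?_⟩
  intro p hp T hT B₁ B₂ ω hB v hv f hf hS
  have hfi : IntervalIntegrable f volume 0 T := by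
    rw [intervalIntegrable_iff_integrableOn_Icc_of_le hT.le]
    exact memLp_one_iff_integrable.1 (hf.mono_exponent hp.out)
  have nF : ∀ s t, s ≤ t → 0 ≤ ∫ r in s..t, ‖f r‖ := fun s t h =>
    intervalIntegral.integral_nonneg h fun _ _ => norm_nonneg _
  have hbd : ∀ a b, 0 ≤ a → a < b → b ≤ T → ∀ r, a ≤ r → r ≤ b →
      ‖v r‖ ≤ (eLpNorm v ∞ (volume.restrict (Icc a b))).toReal :=
    fun a b ha hab hb r h1 h2 => hB.norm_le_essSup hα0 hfi hS hv ha hab hb h1 h2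
  refine ⟨?_, ?_, ?_⟩
  · intro r hr
    obtain ⟨δ, hδ, hsmall⟩ := hB.control.exists_small (show (0 : ℝ) < 1 / 3 by norm_num)
    have h1 : 0 ≤ max 0 (r - δ / 2) := le_max_left _ _
    have h2 : max 0 (r - δ / 2) ≤ r := max_le hr.1 (by linarith)
    have h3 : r ≤ min T (r + δ / 2) := le_min hr.2 (by linarith)
    have h4 : min T (r + δ / 2) ≤ T := min_le_left _ _
    refine ⟨δ / 2, by positivity, ?_⟩
    refine (hB.varNorm_remainder_le hα hα' hfi hS h1 (h2.trans h3) h4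
      (fun x hx hx' => hbd 0 T le_rfl hT le_rfl x (h1.trans hx) (hx'.trans h4))
      (hsmall _ _ h1 (h2.trans h3) h4 ?_)).trans_lt ENNReal.ofReal_lt_top
    have := le_max_right 0 (r - δ / 2)
    have := min_le_right T (r + δ / 2)
    linarith
  · intro s t hs hst ht hω
    have n := hB.control.nonneg s t hs hst ht
    have nF' := nF s t hst
    -- On a degenerate interval the essential supremum does not see `v s`; the estimate is applied
    -- with `M = ‖v s‖`, and its right side is zero anyway.
    rcases hst.eq_or_lt with rfl | hlt
    · refine (hB.varNorm_remainder_le hα hα' hfi hS hs le_rfl ht (M := ‖v s‖)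
        (fun r h1 h2 => by rw [le_antisymm h2 h1]) (by linarith)).trans
        (ENNReal.ofReal_le_ofReal ?_)
      rw [hB.control.diag hs ht, Real.zero_rpow (by positivity), Real.zero_rpow hα0.ne']
      simp
    · refine (hB.varNorm_remainder_le hα hα' hfi hS hs hst ht
        (hbd s t hs hlt ht) (by linarith)).trans (ENNReal.ofReal_le_ofReal ?_)
      refine mul_le_mul_of_nonneg_right (by linarith) ?_
      positivity
  · intro s t hs hst ht hω
    have n := hB.control.nonneg s t hs hst ht
    have nF' := nF s t hst
    rcases hst.eq_or_lt with rfl | hlt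
    · refine (hB.varNorm_incr_le hα hα' hfi hS hs le_rfl ht (M := ‖v s‖)
        (fun r h1 h2 => by rw [le_antisymm h2 h1]) hω).trans
        (ENNReal.ofReal_le_ofReal ?_)
      rw [hB.control.diag hs ht, intervalIntegral.integral_same, Real.zero_rpow hα0.ne']
      simp
    · refine (hB.varNorm_incr_le hα hα' hfi hS hs hst ht
        (hbd s t hs hlt ht) hω).trans (ENNReal.ofReal_le_ofReal ?_)
      refine mul_le_mul_of_nonneg_right (mul_le_mul_of_nonneg_right (by linarith) ?_) ?_ <;>
      positivity
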